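/- Let $H^1=\mathbb R^3$ be the Heisenberg group with product $(x,y,t)(x_0,y_0,t_0)=(x+x_0,\,y+y_0,\,t+t_0+2(yx_0-xy_0))$, let $X=\partial_x+2y\,\partial_t$, $Y=\partial_y-2x\,\partial_t$ and $\Delta_{H^1}=X^2+Y^2$. Let $\Omega\subseteq H^1$ be open and connected (for instance $\Omega=H^1$), let $I\subseteq\mathbb R$ be an open interval, both nonempty, and let $f$ be smooth on $I$. Consider the equation $$\Delta_{H^1}u+f(u)=u_{xx}+u_{yy}+4(x^2+y^2)u_{tt}+4y\,u_{xt}-4x\,u_{yt}+f(u)=0,\qquad (x,y,t)\in\Omega,\ u\in I .\qquad(1)$$ The Lie point symmetry algebra of (1) consists of the smooth vector fields $S=\xi\partial_x+\phi\partial_y+\tau\partial_t+\eta\partial_u$ on $\Omega\times I$, with coefficients depending on $(x,y,t,u)$, whose second-order prolongation $\hat S$ satisfies $\hat S H=0$ at all second-order jets over $\Omega\times I$ with $H=0$, where $H=\Delta_{H^1}u+f(u)$. **Theorem.** Let $$T=\partial_t,\quad R=y\,\partial_x-x\,\partial_y,\quad \tilde X=\partial_x-2y\,\partial_t,\quad \tilde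 Y=\partial_y+2x\,\partial_t ,$$ the generators of the translations in $t$, of the rotations in the $(x,y)$-plane, and of the one-parameter groups $p\mapsto(s,0,0)p$ and $p\mapsto(0,s,0)p$ of $H^1$. These four fields belong to the symmetry algebra of (1) for every $f$, and a vector field that is a symmetry of (1) for every smooth $f$ is a linear combination of them. The symmetry algebra of (1) is strictly larger than their span if and only if, after some affine change of the unknown $v=au+b$ with $a\ne0$ (which turns (1) into $\Delta_{H^1}v+a f((v-b)/a)=0$), the nonlinearity is one of $c$, $ku$, $ku^p$, $ke^u$ of the following list (with constants $c$, $k\neq 0$, and $p\ne0,1$ real). In the listed cases the symmetry algebra is spanned by $T,R,\tilde X,\tilde Y$ and the following additional generators. (i) If $f(u)=0$: $$V_1=(xt-x^2y-y^3)\partial_x+(yt+x^3+xy^2)\partial_y+(t^2-(x^2+y^2)^2)\partial_t-tu\,\partial_u,$$ $$V_2=(t-4xy)\partial_x+(3x^2-y^2)\partial_y-(2yt+2x^3+2xy^2)\partial_t+2yu\,\partial_u,$$ $$V_3=(x^2-3y^2)\partial_x+(t+4xy)\partial_y+(2xt-2x^2y-2y^3)\partial_t-2xu\,\partial_u,$$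 $$Z_1=x\partial_x+y\partial_y+2t\partial_t,\qquad Z_2=u\,\partial_u,\qquad W=\beta(x,y,t)\,\partial_u\ \text{ with } \Delta_{H^1}\beta=0 \text{ on } \Omega .$$ (ii) If $f(u)=c$ is constant, the equation is reduced to case (i) by the change $u=v-cx^2/2$: a function $u$ solves $\Delta_{H^1}u+c=0$ on $\Omega$ if and only if $v=u+cx^2/2$ solves $\Delta_{H^1}v=0$, and the symmetry algebra is spanned by the pullbacks under $(x,y,t,u)\mapsto(x,y,t,u+cx^2/2)$ of all the generators for $f=0$ (including $T,R,\tilde X,\tilde Y$; here these pullbacks replace the original generators). (iii) If $f(u)=ku$, $k\ne0$: $Z_2=u\,\partial_u$ and $W=\beta(x,y,t)\,\partial_u$ with $\Delta_{H^1}\beta+k\beta=0$ on $\Omega$. (iv) If $f(u)=ku^p$, $k\neq0$, $p\ne0,1$, where $I\subseteq(0,\infty)$, or $p$ is a nonnegative integer, or $p$ is an integer and $0\notin I$: the dilation $$Z=x\partial_x+y\partial_y+2t\partial_t+\frac{2}{1-p}\,u\,\partial_u ;$$ in the critical case $p=3$ also $V_1,V_2,V_3$. (v) If $f(u)=ke^u$,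 $k\ne0$: $Z_3=x\partial_x+y\partial_y+2t\partial_t-2\partial_u$. -/

import Mathlib

open scoped ContDiff

noncomputable section

namespace Heis

/-! ### The Heisenberg group and the Kohn-Laplace operator -/

/-- The space underlying the Heisenberg group, with coordinates
`x = p 0`, `y = p 1`, `t = p 2`. Only its smooth structure is used. -/
abbrev H1 := Fin 3 → ℝ

/-- The product of the Heisenberg group. -/
def mul (p q : H1) : H1 :=
  ![p 0 + q 0, p 1 + q 1, p 2 + q 2 + 2 * (p 1 * q 0 - p 0 * q 1)]

/-- The `i`-th coordinate direction. -/
def e (i : Fin 3) : H1 := Pi.single i 1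

/-- The `i`-th partial derivative of a function on the Heisenberg group. -/
def pd (i : Fin 3) (w : H1 → ℝ) (p : H1) : ℝ := fderiv ℝ w p (e i)

/-- The left-invariant operator `X = ∂ₓ + 2 y ∂ₜ`. -/
def opX (w : H1 → ℝ) (p : H1) : ℝ := pd 0 w p + 2 * p 1 * pd 2 w p

/-- The left-invariant operator `Y = ∂ᵧ - 2 x ∂ₜ`. -/
def opY (w : H1 → ℝ) (p : H1) : ℝ := pd 1 w p - 2 * p 0 * pd 2 w p

/-- The Kohn-Laplace operator `X² + Y²`. -/
def kohnLaplace (w : H1 → ℝ) (p : H1) : ℝ := opX (opX w) p + opY (opY w) p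

/-- `w` is a classical solution of `Δw + f(w) = 0` on `Ω`. -/
def IsSolution (Ω : Set H1) (f : ℝ → ℝ) (w : H1 → ℝ) : Prop :=
  ContDiffOn ℝ 2 w Ω ∧ ∀ p ∈ Ω, kohnLaplace w p + f (w p) = 0

/-! ### Jets, prolongations and Lie point symmetries -/

/-- First order jets `(p, u, (uᵢ))`. -/
abbrev Jet1 := H1 × ℝ × (Fin 3 → ℝ)

/-- Second order jets `(p, u, (uᵢ), (uᵢⱼ))`; genuine jets have symmetric `(uᵢⱼ)`. -/
abbrev Jet2 := H1 × ℝ × (Fin 3 → ℝ) × (Fin 3 → Fin 3 → ℝ)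

/-- The 2-jet at `p` of a function `w`. -/
def jet2 (w : H1 → ℝ) (p : H1) : Jet2 :=
  (p, w p, fun i => pd i w p, fun i j => pd i (pd j w) p)

/-- Vector fields `ξ ∂ₓ + φ ∂ᵧ + τ ∂ₜ + η ∂ᵤ` on the space of the independent variables `p` and
the dependent variable `u`; all the coefficients are functions of `(p, u)`.
The value at `(p, u)` is `((ξ, φ, τ), η)`. -/
abbrev VField := H1 × ℝ → H1 × ℝ

/-- The total derivative `Dᵢ g = ∂ᵢ g + uᵢ ∂ᵤ g` of a function `g` of `(p, u)`. -/
def totalD0 (i : Fin 3) (g : H1 × ℝ → ℝ) (z : Jet1) : ℝ :=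
  fderiv ℝ g (z.1, z.2.1) (e i, z.2.2 i)

/-- The total derivative `Dⱼ F = ∂ⱼ F + uⱼ ∂F/∂u + ∑ₖ uⱼₖ ∂F/∂uₖ` of a function of first order
jets. -/
def totalD1 (j : Fin 3) (F : Jet1 → ℝ) (z : Jet2) : ℝ :=
  fderiv ℝ F (z.1, z.2.1, z.2.2.1) (e j, z.2.2.1 j, z.2.2.2 j)

/-- First extension coefficients `η⁽¹⁾ᵢ = Dᵢ η - ∑ₖ uₖ Dᵢ ξₖ`. -/
def ext1 (V : VField) (i : Fin 3) (z : Jet1) : ℝ :=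
  totalD0 i (fun q => (V q).2) z - ∑ k, z.2.2 k * totalD0 i (fun q => (V q).1 k) z

/-- Second extension coefficients `η⁽²⁾ᵢⱼ = Dⱼ η⁽¹⁾ᵢ - ∑ₖ uᵢₖ Dⱼ ξₖ`. -/
def ext2 (V : VField) (i j : Fin 3) (z : Jet2) : ℝ :=
  totalD1 j (ext1 V i) z -
    ∑ k, z.2.2.2 i k * totalD0 j (fun q => (V q).1 k) (z.1, z.2.1, z.2.2.1)

/-- The second order extension (prolongation) of a vector field, a vector field on 2-jets. -/
def prolong (V : VField) (z : Jet2) : Jet2 :=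
  ((V (z.1, z.2.1)).1, (V (z.1, z.2.1)).2,
    fun i => ext1 V i (z.1, z.2.1, z.2.2.1), fun i j => ext2 V i j z)

/-- `V` generates Lie point symmetries, over the domain `D`, of the second order equation
`H (p, u, uᵢ, uᵢⱼ) = 0`: it is a smooth vector field on `D` and its second extension annihilates
`H` at all jets over `D` at which `H` vanishes. -/
def IsLieSymmetry (D : Set (H1 × ℝ)) (H : Jet2 → ℝ) (V : VField) : Prop :=
  ContDiffOn ℝ ∞ V D ∧
    ∀ z : Jet2, (z.1, z.2.1) ∈ D → (∀ i j, z.2.2.2 i j = z.2.2.2 j i) → H z = 0 →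
      fderiv ℝ H z (prolong V z) = 0

/-- The equation `Δu + f(u) = 0` as a function on 2-jets,
`uₓₓ + uᵧᵧ + 4(x² + y²)uₜₜ + 4y uₓₜ - 4x uᵧₜ + f(u)` (see `kohnEq_jet2`). -/
def kohnEq (f : ℝ → ℝ) (z : Jet2) : ℝ :=
  z.2.2.2 0 0 + z.2.2.2 1 1 + 4 * ((z.1 0) ^ 2 + (z.1 1) ^ 2) * z.2.2.2 2 2
    + 4 * z.1 1 * z.2.2.2 0 2 - 4 * z.1 0 * z.2.2.2 1 2 + f z.2.1

/-- `V` is the generator of a Lie point symmetry of `Δu + f(u) = 0` for `p ∈ Ω`, `u ∈ I`. -/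
def IsSym (Ω : Set H1) (I : Set ℝ) (f : ℝ → ℝ) (V : VField) : Prop :=
  IsLieSymmetry (Ω ×ˢ I) (kohnEq f) V

/-- `V` coincides on `D` with a (finite) real linear combination of fields in `S`. -/
def SpannedOn (D : Set (H1 × ℝ)) (S : Set VField) (V : VField) : Prop :=
  ∃ W ∈ Submodule.span ℝ S, Set.EqOn V W D

/-- The symmetry algebra of `Δu + f(u) = 0` over `Ω × I` is the linear span of `S`. -/
def SymSpannedBy (Ω : Set H1) (I : Set ℝ) (f : ℝ → ℝ) (S : Set VField) : Prop :=
  ∀ V : VField, IsSym Ω I f V ↔ SpannedOn (Ω ×ˢ I) S V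

/-! ### The generators -/

def fieldT : VField := fun _ => (![0, 0, 1], 0)

def fieldR : VField := fun z => (![z.1 1, -z.1 0, 0], 0)

def fieldX : VField := fun z => (![1, 0, -2 * z.1 1], 0)

def fieldY : VField := fun z => (![0, 1, 2 * z.1 0], 0)

def fieldV1 : VField := fun z =>
  let x := z.1 0; let y := z.1 1; let t := z.1 2; let u := z.2
  (![x * t - x ^ 2 * y - y ^ 3, y * t + x ^ 3 + x * y ^ 2, t ^ 2 - (x ^ 2 + y ^ 2) ^ 2], -t * u)

def fieldV2 : VField := fun z =>
  let x := z.1 0; let y := z.1 1; let t := z.1 2; let u := z.2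
  (![t - 4 * x * y, 3 * x ^ 2 - y ^ 2, -(2 * y * t + 2 * x ^ 3 + 2 * x * y ^ 2)], 2 * y * u)

def fieldV3 : VField := fun z =>
  let x := z.1 0; let y := z.1 1; let t := z.1 2; let u := z.2
  (![x ^ 2 - 3 * y ^ 2, t + 4 * x * y, 2 * x * t - 2 * x ^ 2 * y - 2 * y ^ 3], -2 * x * u)

/-- `Z₁ = x ∂ₓ + y ∂ᵧ + 2t ∂ₜ`. -/
def fieldZ1 : VField := fun z => (![z.1 0, z.1 1, 2 * z.1 2], 0)

/-- `Z₂ = u ∂ᵤ`. -/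
def fieldZ2 : VField := fun z => (0, z.2)

/-- `Z₃ = x ∂ₓ + y ∂ᵧ + 2t ∂ₜ - 2 ∂ᵤ`. -/
def fieldZ3 : VField := fun z => (![z.1 0, z.1 1, 2 * z.1 2], -2)

/-- `Z = x ∂ₓ + y ∂ᵧ + 2t ∂ₜ + 2/(1-p) u ∂ᵤ`. -/
def fieldZ (p : ℝ) : VField := fun z => (![z.1 0, z.1 1, 2 * z.1 2], 2 / (1 - p) * z.2)

/-- The fields `β(x,y,t) ∂ᵤ` with `Δβ + kβ = 0` on `Ω`. -/
def fieldsW (Ω : Set H1) (k : ℝ) : Set VField :=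
  {V | ∃ β : H1 → ℝ, ContDiffOn ℝ ∞ β Ω ∧ (∀ p ∈ Ω, kohnLaplace β p + k * β p = 0) ∧
    V = fun z => (0, β z.1)}

/-- The four generators admitted for every `f`. -/
def basic : Set VField := {fieldT, fieldR, fieldX, fieldY}

/-- The generators for `f = 0`. -/
def gensZero (Ω : Set H1) : Set VField :=
  basic ∪ {fieldV1, fieldV2, fieldV3, fieldZ1, fieldZ2} ∪ fieldsW Ω 0

/-- The one-parameter group `Φ` of transformations of the Heisenberg group, acting trivially
on `u`, has generator `V`. -/
def IsFlow (Φ : ℝ → H1 → H1) (V : VField) : Prop :=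
  ∀ (p : H1) (u : ℝ), Φ 0 p = p ∧
    ∀ s : ℝ, HasDerivAt (fun r => (Φ r p, u)) (V (Φ s p, u)) s

/-! ### The list of special right-hand sides -/

/-- The real power `u ↦ u ^ p` has its usual meaning and is smooth on `I`. -/
def PowerDomain (p : ℝ) (I : Set ℝ) : Prop :=
  I ⊆ Set.Ioi 0 ∨ (∃ n : ℕ, p = n) ∨ ((∃ n : ℤ, p = n) ∧ (0 : ℝ) ∉ I)

/-- `f` is on `I` one of the functions `c`, `ku`, `ku^p`, `ke^u`. -/
def IsListed (I : Set ℝ) (f : ℝ → ℝ) : Prop :=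
  (∃ c : ℝ, ∀ u ∈ I, f u = c) ∨
  (∃ k : ℝ, k ≠ 0 ∧ ∀ u ∈ I, f u = k * u) ∨
  (∃ k p : ℝ, k ≠ 0 ∧ p ≠ 0 ∧ p ≠ 1 ∧ PowerDomain p I ∧ ∀ u ∈ I, f u = k * u ^ p) ∨
  (∃ k : ℝ, k ≠ 0 ∧ ∀ u ∈ I, f u = k * Real.exp u)

/-- Some change of the unknown `v = a u + b`, `a ≠ 0`, which carries `Δu + f(u) = 0` into
`Δv + a f((v - b)/a) = 0`, brings the right-hand side into the list. -/
def IsEquivListed (I : Set ℝ) (f : ℝ → ℝ) : Prop :=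
  ∃ a b : ℝ, a ≠ 0 ∧ IsListed ((fun u => a * u + b) '' I) (fun v => a * f ((v - b) / a))

/-- The change of the unknown `v = u + c x² / 2`, as a map `(p, u) ↦ (p, v)`. -/
def shift (c : ℝ) (z : H1 × ℝ) : H1 × ℝ := (z.1, z.2 + c * (z.1 0) ^ 2 / 2)

/-! ### The function `kohnEq f` on jets represents the Kohn-Laplace equation -/

theorem kohnEq_jet2 (f : ℝ → ℝ) {w : H1 → ℝ} {p : H1} (hw : ContDiffAt ℝ 2 w p) :
    kohnEq f (jet2 w p) = kohnLaplace w p + f (w p) := by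
  have hd : DifferentiableAt ℝ (fderiv ℝ w) p :=
    (hw.fderiv_right (m := 1) (by norm_num)).differentiableAt (by norm_num)
  have hpd : ∀ i, DifferentiableAt ℝ (pd i w) p := fun i =>
    hd.clm_apply (differentiableAt_const _)
  have hc : ∀ k : Fin 3, DifferentiableAt ℝ (fun q : H1 => q k) p := fun k => by fun_prop
  have hfc : ∀ k : Fin 3, fderiv ℝ (fun q : H1 => q k) p = ContinuousLinearMap.proj k := fun k =>
    (ContinuousLinearMap.proj (R := ℝ) (φ := fun _ : Fin 3 => ℝ) k).fderiv
  have hsymm : ∀ i j, pd i (pd j w) p = pd j (pd i w) p := by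
    intro i j
    have h := hw.isSymmSndFDerivAt (by simp)
    have hh : ∀ a b, pd a (pd b w) p = fderiv ℝ (fderiv ℝ w) p (e a) (e b) := by
      intro a b
      have : HasFDerivAt (pd b w) _ p := hd.hasFDerivAt.clm_apply (hasFDerivAt_const (e b) p)
      rw [pd, this.fderiv]; simp
    rw [hh, hh]; exact h _ _
  have hX : ∀ i, pd i (opX w) p = pd i (pd 0 w) p + 2 * p 1 * pd i (pd 2 w) p
      + 2 * (e i 1) * pd 2 w p := by
    intro i
    have h := (hpd 0).hasFDerivAt.add (((hc 1).hasFDerivAt.const_mul 2).mul (hpd 2).hasFDerivAt)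
    have h' : HasFDerivAt (opX w) _ p := h
    rw [pd, h'.fderiv, hfc]; simp [pd]; ring
  have hY : ∀ i, pd i (opY w) p = pd i (pd 1 w) p - 2 * p 0 * pd i (pd 2 w) p
      - 2 * (e i 0) * pd 2 w p := by
    intro i
    have h := (hpd 1).hasFDerivAt.sub (((hc 0).hasFDerivAt.const_mul 2).mul (hpd 2).hasFDerivAt)
    have h' : HasFDerivAt (opY w) _ p := h
    rw [pd, h'.fderiv, hfc]; simp [pd]; ring
  have e01 : e 0 1 = 0 := by simp [e]
  have e21 : e 2 1 = 0 := by simp [e]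
  have e10 : e 1 0 = 0 := by simp [e]
  have e20 : e 2 0 = 0 := by simp [e]
  simp only [kohnEq, jet2, kohnLaplace]
  rw [opX, opY, hX, hX, hY, hY, e01, e21, e10, e20, hsymm 2 0, hsymm 2 1]
  ring

end Heis

end

open Heis

namespace Heis

/-! ### Partial derivatives on the Heisenberg group -/

/-! Once the equation is solved for `u_xx`, the remaining jet coordinates are free and the symmetry
condition is polynomial in the derivatives of `u`, so each of its coefficients vanishes. The
products of first and second derivatives and the squares of first derivatives show that the spatial
components do not depend on `u` and that the vertical one is affine, `α u + β`
(`IsSym.exists_eq_affineField`). The other coefficients form the system `Determining`: the spatial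
part is a conformal contact field, its components tie the gradient of `α` to the conformal factor,
and one scalar equation involves `f`.

Conformal contact fields are rigid. Repeated use of `[X, Y] = -4T` makes the system for the
components closed, and integrating it gives an explicit eight-parameter family of polynomial fields
(`conformal_field_eq`). If `m` is the conformal factor, the relations for `α` force `α = a - m/2`
with `a` constant. Hence every symmetry is some `genField c a β`, subject only to `Δβ + ((a - m/2) u
+ β) f' + (3m/2 - a) f = 0` on `Ω × I` (`isSym_iff_exists`).

For a listed `f` this equation is separated according to its dependence on `u`, and the surviving
parameters are the generators. The critical power 3 is the one for which `m` drops out. Constants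
reduce to `f = 0` by a shift of the unknown.

For the classification (`isEquivListed_of_determining`), the equation is read at each point as a
linear ordinary differential equation for `f`. If `f` is not affine, two such equations are either
proportional or incompatible. One proportional family is Euler's equation up to an inhomogeneity,
the other is `f = l f' + n`. Proportionality also makes `β` affine in `α`, hence `Δβ = 0` since `Δα
= 0`, and the inhomogeneity disappears. The solutions are powers and exponentials of an affine
function of `u`; if the singular point of Euler's equation lies in `I`, smoothness forces a natural
exponent (`eq_monomial_of_euler`). -/

theorem pd_congr {Ω : Set H1} (hΩ : IsOpen Ω) {g h : H1 → ℝ} (i : Fin 3)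
    (hgh : ∀ q ∈ Ω, g q = h q) {p : H1} (hp : p ∈ Ω) : pd i g p = pd i h p := by
  have : g =ᶠ[nhds p] h := Filter.eventually_of_mem (hΩ.mem_nhds hp) hgh
  rw [pd, pd, this.fderiv_eq]

theorem pd_add {g h : H1 → ℝ} {p : H1} (i : Fin 3) (hg : DifferentiableAt ℝ g p)
    (hh : DifferentiableAt ℝ h p) : pd i (fun q => g q + h q) p = pd i g p + pd i h p := by
  rw [pd, fderiv_fun_add hg hh]; rfl

theorem pd_sub {g h : H1 → ℝ} {p : H1} (i : Fin 3) (hg : DifferentiableAt ℝ g p)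
    (hh : DifferentiableAt ℝ h p) : pd i (fun q => g q - h q) p = pd i g p - pd i h p := by
  rw [pd, fderiv_fun_sub hg hh]; rfl

theorem pd_mul {g h : H1 → ℝ} {p : H1} (i : Fin 3) (hg : DifferentiableAt ℝ g p)
    (hh : DifferentiableAt ℝ h p) :
    pd i (fun q => g q * h q) p = pd i g p * h p + g p * pd i h p := by
  rw [pd, fderiv_fun_mul hg hh]
  simp only [add_apply, smul_apply, smul_eq_mul, pd]
  ring

theorem pd_neg {g : H1 → ℝ} {p : H1} (i : Fin 3) :
    pd i (fun q => -g q) p = -pd i g p := by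
  rw [pd, fderiv_fun_neg]; rfl

theorem pd_const (c : ℝ) (i : Fin 3) (p : H1) : pd i (fun _ => c) p = 0 := by
  simp [pd]

theorem pd_coord (i k : Fin 3) (p : H1) : pd i (fun q => q k) p = if k = i then 1 else 0 := by
  have : fderiv ℝ (fun q : H1 => q k) p = ContinuousLinearMap.proj k :=
    (ContinuousLinearMap.proj (R := ℝ) (φ := fun _ : Fin 3 => ℝ) k).fderiv
  rw [pd, this]; simp [e, Pi.single_apply]

theorem pd_pow {g : H1 → ℝ} {p : H1} (i : Fin 3) (n : ℕ) (hg : DifferentiableAt ℝ g p) :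
    pd i (fun q => g q ^ n) p = n * g p ^ (n - 1) * pd i g p := by
  rw [pd, (hg.hasFDerivAt.pow n).fderiv]
  simp [pd]

theorem contDiffOn_pd {Ω : Set H1} (hΩ : IsOpen Ω) {g : H1 → ℝ} (hg : ContDiffOn ℝ ∞ g Ω)
    (i : Fin 3) : ContDiffOn ℝ ∞ (pd i g) Ω :=
  ((contDiffOn_infty_iff_fderiv_of_isOpen hΩ).1 hg).2.clm_apply contDiffOn_const

theorem contDiffOn_coord (Ω : Set H1) (k : Fin 3) : ContDiffOn ℝ ∞ (fun q : H1 => q k) Ω := by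
  fun_prop

theorem differentiableAt_of_smooth {Ω : Set H1} (hΩ : IsOpen Ω) {g : H1 → ℝ}
    (hg : ContDiffOn ℝ ∞ g Ω) {p : H1} (hp : p ∈ Ω) : DifferentiableAt ℝ g p :=
  (hg.contDiffAt (hΩ.mem_nhds hp)).differentiableAt (by simp)

theorem pd_comm {g : H1 → ℝ} {p : H1} (hg : ContDiffAt ℝ 2 g p) (i j : Fin 3) :
    pd i (pd j g) p = pd j (pd i g) p := by
  have hd : DifferentiableAt ℝ (fderiv ℝ g) p :=
    (hg.fderiv_right (m := 1) (by norm_num)).differentiableAt (by norm_num)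
  have h := hg.isSymmSndFDerivAt (by simp)
  have hh : ∀ a b, pd a (pd b g) p = fderiv ℝ (fderiv ℝ g) p (e a) (e b) := by
    intro a b
    have : HasFDerivAt (pd b g) _ p := hd.hasFDerivAt.clm_apply (hasFDerivAt_const (e b) p)
    rw [pd, this.fderiv]; simp
  rw [hh, hh]; exact h _ _

theorem contDiffAt_two {Ω : Set H1} (hΩ : IsOpen Ω) {g : H1 → ℝ}
    (hg : ContDiffOn ℝ ∞ g Ω) {p : H1} (hp : p ∈ Ω) : ContDiffAt ℝ 2 g p :=
  contDiffAt_infty.1 (hg.contDiffAt (hΩ.mem_nhds hp)) 2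

theorem kohnLaplace_eq {g : H1 → ℝ} {p : H1} (hg : ContDiffAt ℝ 2 g p) :
    kohnLaplace g p = pd 0 (pd 0 g) p + pd 1 (pd 1 g) p
      + 4 * (p 0 ^ 2 + p 1 ^ 2) * pd 2 (pd 2 g) p
      + 4 * p 1 * pd 0 (pd 2 g) p - 4 * p 0 * pd 1 (pd 2 g) p := by
  have h := kohnEq_jet2 (fun _ => 0) hg
  simp only [kohnEq, jet2, add_zero] at h
  exact h.symm

/-! ### The left-invariant frame -/

theorem contDiffOn_opX {Ω : Set H1} (hΩ : IsOpen Ω) {g : H1 → ℝ} (hg : ContDiffOn ℝ ∞ g Ω) :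
    ContDiffOn ℝ ∞ (opX g) Ω :=
  (contDiffOn_pd hΩ hg 0).add
    ((contDiffOn_const.mul (contDiffOn_coord Ω 1)).mul (contDiffOn_pd hΩ hg 2))

theorem contDiffOn_opY {Ω : Set H1} (hΩ : IsOpen Ω) {g : H1 → ℝ} (hg : ContDiffOn ℝ ∞ g Ω) :
    ContDiffOn ℝ ∞ (opY g) Ω :=
  (contDiffOn_pd hΩ hg 1).sub
    ((contDiffOn_const.mul (contDiffOn_coord Ω 0)).mul (contDiffOn_pd hΩ hg 2))

theorem opX_congr {Ω : Set H1} (hΩ : IsOpen Ω) {g h : H1 → ℝ}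
    (hgh : ∀ q ∈ Ω, g q = h q) {p : H1} (hp : p ∈ Ω) : opX g p = opX h p := by
  rw [opX, opX, pd_congr hΩ 0 hgh hp, pd_congr hΩ 2 hgh hp]

theorem opY_congr {Ω : Set H1} (hΩ : IsOpen Ω) {g h : H1 → ℝ}
    (hgh : ∀ q ∈ Ω, g q = h q) {p : H1} (hp : p ∈ Ω) : opY g p = opY h p := by
  rw [opY, opY, pd_congr hΩ 1 hgh hp, pd_congr hΩ 2 hgh hp]

theorem kohnLaplace_congr {Ω : Set H1} (hΩ : IsOpen Ω) {g h : H1 → ℝ}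
    (hgh : ∀ q ∈ Ω, g q = h q) {p : H1} (hp : p ∈ Ω) : kohnLaplace g p = kohnLaplace h p := by
  rw [kohnLaplace, kohnLaplace, opX_congr hΩ (fun q hq => opX_congr hΩ hgh hq) hp,
    opY_congr hΩ (fun q hq => opY_congr hΩ hgh hq) hp]

theorem pd_opX {g : H1 → ℝ} {p : H1} (hg : ContDiffAt ℝ 2 g p) (i : Fin 3) :
    pd i (opX g) p = pd i (pd 0 g) p + 2 * p 1 * pd i (pd 2 g) p
      + (if 1 = i then 2 else 0) * pd 2 g p := by
  have hd : DifferentiableAt ℝ (fderiv ℝ g) p :=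
    (hg.fderiv_right (m := 1) (by norm_num)).differentiableAt (by norm_num)
  have hpd : ∀ i, DifferentiableAt ℝ (pd i g) p := fun i =>
    hd.clm_apply (differentiableAt_const _)
  have h0 := hpd 0
  have h2 := hpd 2
  change pd i (fun q => pd 0 g q + 2 * q 1 * pd 2 g q) p = _
  rw [pd_add _ h0 (by fun_prop), pd_mul _ (by fun_prop) h2, pd_mul _ (by fun_prop) (by fun_prop),
    pd_const, pd_coord]
  split_ifs <;> ring

theorem pd_opY {g : H1 → ℝ} {p : H1} (hg : ContDiffAt ℝ 2 g p) (i : Fin 3) :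
    pd i (opY g) p = pd i (pd 1 g) p - 2 * p 0 * pd i (pd 2 g) p
      - (if 0 = i then 2 else 0) * pd 2 g p := by
  have hd : DifferentiableAt ℝ (fderiv ℝ g) p :=
    (hg.fderiv_right (m := 1) (by norm_num)).differentiableAt (by norm_num)
  have hpd : ∀ i, DifferentiableAt ℝ (pd i g) p := fun i =>
    hd.clm_apply (differentiableAt_const _)
  have h0 := hpd 1
  have h2 := hpd 2
  change pd i (fun q => pd 1 g q - 2 * q 0 * pd 2 g q) p = _
  rw [pd_sub _ h0 (by fun_prop), pd_mul _ (by fun_prop) h2, pd_mul _ (by fun_prop) (by fun_prop),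
    pd_const, pd_coord]
  split_ifs <;> ring

/-- Second derivatives cancel by symmetry, and only the derivatives of the coefficients `2y` and
`-2x` survive. Every integrability condition in `conformal_field_eq` is an instance of this bracket.
-/
theorem opX_opY_sub {g : H1 → ℝ} {p : H1} (hg : ContDiffAt ℝ 2 g p) :
    opX (opY g) p - opY (opX g) p = -4 * pd 2 g p := by
  rw [opX, opY, pd_opX hg, pd_opX hg, pd_opY hg, pd_opY hg, pd_comm hg 2 0, pd_comm hg 2 1,
    pd_comm hg 1 0]
  simp only [show (0 : Fin 3) ≠ 2 by decide, show (1 : Fin 3) ≠ 2 by decide, if_true, if_false]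
  ring

/-- The coefficients of the frame do not involve `t`, so `T` is central; a known frame derivative
may thus be differentiated in `t`. -/
theorem opX_pd_two {g : H1 → ℝ} {p : H1} (hg : ContDiffAt ℝ 2 g p) :
    opX (pd 2 g) p = pd 2 (opX g) p := by
  rw [opX, pd_opX hg, pd_comm hg 2 0, if_neg (by decide)]
  ring

theorem opY_pd_two {g : H1 → ℝ} {p : H1} (hg : ContDiffAt ℝ 2 g p) :
    opY (pd 2 g) p = pd 2 (opY g) p := by
  rw [opY, pd_opY hg, pd_comm hg 2 1, if_neg (by decide)]
  ring

theorem opX_const_mul (g : H1 → ℝ) (c : ℝ) {p : H1} (hg : DifferentiableAt ℝ g p) :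
    opX (fun q => c * g q) p = c * opX g p := by
  rw [opX, opX, pd_mul _ (by fun_prop) hg, pd_mul _ (by fun_prop) hg, pd_const, pd_const]
  ring

theorem opY_const_mul (g : H1 → ℝ) (c : ℝ) {p : H1} (hg : DifferentiableAt ℝ g p) :
    opY (fun q => c * g q) p = c * opY g p := by
  rw [opY, opY, pd_mul _ (by fun_prop) hg, pd_mul _ (by fun_prop) hg, pd_const, pd_const]
  ring

theorem pd_const_mul (i : Fin 3) (g : H1 → ℝ) (c : ℝ) {p : H1} (hg : DifferentiableAt ℝ g p) :
    pd i (fun q => c * g q) p = c * pd i g p := by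
  rw [pd_mul _ (by fun_prop) hg, pd_const]
  ring

/-- A function with vanishing gradient on a connected open set is constant. -/
theorem exists_const_of_pd_eq_zero {Ω : Set H1} (hΩ : IsOpen Ω) (hΩc : IsConnected Ω)
    {g : H1 → ℝ} (hg : ∀ p ∈ Ω, DifferentiableAt ℝ g p)
    (h : ∀ i, ∀ p ∈ Ω, pd i g p = 0) : ∃ c, ∀ p ∈ Ω, g p = c := by
  refine hΩ.exists_is_const_of_fderiv_eq_zero hΩc.isPreconnected
    (fun p hp => (hg p hp).differentiableWithinAt) fun p hp => ?_
  ext v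
  have hv : v = ∑ i, v i • e i := by
    ext k; simp [e, Pi.single_apply]
  rw [hv, map_sum]
  simp only [map_smul]
  exact Finset.sum_eq_zero fun i _ => by
    have := h i p hp
    rw [pd] at this
    rw [this, smul_zero]

/-- Functions with the same derivatives along `X` and `Y` differ by a constant. -/
theorem exists_const_of_frame_eq {Ω : Set H1} (hΩ : IsOpen Ω) (hΩc : IsConnected Ω)
    {g h : H1 → ℝ} (hg : ContDiffOn ℝ ∞ g Ω) (hh : ContDiffOn ℝ ∞ h Ω)
    (hX : ∀ p ∈ Ω, opX g p = opX h p) (hY : ∀ p ∈ Ω, opY g p = opY h p) :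
    ∃ c, ∀ p ∈ Ω, g p = h p + c := by
  -- The horizontal fields generate `T` by their bracket, so the full gradients agree.
  have hT : ∀ p ∈ Ω, pd 2 g p = pd 2 h p := fun p hp => by
    have h1 := opX_opY_sub (contDiffAt_two hΩ hg hp)
    have h2 := opX_opY_sub (contDiffAt_two hΩ hh hp)
    rw [opX_congr hΩ hY hp, opY_congr hΩ hX hp] at h1
    linear_combination (h1 - h2) / 4
  have hgd := fun p (hp : p ∈ Ω) => differentiableAt_of_smooth hΩ hg hp
  have hhd := fun p (hp : p ∈ Ω) => differentiableAt_of_smooth hΩ hh hp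
  obtain ⟨c, hc⟩ := exists_const_of_pd_eq_zero hΩ hΩc (g := fun p => g p - h p)
    (fun p hp => (hgd p hp).sub (hhd p hp)) (by
      intro i p hp
      rw [pd_sub i (hgd p hp) (hhd p hp)]
      have h1 := hX p hp
      have h2 := hY p hp
      have h3 := hT p hp
      rw [opX, opX] at h1
      rw [opY, opY] at h2
      fin_cases i
      · change pd 0 g p - pd 0 h p = 0
        linear_combination h1 - 2 * p 1 * h3
      · change pd 1 g p - pd 1 h p = 0
        linear_combination h2 + 2 * p 0 * h3
      · change pd 2 g p - pd 2 h p = 0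
        linear_combination h3)
  exact ⟨c, fun p hp => by linear_combination hc p hp⟩

/-! ### Conformal contact fields -/

/-- The spatial parts of the combinations of `V₁, V₂, V₃, Z₁, R, X̃, Ỹ, T`. -/
def confField (c : Fin 8 → ℝ) (p : H1) : H1 :=
  ![c 0 * (p 0 * p 2 - p 0 ^ 2 * p 1 - p 1 ^ 3) + c 1 * (p 2 - 4 * p 0 * p 1)
      + c 2 * (p 0 ^ 2 - 3 * p 1 ^ 2) + c 3 * p 0 + c 4 * p 1 + c 5,
    c 0 * (p 1 * p 2 + p 0 ^ 3 + p 0 * p 1 ^ 2) + c 1 * (3 * p 0 ^ 2 - p 1 ^ 2)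
      + c 2 * (p 2 + 4 * p 0 * p 1) + c 3 * p 1 - c 4 * p 0 + c 6,
    c 0 * (p 2 ^ 2 - (p 0 ^ 2 + p 1 ^ 2) ^ 2)
      - c 1 * (2 * p 1 * p 2 + 2 * p 0 ^ 3 + 2 * p 0 * p 1 ^ 2)
      + c 2 * (2 * p 0 * p 2 - 2 * p 0 ^ 2 * p 1 - 2 * p 1 ^ 3) + 2 * c 3 * p 2
      - 2 * c 5 * p 1 + 2 * c 6 * p 0 + c 7]

/-- The conformal factor of `confField c`. -/
def confFactor (c : Fin 8 → ℝ) (p : H1) : ℝ :=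
  2 * c 0 * p 2 + 4 * c 2 * p 0 - 4 * c 1 * p 1 + 2 * c 3

set_option linter.unusedSimpArgs false in
set_option maxHeartbeats 1000000 in
/-- A contact field of the Heisenberg group which is conformal on a connected open set is a
combination of the eight standard ones. -/
theorem conformal_field_eq {Ω : Set H1} (hΩ : IsOpen Ω) (hΩc : IsConnected Ω)
    {A B C : H1 → ℝ} (hA : ContDiffOn ℝ ∞ A Ω) (hB : ContDiffOn ℝ ∞ B Ω)
    (hC : ContDiffOn ℝ ∞ C Ω)
    (hXA : ∀ p ∈ Ω, opX A p = opY B p) (hXB : ∀ p ∈ Ω, opX B p = -1 * opY A p)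
    (hXC : ∀ p ∈ Ω, opX C p = 4 * B p) (hYC : ∀ p ∈ Ω, opY C p = -4 * A p) :
    ∃ c : Fin 8 → ℝ, ∀ p ∈ Ω, A p = confField c p 0 ∧ B p = confField c p 1 ∧
      C p + 2 * p 1 * A p - 2 * p 0 * B p = confField c p 2 := by
  have dA := fun p (hp : p ∈ Ω) => differentiableAt_of_smooth hΩ hA hp
  have dB := fun p (hp : p ∈ Ω) => differentiableAt_of_smooth hΩ hB hp
  have c2 : ∀ {g : H1 → ℝ}, ContDiffOn ℝ ∞ g Ω → ∀ p ∈ Ω, ContDiffAt ℝ 2 g p :=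
    fun hg p hp => contDiffAt_two hΩ hg hp
  have dd : ∀ {g : H1 → ℝ}, ContDiffOn ℝ ∞ g Ω → ∀ p ∈ Ω, DifferentiableAt ℝ g p :=
    fun hg p hp => differentiableAt_of_smooth hΩ hg hp
  -- first order
  have hmA : ∀ p ∈ Ω, opX A p = 1 / 2 * pd 2 C p := by
    intro p hp
    -- The bracket on `C` reads `-4 XA - 4 YB = -4 TC`; thus `m = TC` is the conformal factor.
    have h := opX_opY_sub (c2 hC p hp)
    rw [opX_congr hΩ hYC hp, opY_congr hΩ hXC hp, opX_const_mul _ _ (dA p hp),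
      opY_const_mul _ _ (dB p hp), ← hXA p hp] at h
    linear_combination -h / 8
  have hmB : ∀ p ∈ Ω, opY B p = 1 / 2 * pd 2 C p := fun p hp => (hXA p hp).symm.trans (hmA p hp)
  have sm := contDiffOn_pd hΩ hC 2
  have sn := contDiffOn_opY hΩ hA
  have sa := contDiffOn_pd hΩ hA 2
  have sb := contDiffOn_pd hΩ hB 2
  have sl := contDiffOn_pd hΩ sm 2
  set m := pd 2 C with hm
  set n := opY A with hn
  set a := pd 2 A with ha
  set b := pd 2 B with hb
  set l := pd 2 m with hl
  have hXm : ∀ p ∈ Ω, opX m p = 4 * b p := fun p hp => by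
    rw [hm, opX_pd_two (c2 hC p hp), pd_congr hΩ 2 hXC hp, pd_const_mul _ _ _ (dB p hp)]
  have hYm : ∀ p ∈ Ω, opY m p = -4 * a p := fun p hp => by
    rw [hm, opY_pd_two (c2 hC p hp), pd_congr hΩ 2 hYC hp, pd_const_mul _ _ _ (dA p hp)]
  have hXn : ∀ p ∈ Ω, opX n p = -6 * a p := fun p hp => by
    have h := opX_opY_sub (c2 hA p hp)
    rw [opY_congr hΩ hmA hp, opY_const_mul _ _ (dd sm p hp), hYm p hp] at h
    linear_combination h
  have hYn : ∀ p ∈ Ω, opY n p = -6 * b p := fun p hp => by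
    have h := opX_opY_sub (c2 hB p hp)
    rw [opY_congr hΩ hXB hp, opX_congr hΩ hmB hp, opY_const_mul _ _ (dd sn p hp),
      opX_const_mul _ _ (dd sm p hp), hXm p hp] at h
    linear_combination h
  have hXa : ∀ p ∈ Ω, opX a p = 1 / 2 * l p := fun p hp => by
    rw [ha, opX_pd_two (c2 hA p hp), pd_congr hΩ 2 hmA hp, pd_const_mul _ _ _ (dd sm p hp)]
  have hYb : ∀ p ∈ Ω, opY b p = 1 / 2 * l p := fun p hp => by
    rw [hb, opY_pd_two (c2 hB p hp), pd_congr hΩ 2 hmB hp, pd_const_mul _ _ _ (dd sm p hp)]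
  have hYa' : ∀ p ∈ Ω, opY a p = pd 2 n p := fun p hp => by
    rw [ha, opY_pd_two (c2 hA p hp)]
  have hXb' : ∀ p ∈ Ω, opX b p = -1 * pd 2 n p := fun p hp => by
    rw [hb, opX_pd_two (c2 hB p hp), pd_congr hΩ 2 hXB hp, pd_const_mul _ _ _ (dd sn p hp)]
  -- The bracket on `n` evaluates to `12 Tn`, yet it must be `-4 Tn`.
  have hTn : ∀ p ∈ Ω, pd 2 n p = 0 := fun p hp => by
    have h := opX_opY_sub (c2 sn p hp)
    rw [opX_congr hΩ hYn hp, opY_congr hΩ hXn hp, opX_const_mul _ _ (dd sb p hp),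
      opY_const_mul _ _ (dd sa p hp), hYa' p hp, hXb' p hp] at h
    linear_combination h / 16
  -- Zero is written as `0 * l p` so that `opX_const_mul` and `opY_const_mul` apply to it in the
  -- next brackets.
  have hYa : ∀ p ∈ Ω, opY a p = 0 * l p := fun p hp => by rw [hYa' p hp, hTn p hp, zero_mul]
  have hXb : ∀ p ∈ Ω, opX b p = 0 * l p := fun p hp => by
    rw [hXb' p hp, hTn p hp, mul_zero, zero_mul]
  have hXl' : ∀ p ∈ Ω, opX l p = 4 * pd 2 b p := fun p hp => by
    rw [hl, opX_pd_two (c2 sm p hp), pd_congr hΩ 2 hXm hp, pd_const_mul _ _ _ (dd sb p hp)]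
  have hYl' : ∀ p ∈ Ω, opY l p = -4 * pd 2 a p := fun p hp => by
    rw [hl, opY_pd_two (c2 sm p hp), pd_congr hΩ 2 hYm hp, pd_const_mul _ _ _ (dd sa p hp)]
  -- Here the bracket equals `2 Ta` as well as `-4 Ta`. The same argument for `b` makes `l` constant
  -- and closes the system.
  have hTa : ∀ p ∈ Ω, pd 2 a p = 0 := fun p hp => by
    have h := opX_opY_sub (c2 sa p hp)
    rw [opX_congr hΩ hYa hp, opY_congr hΩ hXa hp, opX_const_mul _ _ (dd sl p hp),
      opY_const_mul _ _ (dd sl p hp), hYl' p hp] at h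
    linear_combination h / 6
  have hTb : ∀ p ∈ Ω, pd 2 b p = 0 := fun p hp => by
    have h := opX_opY_sub (c2 sb p hp)
    rw [opX_congr hΩ hYb hp, opY_congr hΩ hXb hp, opX_const_mul _ _ (dd sl p hp),
      opY_const_mul _ _ (dd sl p hp), hXl' p hp] at h
    linear_combination h / 6
  have hXl : ∀ p ∈ Ω, opX l p = 0 * l p := fun p hp => by
    rw [hXl' p hp, hTb p hp, mul_zero, zero_mul]
  have hYl : ∀ p ∈ Ω, opY l p = 0 * l p := fun p hp => by
    rw [hYl' p hp, hTa p hp, mul_zero, zero_mul]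
  -- integration
  obtain ⟨l₀, hl0⟩ := exists_const_of_frame_eq hΩ hΩc sl
    (contDiffOn_const (c := (0 : ℝ)))
    (fun p hp => by rw [hXl p hp]; simp [opX, pd_const])
    (fun p hp => by rw [hYl p hp]; simp [opY, pd_const])
  simp only [zero_add] at hl0
  -- The order `l, a, b, m, n, A, B, C` works because the frame derivatives of each function involve
  -- only earlier ones; each `h` is an explicit primitive, and each integration adds one constant.
  obtain ⟨a₀, ha0⟩ := exists_const_of_frame_eq hΩ hΩc sa
    (h := fun q => l₀ / 2 * q 0) (by fun_prop)
    (fun p hp => by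
      rw [hXa p hp, hl0 p hp]
      simp (disch := fun_prop) only [opX, pd_mul, pd_const, pd_coord,
        Fin.reduceEq, if_true, if_false]; ring)
    (fun p hp => by
      rw [hYa p hp]
      simp (disch := fun_prop) only [opY, pd_mul, pd_const, pd_coord,
        Fin.reduceEq, if_true, if_false]; ring)
  obtain ⟨b₀, hb0⟩ := exists_const_of_frame_eq hΩ hΩc sb
    (h := fun q => l₀ / 2 * q 1) (by fun_prop)
    (fun p hp => by
      rw [hXb p hp, hl0 p hp]
      simp (disch := fun_prop) only [opX, pd_mul, pd_const, pd_coord,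
        Fin.reduceEq, if_true, if_false]; ring)
    (fun p hp => by
      rw [hYb p hp, hl0 p hp]
      simp (disch := fun_prop) only [opY, pd_mul, pd_const, pd_coord,
        Fin.reduceEq, if_true, if_false]; ring)
  obtain ⟨m₀, hm0⟩ := exists_const_of_frame_eq hΩ hΩc sm
    (h := fun q => l₀ * q 2 + 4 * b₀ * q 0 - 4 * a₀ * q 1) (by fun_prop)
    (fun p hp => by
      rw [hXm p hp, hb0 p hp]
      simp (disch := fun_prop) only [opX, pd_mul, pd_add, pd_sub, pd_const,
        pd_coord, Fin.reduceEq, if_true, if_false]; ring)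
    (fun p hp => by
      rw [hYm p hp, ha0 p hp]
      simp (disch := fun_prop) only [opY, pd_mul, pd_add, pd_sub, pd_const,
        pd_coord, Fin.reduceEq, if_true, if_false]; ring)
  obtain ⟨n₀, hn0⟩ := exists_const_of_frame_eq hΩ hΩc sn
    (h := fun q => -(3 / 2) * l₀ * (q 0 ^ 2 + q 1 ^ 2) - 6 * a₀ * q 0 - 6 * b₀ * q 1)
    (by fun_prop)
    (fun p hp => by
      rw [hXn p hp, ha0 p hp]
      simp (disch := fun_prop) only [opX, pd_mul, pd_add, pd_sub, pd_const,
        pd_coord, pd_pow, Fin.reduceEq, if_true, if_false]; push_cast; ring)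
    (fun p hp => by
      rw [hYn p hp, hb0 p hp]
      simp (disch := fun_prop) only [opY, pd_mul, pd_add, pd_sub, pd_const,
        pd_coord, pd_pow, Fin.reduceEq, if_true, if_false]; push_cast; ring)
  obtain ⟨A₀, hA0⟩ := exists_const_of_frame_eq hΩ hΩc hA
    (h := fun p => l₀ / 2 * (p 0 * p 2 - p 0 ^ 2 * p 1 - p 1 ^ 3) + a₀ * (p 2 - 4 * p 0 * p 1)
      + b₀ * (p 0 ^ 2 - 3 * p 1 ^ 2) + m₀ / 2 * p 0 + n₀ * p 1) (by fun_prop)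
    (fun p hp => by
      rw [hmA p hp, hm0 p hp]
      simp (disch := fun_prop) only [opX, pd_mul, pd_add, pd_sub, pd_const,
        pd_coord, pd_pow, Fin.reduceEq, if_true, if_false]; push_cast; ring)
    (fun p hp => by
      change n p = _
      rw [hn0 p hp]
      simp (disch := fun_prop) only [opY, pd_mul, pd_add, pd_sub, pd_const,
        pd_coord, pd_pow, Fin.reduceEq, if_true, if_false]; push_cast; ring)
  obtain ⟨B₀, hB0⟩ := exists_const_of_frame_eq hΩ hΩc hB
    (h := fun p => l₀ / 2 * (p 1 * p 2 + p 0 ^ 3 + p 0 * p 1 ^ 2) + a₀ * (3 * p 0 ^ 2 - p 1 ^ 2)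
      + b₀ * (p 2 + 4 * p 0 * p 1) + m₀ / 2 * p 1 - n₀ * p 0) (by fun_prop)
    (fun p hp => by
      rw [hXB p hp, hn0 p hp]
      simp (disch := fun_prop) only [opX, pd_mul, pd_add, pd_sub, pd_const,
        pd_coord, pd_pow, Fin.reduceEq, if_true, if_false]; push_cast; ring)
    (fun p hp => by
      rw [hmB p hp, hm0 p hp]
      simp (disch := fun_prop) only [opY, pd_mul, pd_add, pd_sub, pd_const,
        pd_coord, pd_pow, Fin.reduceEq, if_true, if_false]; push_cast; ring)
  obtain ⟨C₀, hC0⟩ := exists_const_of_frame_eq hΩ hΩc hC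
    (h := fun p => l₀ / 2 * (p 2 ^ 2 + (p 0 ^ 2 + p 1 ^ 2) ^ 2)
      + 4 * a₀ * (p 0 ^ 3 + p 0 * p 1 ^ 2 - p 1 * p 2)
      + 4 * b₀ * (p 0 * p 2 + p 0 ^ 2 * p 1 + p 1 ^ 3)
      + m₀ * p 2 - 2 * n₀ * (p 0 ^ 2 + p 1 ^ 2) - 4 * A₀ * p 1 + 4 * B₀ * p 0) (by fun_prop)
    (fun p hp => by
      rw [hXC p hp, hB0 p hp]
      simp (disch := fun_prop) only [opX, pd_mul, pd_add, pd_sub, pd_const,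
        pd_coord, pd_pow, Fin.reduceEq, if_true, if_false]; push_cast; ring)
    (fun p hp => by
      rw [hYC p hp, hA0 p hp]
      simp (disch := fun_prop) only [opY, pd_mul, pd_add, pd_sub, pd_const,
        pd_coord, pd_pow, Fin.reduceEq, if_true, if_false]; push_cast; ring)
  refine ⟨![l₀ / 2, a₀, b₀, m₀ / 2, n₀, A₀, B₀, C₀], fun p hp => ⟨?_, ?_, ?_⟩⟩
  · rw [hA0 p hp]; rfl
  · rw [hB0 p hp]; rfl
  · rw [hA0 p hp, hB0 p hp, hC0 p hp]
    simp [confField]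
    ring

/-! ### Second extensions -/

/-- The derivative with respect to the `i`-th independent variable. -/
noncomputable def dp (i : Fin 3) (g : H1 × ℝ → ℝ) (q : H1 × ℝ) : ℝ := fderiv ℝ g q (e i, 0)

/-- The derivative with respect to the dependent variable. -/
noncomputable def du (g : H1 × ℝ → ℝ) (q : H1 × ℝ) : ℝ := fderiv ℝ g q (0, 1)

theorem fderiv_pair (g : H1 × ℝ → ℝ) (q : H1 × ℝ) (i : Fin 3) (s : ℝ) :
    fderiv ℝ g q (e i, s) = dp i g q + s * du g q := by
  have : ((e i, s) : H1 × ℝ) = (e i, 0) + s • ((0, 1) : H1 × ℝ) := by simp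
  rw [this, map_add, map_smul]; rfl

theorem totalD0_eq (i : Fin 3) (g : H1 × ℝ → ℝ) (z : Jet1) :
    totalD0 i g z = dp i g (z.1, z.2.1) + z.2.2 i * du g (z.1, z.2.1) :=
  fderiv_pair _ _ _ _

theorem contDiffAt_dp {g : H1 × ℝ → ℝ} {q : H1 × ℝ} (hg : ContDiffAt ℝ ∞ g q) (i : Fin 3) :
    ContDiffAt ℝ ∞ (dp i g) q :=
  (hg.fderiv_right (m := ∞) (by simp)).clm_apply contDiffAt_const

theorem contDiffAt_du {g : H1 × ℝ → ℝ} {q : H1 × ℝ} (hg : ContDiffAt ℝ ∞ g q) :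
    ContDiffAt ℝ ∞ (du g) q :=
  (hg.fderiv_right (m := ∞) (by simp)).clm_apply contDiffAt_const

theorem dp_congr {D : Set (H1 × ℝ)} (hD : IsOpen D) {g h : H1 × ℝ → ℝ} (i : Fin 3)
    (hgh : ∀ q ∈ D, g q = h q) {q : H1 × ℝ} (hq : q ∈ D) : dp i g q = dp i h q := by
  have : g =ᶠ[nhds q] h := Filter.eventually_of_mem (hD.mem_nhds hq) hgh
  rw [dp, dp, this.fderiv_eq]

theorem du_congr {D : Set (H1 × ℝ)} (hD : IsOpen D) {g h : H1 × ℝ → ℝ}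
    (hgh : ∀ q ∈ D, g q = h q) {q : H1 × ℝ} (hq : q ∈ D) : du g q = du h q := by
  have : g =ᶠ[nhds q] h := Filter.eventually_of_mem (hD.mem_nhds hq) hgh
  rw [du, du, this.fderiv_eq]

theorem du_dp_comm {g : H1 × ℝ → ℝ} {q : H1 × ℝ} (hg : ContDiffAt ℝ ∞ g q) (i : Fin 3) :
    du (dp i g) q = dp i (du g) q := by
  have hd : DifferentiableAt ℝ (fderiv ℝ g) q :=
    (hg.fderiv_right (m := ∞) (by simp)).differentiableAt (by simp)
  have h := (contDiffAt_infty.1 hg 2).isSymmSndFDerivAt (by simp)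
  have hh : ∀ a b : H1 × ℝ, fderiv ℝ (fun x => fderiv ℝ g x b) q a
      = fderiv ℝ (fderiv ℝ g) q a b := by
    intro a b
    rw [(hd.hasFDerivAt.clm_apply (hasFDerivAt_const b q)).fderiv]; simp
  change fderiv ℝ (fun x => fderiv ℝ g x _) q _ = fderiv ℝ (fun x => fderiv ℝ g x _) q _
  rw [hh, hh]; exact h _ _

/-- The second total derivative `Dⱼ Dᵢ g` of a function of `(p, u)`. -/
noncomputable def totalD2 (i j : Fin 3) (g : H1 × ℝ → ℝ) (z : Jet2) : ℝ :=
  dp j (dp i g) (z.1, z.2.1) + z.2.2.1 j * du (dp i g) (z.1, z.2.1)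
    + z.2.2.1 i * (dp j (du g) (z.1, z.2.1) + z.2.2.1 j * du (du g) (z.1, z.2.1))
    + z.2.2.2 j i * du g (z.1, z.2.1)

/-- The projection of first order jets to `(p, u)`. -/
noncomputable def basePoint : Jet1 →L[ℝ] H1 × ℝ :=
  (ContinuousLinearMap.fst ℝ H1 (ℝ × (Fin 3 → ℝ))).prod
    ((ContinuousLinearMap.fst ℝ ℝ (Fin 3 → ℝ)).comp
      (ContinuousLinearMap.snd ℝ H1 (ℝ × (Fin 3 → ℝ))))

/-- The coordinate `uₖ` of first order jets. -/
noncomputable def slope (k : Fin 3) : Jet1 →L[ℝ] ℝ :=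
  (ContinuousLinearMap.proj (R := ℝ) (φ := fun _ : Fin 3 => ℝ) k).comp
    ((ContinuousLinearMap.snd ℝ ℝ (Fin 3 → ℝ)).comp
      (ContinuousLinearMap.snd ℝ H1 (ℝ × (Fin 3 → ℝ))))

theorem basePoint_apply (z : Jet1) : basePoint z = (z.1, z.2.1) := rfl

theorem slope_apply (k : Fin 3) (z : Jet1) : slope k z = z.2.2 k := rfl

theorem hasFDerivAt_base {G : H1 × ℝ → ℝ} {z : Jet1} (hG : DifferentiableAt ℝ G (z.1, z.2.1)) :
    HasFDerivAt (fun z : Jet1 => G (z.1, z.2.1))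
      ((fderiv ℝ G (z.1, z.2.1)).comp basePoint) z :=
  HasFDerivAt.comp z (f := basePoint) hG.hasFDerivAt basePoint.hasFDerivAt

theorem hasFDerivAt_slope (k : Fin 3) (z : Jet1) :
    HasFDerivAt (fun z : Jet1 => z.2.2 k) (slope k) z :=
  (slope k).hasFDerivAt

theorem differentiableAt_totalD0 {g : H1 × ℝ → ℝ} {z : Jet1}
    (hg : ContDiffAt ℝ ∞ g (z.1, z.2.1)) (i : Fin 3) : DifferentiableAt ℝ (totalD0 i g) z := by
  have h : totalD0 i g = fun z => dp i g (z.1, z.2.1) + z.2.2 i * du g (z.1, z.2.1) :=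
    funext fun z => totalD0_eq i g z
  rw [h]
  exact (hasFDerivAt_base ((contDiffAt_dp hg i).differentiableAt (by simp))).differentiableAt.add
    ((hasFDerivAt_slope i z).differentiableAt.mul
      (hasFDerivAt_base ((contDiffAt_du hg).differentiableAt (by simp))).differentiableAt)

theorem totalD1_totalD0 {g : H1 × ℝ → ℝ} {z : Jet2} (hg : ContDiffAt ℝ ∞ g (z.1, z.2.1))
    (i j : Fin 3) : totalD1 j (totalD0 i g) z = totalD2 i j g z := by
  have h : totalD0 i g = fun z => dp i g (z.1, z.2.1) + z.2.2 i * du g (z.1, z.2.1) :=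
    funext fun z => totalD0_eq i g z
  have h1 := hasFDerivAt_base (z := (z.1, z.2.1, z.2.2.1))
    ((contDiffAt_dp hg i).differentiableAt (by simp))
  have h2 := hasFDerivAt_base (z := (z.1, z.2.1, z.2.2.1))
    ((contDiffAt_du hg).differentiableAt (by simp))
  have h3 := h1.fun_add ((hasFDerivAt_slope i (z.1, z.2.1, z.2.2.1)).fun_mul h2)
  rw [totalD1, h, h3.fderiv]
  simp only [add_apply, smul_apply, ContinuousLinearMap.comp_apply, basePoint_apply, slope_apply,
    fderiv_pair, smul_eq_mul, totalD2]
  ring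

theorem totalD1_ext1 {V : VField} {z : Jet2} (hV : ContDiffAt ℝ ∞ V (z.1, z.2.1))
    (i j : Fin 3) : totalD1 j (ext1 V i) z = totalD2 i j (fun q => (V q).2) z
      - ∑ k, (z.2.2.2 j k * totalD0 i (fun q => (V q).1 k) (z.1, z.2.1, z.2.2.1)
        + z.2.2.1 k * totalD2 i j (fun q => (V q).1 k) z) := by
  have s2 : ContDiffAt ℝ ∞ (fun q => (V q).2) (z.1, z.2.1) := hV.snd
  have s1 : ∀ k, ContDiffAt ℝ ∞ (fun q => (V q).1 k) (z.1, z.2.1) := contDiffAt_pi.1 hV.fst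
  have h2 := (differentiableAt_totalD0 (z := (z.1, z.2.1, z.2.2.1)) s2 i).hasFDerivAt
  have h1 := fun k => (hasFDerivAt_slope k (z.1, z.2.1, z.2.2.1)).mul
    (differentiableAt_totalD0 (z := (z.1, z.2.1, z.2.2.1)) (s1 k) i).hasFDerivAt
  have h := h2.sub (HasFDerivAt.fun_sum fun k (_ : k ∈ Finset.univ) => h1 k)
  have h' : HasFDerivAt (ext1 V i) _ (z.1, z.2.1, z.2.2.1) := h
  rw [totalD1, h'.fderiv]
  simp only [sub_apply, add_apply, smul_apply, sum_apply,
    slope_apply, smul_eq_mul]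
  rw [← totalD1_totalD0 s2]
  simp only [← totalD1_totalD0 (s1 _)]
  refine congrArg₂ _ rfl (Finset.sum_congr rfl fun k _ => ?_)
  rw [add_comm, mul_comm (z.2.2.2 j k)]; rfl

theorem ext2_eq {V : VField} {z : Jet2} (hV : ContDiffAt ℝ ∞ V (z.1, z.2.1))
    (i j : Fin 3) : ext2 V i j z = totalD2 i j (fun q => (V q).2) z
      - ∑ k, (z.2.2.2 j k * totalD0 i (fun q => (V q).1 k) (z.1, z.2.1, z.2.2.1)
        + z.2.2.1 k * totalD2 i j (fun q => (V q).1 k) z)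
      - ∑ k, z.2.2.2 i k * totalD0 j (fun q => (V q).1 k) (z.1, z.2.1, z.2.2.1) := by
  rw [ext2, totalD1_ext1 hV]

theorem fderiv_kohnEq {f : ℝ → ℝ} {z : Jet2} (hf : DifferentiableAt ℝ f z.2.1) (d : Jet2) :
    fderiv ℝ (kohnEq f) z d = d.2.2.2 0 0 + d.2.2.2 1 1
      + 4 * ((z.1 0) ^ 2 + (z.1 1) ^ 2) * d.2.2.2 2 2
      + 4 * z.1 1 * d.2.2.2 0 2 - 4 * z.1 0 * d.2.2.2 1 2
      + 8 * (z.1 0 * d.1 0 + z.1 1 * d.1 1) * z.2.2.2 2 2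
      + 4 * d.1 1 * z.2.2.2 0 2 - 4 * d.1 0 * z.2.2.2 1 2 + deriv f z.2.1 * d.2.1 := by
  let sndJ := ContinuousLinearMap.snd ℝ H1 (ℝ × (Fin 3 → ℝ) × (Fin 3 → Fin 3 → ℝ))
  let sndU := (ContinuousLinearMap.snd ℝ ℝ ((Fin 3 → ℝ) × (Fin 3 → Fin 3 → ℝ))).comp sndJ
  let uL := (ContinuousLinearMap.fst ℝ ℝ ((Fin 3 → ℝ) × (Fin 3 → Fin 3 → ℝ))).comp sndJ
  let pL := fun i : Fin 3 => (ContinuousLinearMap.proj (R := ℝ) (φ := fun _ : Fin 3 => ℝ) i).comp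
    (ContinuousLinearMap.fst ℝ H1 (ℝ × (Fin 3 → ℝ) × (Fin 3 → Fin 3 → ℝ)))
  let wL := fun i j : Fin 3 => (ContinuousLinearMap.proj (R := ℝ) (φ := fun _ : Fin 3 => ℝ) j).comp
    ((ContinuousLinearMap.proj (R := ℝ) (φ := fun _ : Fin 3 => Fin 3 → ℝ) i).comp
      ((ContinuousLinearMap.snd ℝ (Fin 3 → ℝ) (Fin 3 → Fin 3 → ℝ)).comp sndU))
  have hw : ∀ i j : Fin 3, HasFDerivAt (fun z : Jet2 => z.2.2.2 i j) (wL i j) z :=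
    fun i j => (wL i j).hasFDerivAt
  have hp : ∀ i : Fin 3, HasFDerivAt (fun z : Jet2 => z.1 i) (pL i) z :=
    fun i => (pL i).hasFDerivAt
  have hu : HasFDerivAt (fun z : Jet2 => z.2.1) uL z := uL.hasFDerivAt
  have wLa : ∀ i j (d : Jet2), wL i j d = d.2.2.2 i j := fun _ _ _ => rfl
  have pLa : ∀ i (d : Jet2), pL i d = d.1 i := fun _ _ => rfl
  have uLa : ∀ d : Jet2, uL d = d.2.1 := fun _ => rfl
  have hfu := HasDerivAt.comp_hasFDerivAt z hf.hasDerivAt hu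
  have h := (((((hw 0 0).add (hw 1 1)).add
    (((((hp 0).pow 2).fun_add ((hp 1).pow 2)).const_mul 4).mul (hw 2 2))).add
    (((hp 1).const_mul 4).mul (hw 0 2))).sub (((hp 0).const_mul 4).mul (hw 1 2))).add hfu
  have h' : HasFDerivAt (kohnEq f) _ z := h
  rw [h'.fderiv]
  simp only [sub_apply, add_apply, smul_apply, smul_eq_mul, wLa, pLa, uLa]
  push_cast
  ring

/-! ### Reduction of the symmetry condition -/

/-- The value on the extension of `V` of the differential of the equation. -/
noncomputable def symValue (f : ℝ → ℝ) (V : VField) (z : Jet2) : ℝ :=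
  ext2 V 0 0 z + ext2 V 1 1 z + 4 * ((z.1 0) ^ 2 + (z.1 1) ^ 2) * ext2 V 2 2 z
    + 4 * z.1 1 * ext2 V 0 2 z - 4 * z.1 0 * ext2 V 1 2 z
    + 8 * (z.1 0 * (V (z.1, z.2.1)).1 0 + z.1 1 * (V (z.1, z.2.1)).1 1) * z.2.2.2 2 2
    + 4 * (V (z.1, z.2.1)).1 1 * z.2.2.2 0 2 - 4 * (V (z.1, z.2.1)).1 0 * z.2.2.2 1 2
    + deriv f z.2.1 * (V (z.1, z.2.1)).2

theorem isSym_iff {Ω : Set H1} {I : Set ℝ} {f : ℝ → ℝ} (hf : ∀ u ∈ I, DifferentiableAt ℝ f u)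
    {V : VField} : IsSym Ω I f V ↔ ContDiffOn ℝ ∞ V (Ω ×ˢ I) ∧
      ∀ z : Jet2, (z.1, z.2.1) ∈ Ω ×ˢ I → (∀ i j, z.2.2.2 i j = z.2.2.2 j i) →
        kohnEq f z = 0 → symValue f V z = 0 := by
  refine and_congr_right fun _ => forall_congr' fun z => forall_congr' fun hz => ?_
  rw [fderiv_kohnEq (hf _ hz.2)]
  rfl

/-- The extension involves only derivatives of the coefficients at the base point, hence only the
germ of the field there. This allows a symmetry to be replaced by a normal form that agrees with it
only on `D`. -/
theorem ext2_congr {D : Set (H1 × ℝ)} (hD : IsOpen D) {V W : VField}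
    (hV : ContDiffOn ℝ ∞ V D) (hVW : Set.EqOn V W D) {z : Jet2} (hz : (z.1, z.2.1) ∈ D)
    (i j : Fin 3) : ext2 V i j z = ext2 W i j z := by
  have hW : ContDiffOn ℝ ∞ W D := hV.congr fun q hq => (hVW hq).symm
  have h2 : ∀ q ∈ D, (V q).2 = (W q).2 := fun q hq => by rw [hVW hq]
  have h1 : ∀ k, ∀ q ∈ D, (V q).1 k = (W q).1 k := fun k q hq => by rw [hVW hq]
  have ht0 : ∀ {g h : H1 × ℝ → ℝ}, (∀ q ∈ D, g q = h q) → ∀ i,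
      totalD0 i g (z.1, z.2.1, z.2.2.1) = totalD0 i h (z.1, z.2.1, z.2.2.1) := by
    intro g h hgh i
    rw [totalD0_eq, totalD0_eq, dp_congr hD i hgh hz, du_congr hD hgh hz]
  have ht2 : ∀ {g h : H1 × ℝ → ℝ}, (∀ q ∈ D, g q = h q) → ∀ i j,
      totalD2 i j g z = totalD2 i j h z := by
    intro g h hgh i j
    rw [totalD2, totalD2, du_congr hD hgh hz, dp_congr hD j (fun q hq => dp_congr hD i hgh hq) hz,
      du_congr hD (fun q hq => dp_congr hD i hgh hq) hz,
      dp_congr hD j (fun q hq => du_congr hD hgh hq) hz,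
      du_congr hD (fun q hq => du_congr hD hgh hq) hz]
  rw [ext2_eq (hV.contDiffAt (hD.mem_nhds hz)), ext2_eq (hW.contDiffAt (hD.mem_nhds hz)),
    ht2 h2]
  simp only [ht2 (h1 _), ht0 (h1 _)]

theorem IsSym.congr {Ω : Set H1} (hΩ : IsOpen Ω) {I : Set ℝ} (hI : IsOpen I) {f : ℝ → ℝ}
    (hf : ∀ u ∈ I, DifferentiableAt ℝ f u) {V W : VField} (hV : IsSym Ω I f V)
    (hVW : Set.EqOn V W (Ω ×ˢ I)) : IsSym Ω I f W := by
  rw [isSym_iff hf] at hV ⊢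
  refine ⟨hV.1.congr fun q hq => (hVW hq).symm, fun z hz hs hH => ?_⟩
  rw [← hV.2 z hz hs hH, symValue, symValue]
  simp only [ext2_congr (hΩ.prod hI) hV.1 hVW hz, hVW hz]

theorem ext2_apply {V : VField} {p : H1} {u : ℝ} (hV : ContDiffAt ℝ ∞ V (p, u))
    (v : Fin 3 → ℝ) (w : Fin 3 → Fin 3 → ℝ) (i j : Fin 3) :
    ext2 V i j (p, u, v, w) = totalD2 i j (fun q => (V q).2) (p, u, v, w)
      - ∑ k, (w j k * totalD0 i (fun q => (V q).1 k) (p, u, v)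
        + v k * totalD2 i j (fun q => (V q).1 k) (p, u, v, w))
      - ∑ k, w i k * totalD0 j (fun q => (V q).1 k) (p, u, v) :=
  ext2_eq (z := (p, u, v, w)) hV i j

/-- The second order jet with the given entries. -/
def mkJet (p : H1) (u v0 v1 v2 w00 w11 w22 w01 w02 w12 : ℝ) : Jet2 :=
  (p, u, ![v0, v1, v2], ![![w00, w01, w02], ![w01, w11, w12], ![w02, w12, w22]])

/-- Solving for `u_xx` parametrises the symmetric jets on the equation by all other coordinates.
These may then be given arbitrary values, which is how coefficients are extracted below. -/
theorem IsSym.symValue_mkJet {Ω : Set H1} {I : Set ℝ} {f : ℝ → ℝ}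
    (hf : ∀ u ∈ I, DifferentiableAt ℝ f u) {V : VField} (hV : IsSym Ω I f V) {p : H1} {u : ℝ}
    (hp : p ∈ Ω) (hu : u ∈ I) (v0 v1 v2 w11 w22 w01 w02 w12 : ℝ) :
    symValue f V (mkJet p u v0 v1 v2 (-w11 - 4 * (p 0 ^ 2 + p 1 ^ 2) * w22 - 4 * p 1 * w02
      + 4 * p 0 * w12 - f u) w11 w22 w01 w02 w12) = 0 := by
  refine ((isSym_iff hf).1 hV).2 _ ⟨hp, hu⟩ ?_ ?_
  · intro i j
    fin_cases i <;> fin_cases j <;> rfl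
  · simp [kohnEq, mkJet]
    ring

/-- The coefficients of products of a first and a second derivative come only from `∂ᵤ` of the
field; the products with `uₓ` and `uᵧ` chosen here no longer contain `∂ᵤη`. -/
theorem IsSym.du_spatial {Ω : Set H1} (hΩ : IsOpen Ω) {I : Set ℝ} (hI : IsOpen I) {f : ℝ → ℝ}
    (hf : ∀ u ∈ I, DifferentiableAt ℝ f u) {V : VField} (hV : IsSym Ω I f V) {q : H1 × ℝ}
    (hq : q ∈ Ω ×ˢ I) (k : Fin 3) : du (fun q => (V q).1 k) q = 0 := by
  obtain ⟨p, u⟩ := q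
  have hVq : ContDiffAt ℝ ∞ V (p, u) := hV.1.contDiffAt ((hΩ.prod hI).mem_nhds hq)
  have H := fun v0 v1 w01 w02 : ℝ => hV.symValue_mkJet hf hq.1 hq.2 v0 v1 0 0 0 w01 w02 0
  simp only [symValue, mkJet, ext2_apply hVq, totalD2, totalD0_eq, Fin.sum_univ_three] at H
  have h00 := H 0 0 0 0
  have h01 := H 0 0 1 0
  have h02 := H 0 0 0 1
  have a00 := H 1 0 0 0
  have a01 := H 1 0 1 0
  have a02 := H 1 0 0 1
  have b00 := H 0 1 0 0
  have b01 := H 0 1 1 0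
  simp at h00 h01 h02 a00 a01 a02 b00 b01
  -- A mixed second difference in `v0` and `w01` isolates the coefficient of `v0 * w01`, which is
  -- `-2 ∂ᵤξ₁`.
  have c1 : du (fun q => (V q).1 1) (p, u) = 0 := by
    linear_combination (a01 - a00 - h01 + h00) / -2
  have c0 : du (fun q => (V q).1 0) (p, u) = 0 := by
    linear_combination (b01 - b00 - h01 + h00) / -2
  -- Since `u_xx` contains `-4y w02`, this difference also sees `∂ᵤξ₀`, which `c0` removes.
  have c2 : du (fun q => (V q).1 2) (p, u) = 0 := by
    linear_combination (a02 - a00 - h02 + h00) / -2 + 2 * p 1 * c0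
  fin_cases k
  exacts [c0, c1, c2]

/-- With the spatial part independent of `u`, the coefficient of `v0 ^ 2` is `∂ᵤ²η`; a second
difference in `v0` extracts it. -/
theorem IsSym.du_du_vertical {Ω : Set H1} (hΩ : IsOpen Ω) {I : Set ℝ} (hI : IsOpen I)
    {f : ℝ → ℝ} (hf : ∀ u ∈ I, DifferentiableAt ℝ f u) {V : VField} (hV : IsSym Ω I f V)
    {q : H1 × ℝ} (hq : q ∈ Ω ×ˢ I) : du (du (fun q => (V q).2)) q = 0 := by
  have hk := fun k q hq => hV.du_spatial hΩ hI hf (q := q) hq k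
  have hD := hΩ.prod hI
  have hz := fun k => hk k q hq
  obtain ⟨p, u⟩ := q
  have hVq : ContDiffAt ℝ ∞ V (p, u) := hV.1.contDiffAt (hD.mem_nhds hq)
  have s1 : ∀ k, ContDiffAt ℝ ∞ (fun q => (V q).1 k) (p, u) := contDiffAt_pi.1 hVq.fst
  have d0 : ∀ i, dp i (fun _ : H1 × ℝ => (0 : ℝ)) (p, u) = 0 := fun i => by simp [dp]
  have d1 : du (fun _ : H1 × ℝ => (0 : ℝ)) (p, u) = 0 := by simp [du]
  have hpu : ∀ i k, dp i (du fun q => (V q).1 k) (p, u) = 0 := fun i k => by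
    rw [dp_congr hD i (hk k) hq, d0]
  have huu : ∀ k, du (du fun q => (V q).1 k) (p, u) = 0 := fun k => by
    rw [du_congr hD (hk k) hq, d1]
  have hup : ∀ i k, du (dp i fun q => (V q).1 k) (p, u) = 0 := fun i k => by
    rw [du_dp_comm (s1 k), hpu]
  have H := fun v0 : ℝ => hV.symValue_mkJet hf hq.1 hq.2 v0 0 0 0 0 0 0 0
  simp only [symValue, mkJet, ext2_apply hVq, totalD2, totalD0_eq, Fin.sum_univ_three, hz, hpu, huu, hup] at H
  have h0 := H 0
  have h1 := H 1
  have h2 := H (-1)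
  simp at h0 h1 h2
  linear_combination (h1 + h2 - 2 * h0) / 2

/-! ### Projectable fields which are affine in the unknown -/

/-- The field `ξ(p) ∂ₚ + (α(p) u + β(p)) ∂ᵤ`. -/
def affineField (ξ : H1 → H1) (α β : H1 → ℝ) : VField :=
  fun z => (ξ z.1, α z.1 * z.2 + β z.1)

theorem contDiffOn_affineField {Ω : Set H1} (I : Set ℝ) {ξ : H1 → H1} {α β : H1 → ℝ}
    (hξ : ContDiffOn ℝ ∞ ξ Ω) (hα : ContDiffOn ℝ ∞ α Ω) (hβ : ContDiffOn ℝ ∞ β Ω) :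
    ContDiffOn ℝ ∞ (affineField ξ α β) (Ω ×ˢ I) := by
  have hm : Set.MapsTo (Prod.fst : H1 × ℝ → H1) (Ω ×ˢ I) Ω := fun q hq => hq.1
  have h1 : ContDiffOn ℝ ∞ (Prod.fst : H1 × ℝ → H1) (Ω ×ˢ I) := contDiff_fst.contDiffOn
  have h2 : ContDiffOn ℝ ∞ (Prod.snd : H1 × ℝ → ℝ) (Ω ×ˢ I) := contDiff_snd.contDiffOn
  exact (hξ.comp h1 hm).prodMk (((hα.comp h1 hm).mul h2).add (hβ.comp h1 hm))

theorem hasDerivAt_vertical {g : H1 × ℝ → ℝ} {p : H1} {u : ℝ}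
    (hg : DifferentiableAt ℝ g (p, u)) : HasDerivAt (fun s => g (p, s)) (du g (p, u)) u :=
  hg.hasFDerivAt.comp_hasDerivAt u ((hasDerivAt_const u p).prodMk (hasDerivAt_id u))

theorem eq_of_hasDerivAt_zero {I : Set ℝ} (hI : IsOpen I) (hIc : IsConnected I) {g : ℝ → ℝ}
    (hg : ∀ s ∈ I, HasDerivAt g 0 s) {u v : ℝ} (hu : u ∈ I) (hv : v ∈ I) : g u = g v :=
  hI.is_const_of_deriv_eq_zero hIc.isPreconnected
    (fun s hs => (hg s hs).differentiableAt.differentiableWithinAt)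
    (fun s hs => (hg s hs).deriv) hu hv

/-- On the connected `I` one integrates `∂ᵤξ = 0` and `∂ᵤ²η = 0`. All coefficients are read off at
one fixed value `u₀`, so they inherit smoothness in `p`. -/
theorem IsSym.exists_eq_affineField {Ω : Set H1} (hΩ : IsOpen Ω) {I : Set ℝ} (hI : IsOpen I)
    (hIc : IsConnected I) {f : ℝ → ℝ} (hf : ∀ u ∈ I, DifferentiableAt ℝ f u) {V : VField}
    (hV : IsSym Ω I f V) : ∃ (ξ : H1 → H1) (α β : H1 → ℝ), ContDiffOn ℝ ∞ ξ Ω ∧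
      ContDiffOn ℝ ∞ α Ω ∧ ContDiffOn ℝ ∞ β Ω ∧
      Set.EqOn V (affineField ξ α β) (Ω ×ˢ I) := by
  obtain ⟨u₀, hu₀⟩ := hIc.nonempty
  have hD := hΩ.prod hI
  have hVq : ∀ {q}, q ∈ Ω ×ˢ I → ContDiffAt ℝ ∞ V q := fun hq =>
    hV.1.contDiffAt (hD.mem_nhds hq)
  have hs2 : ∀ {q}, q ∈ Ω ×ˢ I → ContDiffAt ℝ ∞ (fun q => (V q).2) q := fun hq => (hVq hq).snd
  have hs1 : ∀ k {q}, q ∈ Ω ×ˢ I → ContDiffAt ℝ ∞ (fun q => (V q).1 k) q := fun k q hq =>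
    contDiffAt_pi.1 (hVq hq).fst k
  have hins : ∀ p : H1, ContDiffAt ℝ ∞ (fun p : H1 => (p, u₀)) p := fun p =>
    contDiffAt_id.prodMk contDiffAt_const
  have hα : ContDiffOn ℝ ∞ (fun p => du (fun q => (V q).2) (p, u₀)) Ω := fun p hp =>
    (ContDiffAt.comp p (contDiffAt_du (hs2 ⟨hp, hu₀⟩)) (hins p)).contDiffWithinAt
  refine ⟨fun p => (V (p, u₀)).1, fun p => du (fun q => (V q).2) (p, u₀),
    fun p => (V (p, u₀)).2 - du (fun q => (V q).2) (p, u₀) * u₀, fun p hp =>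
    (ContDiffAt.comp p (hVq ⟨hp, hu₀⟩).fst (hins p)).contDiffWithinAt, hα,
    ContDiffOn.sub (fun p hp =>
      (ContDiffAt.comp p (hVq ⟨hp, hu₀⟩).snd (hins p)).contDiffWithinAt)
      (hα.mul contDiffOn_const), ?_⟩
  rintro ⟨p, u⟩ ⟨hp, hu⟩
  have hα' : ∀ s ∈ I, du (fun q => (V q).2) (p, s) = du (fun q => (V q).2) (p, u₀) := by
    intro s hs
    refine eq_of_hasDerivAt_zero hI hIc (g := fun s => du (fun q => (V q).2) (p, s))
      (fun r hr => ?_) hs hu₀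
    rw [← hV.du_du_vertical hΩ hI hf (q := (p, r)) ⟨hp, hr⟩]
    exact hasDerivAt_vertical ((contDiffAt_du (hs2 (q := (p, r)) ⟨hp, hr⟩)).differentiableAt (by simp))
  refine Prod.ext (funext fun k => ?_) ?_
  · refine eq_of_hasDerivAt_zero hI hIc (g := fun s => (V (p, s)).1 k) (fun r hr => ?_) hu hu₀
    rw [← hV.du_spatial hΩ hI hf (q := (p, r)) ⟨hp, hr⟩ k]
    exact hasDerivAt_vertical (g := fun q => (V q).1 k)
      ((hs1 k (q := (p, r)) ⟨hp, hr⟩).differentiableAt (by simp))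
  · have h := eq_of_hasDerivAt_zero hI hIc
      (g := fun s => (V (p, s)).2 - du (fun q => (V q).2) (p, u₀) * s) (fun r hr => ?_) hu hu₀
    · change (V (p, u)).2 = du (fun q => (V q).2) (p, u₀) * u
        + ((V (p, u₀)).2 - du (fun q => (V q).2) (p, u₀) * u₀)
      linear_combination h
    · have h1 := hasDerivAt_vertical (g := fun q => (V q).2)
        ((hs2 (q := (p, r)) ⟨hp, hr⟩).differentiableAt (by simp))
      have h2 := h1.fun_sub ((hasDerivAt_id r).const_mul (du (fun q => (V q).2) (p, u₀)))
      rw [hα' r hr, mul_one, sub_self] at h2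
      exact h2

theorem dp_affine {a b : H1 → ℝ} {p : H1} (u : ℝ) (ha : DifferentiableAt ℝ a p)
    (hb : DifferentiableAt ℝ b p) (i : Fin 3) :
    dp i (fun q => a q.1 * q.2 + b q.1) (p, u) = pd i a p * u + pd i b p := by
  have h1 : HasFDerivAt (fun q : H1 × ℝ => a q.1) _ (p, u) :=
    HasFDerivAt.comp (p, u) (g := a) ha.hasFDerivAt hasFDerivAt_fst
  have h2 : HasFDerivAt (fun q : H1 × ℝ => b q.1) _ (p, u) :=
    HasFDerivAt.comp (p, u) (g := b) hb.hasFDerivAt hasFDerivAt_fst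
  rw [dp, ((h1.fun_mul hasFDerivAt_snd).fun_add h2).fderiv]
  simp [pd]
  ring

theorem du_affine {a b : H1 → ℝ} {p : H1} (u : ℝ) (ha : DifferentiableAt ℝ a p)
    (hb : DifferentiableAt ℝ b p) :
    du (fun q => a q.1 * q.2 + b q.1) (p, u) = a p := by
  have h1 : HasFDerivAt (fun q : H1 × ℝ => a q.1) _ (p, u) :=
    HasFDerivAt.comp (p, u) (g := a) ha.hasFDerivAt hasFDerivAt_fst
  have h2 : HasFDerivAt (fun q : H1 × ℝ => b q.1) _ (p, u) :=
    HasFDerivAt.comp (p, u) (g := b) hb.hasFDerivAt hasFDerivAt_fst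
  rw [du, ((h1.fun_mul hasFDerivAt_snd).fun_add h2).fderiv]
  simp

theorem dp_lift {b : H1 → ℝ} {p : H1} (u : ℝ) (hb : DifferentiableAt ℝ b p) (i : Fin 3) :
    dp i (fun q => b q.1) (p, u) = pd i b p := by
  have h := dp_affine (a := fun _ => 0) u (by fun_prop) hb i
  simpa [pd_const] using h

theorem du_lift {b : H1 → ℝ} {p : H1} (u : ℝ) (hb : DifferentiableAt ℝ b p) :
    du (fun q => b q.1) (p, u) = 0 := by
  have h := du_affine (a := fun _ => 0) u (by fun_prop) hb
  simpa using h

theorem ext2_affineField {Ω : Set H1} (hΩ : IsOpen Ω) {ξ : H1 → H1} {α β : H1 → ℝ}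
    (hξ : ContDiffOn ℝ ∞ ξ Ω) (hα : ContDiffOn ℝ ∞ α Ω) (hβ : ContDiffOn ℝ ∞ β Ω)
    {p : H1} (hp : p ∈ Ω) (u : ℝ) (v : Fin 3 → ℝ) (w : Fin 3 → Fin 3 → ℝ) (i j : Fin 3) :
    ext2 (affineField ξ α β) i j (p, u, v, w) =
      pd j (pd i α) p * u + pd j (pd i β) p + v j * pd i α p + v i * pd j α p + w j i * α p
      - ∑ k, (w j k * pd i (fun p => ξ p k) p + v k * pd j (pd i fun p => ξ p k) p)
      - ∑ k, w i k * pd j (fun p => ξ p k) p := by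
  have hD : IsOpen (Ω ×ˢ (Set.univ : Set ℝ)) := hΩ.prod isOpen_univ
  have hpu : (p, u) ∈ Ω ×ˢ (Set.univ : Set ℝ) := ⟨hp, trivial⟩
  have dd : ∀ {g : H1 → ℝ}, ContDiffOn ℝ ∞ g Ω → ∀ q ∈ Ω, DifferentiableAt ℝ g q :=
    fun hg q hq => differentiableAt_of_smooth hΩ hg hq
  have hξk : ∀ k, ContDiffOn ℝ ∞ (fun p => ξ p k) Ω := contDiffOn_pi.1 hξ
  have hsm := contDiffOn_affineField Set.univ hξ hα hβ
  rw [ext2_apply (hsm.contDiffAt (hD.mem_nhds hpu))]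
  have k1 : ∀ k, ∀ q ∈ Ω ×ˢ (Set.univ : Set ℝ), du (fun q : H1 × ℝ => ξ q.1 k) q = 0 :=
    fun k q hq => du_lift q.2 (dd (hξk k) _ hq.1)
  have k2 : ∀ i k, ∀ q ∈ Ω ×ˢ (Set.univ : Set ℝ),
      dp i (fun q : H1 × ℝ => ξ q.1 k) q = pd i (fun p => ξ p k) q.1 :=
    fun i k q hq => dp_lift q.2 (dd (hξk k) _ hq.1) i
  have m1 : ∀ q ∈ Ω ×ˢ (Set.univ : Set ℝ),
      du (fun q : H1 × ℝ => α q.1 * q.2 + β q.1) q = α q.1 :=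
    fun q hq => du_affine q.2 (dd hα _ hq.1) (dd hβ _ hq.1)
  have m2 : ∀ i, ∀ q ∈ Ω ×ˢ (Set.univ : Set ℝ),
      dp i (fun q : H1 × ℝ => α q.1 * q.2 + β q.1) q = pd i α q.1 * q.2 + pd i β q.1 :=
    fun i q hq => dp_affine q.2 (dd hα _ hq.1) (dd hβ _ hq.1) i
  have t0 : ∀ i k, totalD0 i (fun q : H1 × ℝ => ξ q.1 k) (p, u, v) = pd i (fun p => ξ p k) p :=
    fun i k => by rw [totalD0_eq, k1 k _ hpu, k2 i k _ hpu, mul_zero, add_zero]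
  have t2 : ∀ i j k, totalD2 i j (fun q : H1 × ℝ => ξ q.1 k) (p, u, v, w)
      = pd j (pd i fun p => ξ p k) p := by
    intro i j k
    have sk := dd (contDiffOn_pd hΩ (hξk k) i) p hp
    rw [totalD2, k1 k _ hpu, dp_congr hD j (k2 i k) hpu, du_congr hD (k2 i k) hpu,
      dp_congr hD j (k1 k) hpu, du_congr hD (k1 k) hpu, dp_lift u sk j, du_lift u sk]
    simp [dp, du]
  have s2 : totalD2 i j (fun q : H1 × ℝ => α q.1 * q.2 + β q.1) (p, u, v, w)
      = pd j (pd i α) p * u + pd j (pd i β) p + v j * pd i α p + v i * pd j α p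
        + w j i * α p := by
    have sa := dd (contDiffOn_pd hΩ hα i) p hp
    have sb := dd (contDiffOn_pd hΩ hβ i) p hp
    rw [totalD2, m1 _ hpu, dp_congr hD j (m2 i) hpu, du_congr hD (m2 i) hpu,
      dp_congr hD j m1 hpu, du_congr hD m1 hpu, dp_affine u sa sb j, du_affine u sa sb,
      dp_lift u (dd hα p hp), du_lift u (dd hα p hp)]
    ring
  change totalD2 i j (fun q : H1 × ℝ => α q.1 * q.2 + β q.1) (p, u, v, w)
      - ∑ k, (w j k * totalD0 i (fun q : H1 × ℝ => ξ q.1 k) (p, u, v)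
        + v k * totalD2 i j (fun q : H1 × ℝ => ξ q.1 k) (p, u, v, w))
      - ∑ k, w i k * totalD0 j (fun q : H1 × ℝ => ξ q.1 k) (p, u, v) = _
  simp only [s2, t0, t2]

/-- The determining equations at the point `p`. -/
structure Determining (I : Set ℝ) (f : ℝ → ℝ) (A B τ α β : H1 → ℝ) (p : H1) : Prop where
  diag : opX A p = opY B p
  offDiag : opX B p = -1 * opY A p
  contactX : opX τ p = 2 * p 1 * opX A p + 2 * p 0 * opY A p + 2 * B p
  contactY : opY τ p = 2 * p 1 * opY A p - 2 * p 0 * opY B p - 2 * A p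
  lapA : kohnLaplace A p = 2 * opX α p
  lapB : kohnLaplace B p = 2 * opY α p
  lapT : kohnLaplace τ p = 4 * p 1 * opX α p - 4 * p 0 * opY α p
  zeroth : ∀ u ∈ I, kohnLaplace α p * u + kohnLaplace β p + (α p * u + β p) * deriv f u
    + (2 * opX A p - α p) * f u = 0

/-- After elimination of `u_xx` the condition is affine in the first and second derivatives, and its
coefficients are the determining equations. The coefficient of `w22` is not needed: it follows from
the others, as the converse shows. -/
theorem isSym_affineField_iff {Ω : Set H1} (hΩ : IsOpen Ω) {I : Set ℝ} (hIn : I.Nonempty)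
    {f : ℝ → ℝ} (hf : ∀ u ∈ I, DifferentiableAt ℝ f u) {ξ : H1 → H1} {α β : H1 → ℝ}
    (hξ : ContDiffOn ℝ ∞ ξ Ω) (hα : ContDiffOn ℝ ∞ α Ω) (hβ : ContDiffOn ℝ ∞ β Ω) :
    IsSym Ω I f (affineField ξ α β) ↔ ∀ p ∈ Ω, Determining I f (fun p => ξ p 0)
      (fun p => ξ p 1) (fun p => ξ p 2) α β p := by
  have hξk : ∀ k, ContDiffOn ℝ ∞ (fun p => ξ p k) Ω := contDiffOn_pi.1 hξ
  constructor
  · intro h p hp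
    have ca := contDiffAt_two hΩ hα hp
    have cb := contDiffAt_two hΩ hβ hp
    have ck := fun k => contDiffAt_two hΩ (hξk k) hp
    have H := fun u hu v0 v1 v2 w11 w22 w01 w02 w12 =>
      h.symValue_mkJet hf hp (u := u) hu v0 v1 v2 w11 w22 w01 w02 w12
    simp only [symValue, mkJet, ext2_affineField hΩ hξ hα hβ hp, Fin.sum_univ_three,
      pd_comm ca 2 0, pd_comm cb 2 0, pd_comm (ck _) 2 0, pd_comm ca 2 1, pd_comm cb 2 1,
      pd_comm (ck _) 2 1, affineField] at H
    obtain ⟨u₀, hu₀⟩ := hIn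
    -- The zero jet and the jets with a single unit entry: differences with `h0` give the
    -- coefficients.
    have h0 := H u₀ hu₀ 0 0 0 0 0 0 0 0
    have hv0 := H u₀ hu₀ 1 0 0 0 0 0 0 0
    have hv1 := H u₀ hu₀ 0 1 0 0 0 0 0 0
    have hv2 := H u₀ hu₀ 0 0 1 0 0 0 0 0
    have h11 := H u₀ hu₀ 0 0 0 1 0 0 0 0
    have h01 := H u₀ hu₀ 0 0 0 0 0 1 0 0
    have h02 := H u₀ hu₀ 0 0 0 0 0 0 1 0
    have h12 := H u₀ hu₀ 0 0 0 0 0 0 0 1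
    have hu := fun u hu => H u hu 0 0 0 0 0 0 0 0
    clear H
    simp at h0 hv0 hv1 hv2 h11 h01 h02 h12 hu
    have d1 : opX (fun p => ξ p 0) p = opY (fun p => ξ p 1) p := by
      rw [opX, opY]
      linear_combination (h11 - h0) / 2
    have d2 : opX (fun p => ξ p 1) p = -1 * opY (fun p => ξ p 0) p := by
      rw [opX, opY]
      linear_combination (h01 - h0) / -2
    refine ⟨d1, d2, ?_, ?_, ?_, ?_, ?_, fun u hu' => ?_⟩
    · rw [opX, opX, opY]
      linear_combination (h02 - h0) / -2
    · rw [opX, opY] at d1 d2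
      rw [opY, opY, opY]
      linear_combination (h12 - h0) / -2 - 4 * p 0 * d1 - 2 * p 1 * d2
    · rw [kohnLaplace_eq (ck 0), opX]
      linear_combination h0 - hv0
    · rw [kohnLaplace_eq (ck 1), opY]
      linear_combination h0 - hv1
    · rw [kohnLaplace_eq (ck 2), opX, opY]
      linear_combination h0 - hv2
    · rw [kohnLaplace_eq ca, kohnLaplace_eq cb, opX]
      linear_combination hu u hu'
  · intro h
    rw [isSym_iff hf]
    refine ⟨contDiffOn_affineField I hξ hα hβ, ?_⟩
    rintro ⟨p, u, v, w⟩ hz hs hH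
    have hp : p ∈ Ω := hz.1
    have hd := h p hp
    have ca := contDiffAt_two hΩ hα hp
    have cb := contDiffAt_two hΩ hβ hp
    have ck := fun k => contDiffAt_two hΩ (hξk k) hp
    have w10 : w 1 0 = w 0 1 := hs 1 0
    have w20 : w 2 0 = w 0 2 := hs 2 0
    have w21 : w 2 1 = w 1 2 := hs 2 1
    have d1 := hd.diag
    have d2 := hd.offDiag
    have d3 := hd.contactX
    have d4 := hd.contactY
    have d5 := hd.lapA
    have d6 := hd.lapB
    have d7 := hd.lapT
    have d8 := hd.zeroth u hz.2
    rw [kohnLaplace_eq ca, kohnLaplace_eq cb] at d8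
    rw [kohnLaplace_eq (ck _)] at d5 d6 d7
    simp only [opX, opY] at d1 d2 d3 d4 d5 d6 d7 d8
    simp only [kohnEq] at hH
    simp only [symValue, ext2_affineField hΩ hξ hα hβ hp, Fin.sum_univ_three,
      pd_comm ca 2 0, pd_comm cb 2 0, pd_comm (ck _) 2 0, pd_comm ca 2 1, pd_comm cb 2 1,
      pd_comm (ck _) 2 1, affineField, w10, w20, w21]
    -- The multiplier `α - 2 XA` of the equation is the coefficient of `w00` in `symValue`.
    linear_combination (α p - 2 * (pd 0 (fun p => ξ p 0) p + 2 * p 1 * pd 2 (fun p => ξ p 0) p)) * hH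
      + (2 * w 1 1 - 8 * p 0 * w 1 2 + 8 * p 0 ^ 2 * w 2 2) * d1
      + (-2 * w 0 1 - 4 * p 1 * w 1 2) * d2 + (-2 * w 0 2 - 4 * p 1 * w 2 2) * d3
      + (-2 * w 1 2 + 4 * p 0 * w 2 2) * d4 - v 0 * d5 - v 1 * d6 - v 2 * d7 + d8

/-! ### The general form of the symmetries -/

/-- The field with spatial part `confField c` and vertical part `(a - m/2) u + β`, where `m` is
the conformal factor. -/
noncomputable def genField (c : Fin 8 → ℝ) (a : ℝ) (β : H1 → ℝ) : VField :=
  affineField (confField c) (fun p => a - confFactor c p / 2) β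

theorem contDiff_confField (c : Fin 8 → ℝ) : ContDiff ℝ ∞ (confField c) := by
  rw [contDiff_pi]
  intro k
  fin_cases k <;> simp only [confField, Fin.zero_eta, Fin.mk_one, Fin.reduceFinMk,
    Matrix.cons_val] <;> fun_prop

theorem contDiff_confFactor (c : Fin 8 → ℝ) : ContDiff ℝ ∞ (confFactor c) := by
  unfold confFactor
  fun_prop

/-- The rotational part of the derivative of `confField c`. -/
noncomputable def confRot (c : Fin 8 → ℝ) (p : H1) : ℝ :=
  -3 * c 0 * (p 0 ^ 2 + p 1 ^ 2) - 6 * c 1 * p 0 - 6 * c 2 * p 1 + c 4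

section

set_option linter.unusedSimpArgs false

theorem opX_confField_zero (c : Fin 8 → ℝ) :
    opX (fun p => confField c p 0) = fun p => confFactor c p / 2 := by
  funext p
  simp only [confField, Matrix.cons_val]
  simp (disch := fun_prop) only [opX, pd_mul, pd_add, pd_sub, pd_const, pd_coord, pd_pow,
    Fin.reduceEq, if_true, if_false, confFactor]
  push_cast; ring

theorem opY_confField_zero (c : Fin 8 → ℝ) :
    opY (fun p => confField c p 0) = confRot c := by
  funext p
  simp only [confField, Matrix.cons_val]
  simp (disch := fun_prop) only [opY, pd_mul, pd_add, pd_sub, pd_const, pd_coord, pd_pow,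
    Fin.reduceEq, if_true, if_false, confRot]
  push_cast; ring

theorem opX_confField_one (c : Fin 8 → ℝ) :
    opX (fun p => confField c p 1) = fun p => -confRot c p := by
  funext p
  simp only [confField, Matrix.cons_val]
  simp (disch := fun_prop) only [opX, pd_mul, pd_add, pd_sub, pd_const, pd_coord, pd_pow,
    Fin.reduceEq, if_true, if_false, confRot]
  push_cast; ring

theorem opY_confField_one (c : Fin 8 → ℝ) :
    opY (fun p => confField c p 1) = fun p => confFactor c p / 2 := by
  funext p
  simp only [confField, Matrix.cons_val]
  simp (disch := fun_prop) only [opY, pd_mul, pd_add, pd_sub, pd_const, pd_coord, pd_pow,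
    Fin.reduceEq, if_true, if_false, confFactor]
  push_cast; ring

theorem opX_confField_two (c : Fin 8 → ℝ) : opX (fun p => confField c p 2) =
    fun p => p 1 * confFactor c p + 2 * p 0 * confRot c p + 2 * confField c p 1 := by
  funext p
  simp only [confField, Matrix.cons_val]
  simp (disch := fun_prop) only [opX, pd_mul, pd_add, pd_sub, pd_const, pd_coord, pd_pow,
    Fin.reduceEq, if_true, if_false, confFactor, confRot]
  push_cast; ring

theorem opY_confField_two (c : Fin 8 → ℝ) : opY (fun p => confField c p 2) =
    fun p => 2 * p 1 * confRot c p - p 0 * confFactor c p - 2 * confField c p 0 := by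
  funext p
  simp only [confField, Matrix.cons_val]
  simp (disch := fun_prop) only [opY, pd_mul, pd_add, pd_sub, pd_const, pd_coord, pd_pow,
    Fin.reduceEq, if_true, if_false, confFactor, confRot]
  push_cast; ring

theorem opX_factor (c : Fin 8 → ℝ) (a : ℝ) :
    opX (fun p => a - confFactor c p / 2) = fun p => -(2 * c 2 + 2 * c 0 * p 1) := by
  funext p
  simp only [confFactor, div_eq_mul_inv]
  simp (disch := fun_prop) only [opX, pd_mul, pd_add, pd_sub, pd_const, pd_coord,
    Fin.reduceEq, if_true, if_false]
  ring

theorem opY_factor (c : Fin 8 → ℝ) (a : ℝ) :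
    opY (fun p => a - confFactor c p / 2) = fun p => 2 * c 1 + 2 * c 0 * p 0 := by
  funext p
  simp only [confFactor, div_eq_mul_inv]
  simp (disch := fun_prop) only [opY, pd_mul, pd_add, pd_sub, pd_const, pd_coord,
    Fin.reduceEq, if_true, if_false]
  ring

/-- The factor is affine in the coordinates, and its `X`-derivative depends on `y` only, its
`Y`-derivative on `x` only. So `Δα` drops out of the zeroth order equation. -/
theorem kohnLaplace_factor (c : Fin 8 → ℝ) (a : ℝ) (p : H1) :
    kohnLaplace (fun p => a - confFactor c p / 2) p = 0 := by
  rw [kohnLaplace, opX_factor, opY_factor]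
  simp (disch := fun_prop) only [opX, opY, pd_mul, pd_add, pd_neg, pd_const, pd_coord,
    Fin.reduceEq, if_true, if_false]
  ring

/-- The value is `2 X(-m/2)`. Together with the next lemma it makes `lapA` and `lapB` determine `α`
up to a constant. -/
theorem kohnLaplace_confField_zero (c : Fin 8 → ℝ) (p : H1) :
    kohnLaplace (fun p => confField c p 0) p = -4 * (c 2 + c 0 * p 1) := by
  rw [kohnLaplace, opX_confField_zero, opY_confField_zero]
  unfold confRot
  simp only [confFactor, div_eq_mul_inv]
  simp (disch := fun_prop) only [opX, opY, pd_mul, pd_add, pd_sub, pd_const, pd_coord, pd_pow,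
    Fin.reduceEq, if_true, if_false]
  push_cast; ring

theorem kohnLaplace_confField_one (c : Fin 8 → ℝ) (p : H1) :
    kohnLaplace (fun p => confField c p 1) p = 4 * (c 1 + c 0 * p 0) := by
  rw [kohnLaplace, opX_confField_one, opY_confField_one]
  simp only [confFactor, confRot, div_eq_mul_inv]
  simp (disch := fun_prop) only [opX, opY, pd_mul, pd_add, pd_sub, pd_neg, pd_const, pd_coord,
    pd_pow, Fin.reduceEq, if_true, if_false]
  push_cast; ring

theorem kohnLaplace_confField_two (c : Fin 8 → ℝ) (p : H1) :
    kohnLaplace (fun p => confField c p 2) p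
      = -8 * p 1 * (c 2 + c 0 * p 1) - 8 * p 0 * (c 1 + c 0 * p 0) := by
  rw [kohnLaplace, opX_confField_two, opY_confField_two]
  simp only [confFactor, confRot, confField, Matrix.cons_val]
  simp (disch := fun_prop) only [opX, opY, pd_mul, pd_add, pd_sub, pd_neg, pd_const, pd_coord,
    pd_pow, Fin.reduceEq, if_true, if_false]
  push_cast; ring

end

/-- The first seven determining equations hold identically for these fields. In the last one `XA =
m/2`, so the coefficient of `f` becomes `m - α = 3m/2 - a`. -/
theorem isSym_genField_iff {Ω : Set H1} (hΩ : IsOpen Ω) {I : Set ℝ} (hIn : I.Nonempty)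
    {f : ℝ → ℝ} (hf : ∀ u ∈ I, DifferentiableAt ℝ f u) (c : Fin 8 → ℝ) (a : ℝ) {β : H1 → ℝ}
    (hβ : ContDiffOn ℝ ∞ β Ω) : IsSym Ω I f (genField c a β) ↔ ∀ p ∈ Ω, ∀ u ∈ I,
      kohnLaplace β p + ((a - confFactor c p / 2) * u + β p) * deriv f u
        + (3 / 2 * confFactor c p - a) * f u = 0 := by
  rw [genField, isSym_affineField_iff hΩ hIn hf (contDiff_confField c).contDiffOn
    (contDiffOn_const.sub ((contDiff_confFactor c).contDiffOn.div_const 2)) hβ]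
  refine forall_congr' fun p => forall_congr' fun _ => ⟨fun h u hu => ?_, fun h => ?_⟩
  · have := h.zeroth u hu
    rw [kohnLaplace_factor, opX_confField_zero] at this
    linear_combination this
  · refine ⟨?_, ?_, ?_, ?_, ?_, ?_, ?_, fun u hu => ?_⟩
    · rw [opX_confField_zero, opY_confField_one]
    · rw [opX_confField_one, opY_confField_zero]; ring
    · rw [opX_confField_two, opX_confField_zero, opY_confField_zero]; ring
    · rw [opY_confField_two, opY_confField_zero, opY_confField_one]; ring
    · rw [kohnLaplace_confField_zero, opX_factor]; ring
    · rw [kohnLaplace_confField_one, opY_factor]; ring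
    · rw [kohnLaplace_confField_two, opX_factor, opY_factor]; ring
    · rw [kohnLaplace_factor, opX_confField_zero]
      linear_combination h u hu

/-- The contact form `dt - 2y dx + 2x dy` is evaluated on the field: for this function `C` the two
contact equations become `XC = 4B` and `YC = -4A`, and `conformal_field_eq` applies. -/
theorem IsSym.exists_eq_genField {Ω : Set H1} (hΩ : IsOpen Ω) (hΩc : IsConnected Ω) {I : Set ℝ}
    (hI : IsOpen I) (hIc : IsConnected I) {f : ℝ → ℝ} (hf : ∀ u ∈ I, DifferentiableAt ℝ f u)
    {V : VField} (hV : IsSym Ω I f V) : ∃ (c : Fin 8 → ℝ) (a : ℝ) (β : H1 → ℝ),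
      ContDiffOn ℝ ∞ β Ω ∧ Set.EqOn V (genField c a β) (Ω ×ˢ I) := by
  obtain ⟨ξ, α, β, hξ, hα, hβ, hVe⟩ := hV.exists_eq_affineField hΩ hI hIc hf
  have hd := (isSym_affineField_iff hΩ hIc.nonempty hf hξ hα hβ).1 (hV.congr hΩ hI hf hVe)
  have hξk : ∀ k, ContDiffOn ℝ ∞ (fun p => ξ p k) Ω := contDiffOn_pi.1 hξ
  have hA := fun p (hp : p ∈ Ω) => differentiableAt_of_smooth hΩ (hξk 0) hp
  have hB := fun p (hp : p ∈ Ω) => differentiableAt_of_smooth hΩ (hξk 1) hp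
  have hT := fun p (hp : p ∈ Ω) => differentiableAt_of_smooth hΩ (hξk 2) hp
  have hC : ContDiffOn ℝ ∞ (fun p => ξ p 2 - 2 * p 1 * ξ p 0 + 2 * p 0 * ξ p 1) Ω :=
    ((hξk 2).sub ((contDiffOn_const.mul (contDiffOn_coord Ω 1)).mul (hξk 0))).add
      ((contDiffOn_const.mul (contDiffOn_coord Ω 0)).mul (hξk 1))
  have hpd : ∀ i, ∀ p ∈ Ω, pd i (fun p => ξ p 2 - 2 * p 1 * ξ p 0 + 2 * p 0 * ξ p 1) p
      = pd i (fun p => ξ p 2) p - 2 * p 1 * pd i (fun p => ξ p 0) p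
        + 2 * p 0 * pd i (fun p => ξ p 1) p - (if 1 = i then 2 else 0) * ξ p 0
        + (if 0 = i then 2 else 0) * ξ p 1 := by
    intro i p hp
    have h0 := hA p hp
    have h1 := hB p hp
    have h2 := hT p hp
    rw [pd_add _ (by fun_prop) (by fun_prop), pd_sub _ (by fun_prop) (by fun_prop),
      pd_mul _ (by fun_prop) h0, pd_mul _ (by fun_prop) h1, pd_mul _ (by fun_prop) (by fun_prop),
      pd_mul _ (by fun_prop) (by fun_prop), pd_const, pd_coord, pd_coord]
    split_ifs <;> ring
  obtain ⟨c, hc⟩ := conformal_field_eq hΩ hΩc (hξk 0) (hξk 1) hC (fun p hp => (hd p hp).diag)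
    (fun p hp => (hd p hp).offDiag)
    (fun p hp => by
      have h1 := (hd p hp).contactX
      have h2 := (hd p hp).offDiag
      rw [opX, opX, opY] at h1
      rw [opX, opY] at h2
      rw [opX, hpd 0 p hp, hpd 2 p hp]
      simp only [Fin.reduceEq, if_true, if_false]
      linear_combination h1 + 2 * p 0 * h2)
    (fun p hp => by
      have h1 := (hd p hp).contactY
      rw [opY, opY, opY] at h1
      rw [opY, hpd 1 p hp, hpd 2 p hp]
      simp only [Fin.reduceEq, if_true, if_false]
      linear_combination h1)
  have hξc : ∀ p ∈ Ω, ξ p = confField c p := by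
    intro p hp
    obtain ⟨h0, h1, h2⟩ := hc p hp
    funext k
    fin_cases k
    · exact h0
    · exact h1
    · exact (by linear_combination h2 : ξ p 2 = confField c p 2)
  -- `lapA` and `lapB` give the frame derivatives of `α`, which are those of `-m/2`. The leading `0`
  -- matches the shape of `opX_factor`.
  obtain ⟨a, ha⟩ := exists_const_of_frame_eq hΩ hΩc hα
    (h := fun p => 0 - confFactor c p / 2)
    (contDiffOn_const.sub ((contDiff_confFactor c).contDiffOn.div_const 2))
    (fun p hp => by
      have h := (hd p hp).lapA
      rw [kohnLaplace_congr hΩ (fun q hq => by rw [hξc q hq]) hp,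
        kohnLaplace_confField_zero] at h
      rw [opX_factor]
      linear_combination -h / 2)
    (fun p hp => by
      have h := (hd p hp).lapB
      rw [kohnLaplace_congr hΩ (fun q hq => by rw [hξc q hq]) hp,
        kohnLaplace_confField_one] at h
      rw [opY_factor]
      linear_combination -h / 2)
  refine ⟨c, a, β, hβ, fun q hq => (hVe hq).trans ?_⟩
  rw [genField, affineField, affineField, hξc _ hq.1, ha _ hq.1]
  rw [show 0 - confFactor c q.1 / 2 + a = a - confFactor c q.1 / 2 by ring]

/-! ### Linearity of the operator and of the symmetry condition -/

theorem opX_lin {g h : H1 → ℝ} {p : H1} (r s : ℝ) (hg : DifferentiableAt ℝ g p)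
    (hh : DifferentiableAt ℝ h p) :
    opX (fun q => r * g q + s * h q) p = r * opX g p + s * opX h p := by
  have h1 : ∀ i, pd i (fun q => r * g q + s * h q) p = r * pd i g p + s * pd i h p := fun i => by
    rw [pd_add _ (hg.const_mul r) (hh.const_mul s), pd_const_mul _ _ _ hg, pd_const_mul _ _ _ hh]
  rw [opX, opX, opX, h1, h1]
  ring

theorem opY_lin {g h : H1 → ℝ} {p : H1} (r s : ℝ) (hg : DifferentiableAt ℝ g p)
    (hh : DifferentiableAt ℝ h p) :
    opY (fun q => r * g q + s * h q) p = r * opY g p + s * opY h p := by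
  have h1 : ∀ i, pd i (fun q => r * g q + s * h q) p = r * pd i g p + s * pd i h p := fun i => by
    rw [pd_add _ (hg.const_mul r) (hh.const_mul s), pd_const_mul _ _ _ hg, pd_const_mul _ _ _ hh]
  rw [opY, opY, opY, h1, h1]
  ring

theorem kohnLaplace_lin {Ω : Set H1} (hΩ : IsOpen Ω) {g h : H1 → ℝ} (r s : ℝ)
    (hg : ContDiffOn ℝ ∞ g Ω) (hh : ContDiffOn ℝ ∞ h Ω) {p : H1} (hp : p ∈ Ω) :
    kohnLaplace (fun q => r * g q + s * h q) p = r * kohnLaplace g p + s * kohnLaplace h p := by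
  have dd : ∀ {g : H1 → ℝ}, ContDiffOn ℝ ∞ g Ω → ∀ q ∈ Ω, DifferentiableAt ℝ g q :=
    fun hg q hq => differentiableAt_of_smooth hΩ hg hq
  rw [kohnLaplace, opX_congr hΩ (fun q hq => opX_lin r s (dd hg q hq) (dd hh q hq)) hp,
    opY_congr hΩ (fun q hq => opY_lin r s (dd hg q hq) (dd hh q hq)) hp,
    opX_lin r s (dd (contDiffOn_opX hΩ hg) p hp) (dd (contDiffOn_opX hΩ hh) p hp),
    opY_lin r s (dd (contDiffOn_opY hΩ hg) p hp) (dd (contDiffOn_opY hΩ hh) p hp),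
    kohnLaplace, kohnLaplace]
  ring

theorem kohnLaplace_const (b : ℝ) (p : H1) : kohnLaplace (fun _ => b) p = 0 := by
  have hX : opX (fun _ => b) = fun _ => 0 := funext fun q => by simp [opX, pd_const]
  have hY : opY (fun _ => b) = fun _ => 0 := funext fun q => by simp [opY, pd_const]
  rw [kohnLaplace, hX, hY]
  simp [opX, opY, pd_const]

theorem confField_lin (r s : ℝ) (c d : Fin 8 → ℝ) (p : H1) :
    confField (r • c + s • d) p = r • confField c p + s • confField d p := by
  funext k
  fin_cases k <;> simp [confField] <;> ring

theorem confFactor_lin (r s : ℝ) (c d : Fin 8 → ℝ) (p : H1) :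
    confFactor (r • c + s • d) p = r * confFactor c p + s * confFactor d p := by
  simp [confFactor]
  ring

theorem genField_lin (r s : ℝ) (c d : Fin 8 → ℝ) (a b : ℝ) (β γ : H1 → ℝ) :
    genField (r • c + s • d) (r * a + s * b) (fun p => r * β p + s * γ p)
      = r • genField c a β + s • genField d b γ := by
  funext z
  refine Prod.ext (confField_lin r s c d z.1) ?_
  simp only [genField, affineField, confFactor_lin, Pi.add_apply, Pi.smul_apply, Prod.snd_add,
    Prod.smul_snd, smul_eq_mul]
  ring

section

variable {Ω : Set H1} {I : Set ℝ} {f : ℝ → ℝ}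

/-- This ends the use of prolongations: from here on only the scalar equation is studied. -/
theorem isSym_iff_exists (hΩ : IsOpen Ω) (hΩc : IsConnected Ω) (hI : IsOpen I)
    (hIc : IsConnected I) (hf : ∀ u ∈ I, DifferentiableAt ℝ f u) {V : VField} :
    IsSym Ω I f V ↔ ∃ (c : Fin 8 → ℝ) (a : ℝ) (β : H1 → ℝ), ContDiffOn ℝ ∞ β Ω ∧
      Set.EqOn V (genField c a β) (Ω ×ˢ I) ∧ ∀ p ∈ Ω, ∀ u ∈ I,
        kohnLaplace β p + ((a - confFactor c p / 2) * u + β p) * deriv f u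
          + (3 / 2 * confFactor c p - a) * f u = 0 := by
  constructor
  · intro h
    obtain ⟨c, a, β, hβ, he⟩ := h.exists_eq_genField hΩ hΩc hI hIc hf
    exact ⟨c, a, β, hβ, he,
      (isSym_genField_iff hΩ hIc.nonempty hf c a hβ).1 (h.congr hΩ hI hf he)⟩
  · rintro ⟨c, a, β, hβ, he, h⟩
    exact ((isSym_genField_iff hΩ hIc.nonempty hf c a hβ).2 h).congr hΩ hI hf he.symm

/-- Linear combinations of symmetries are symmetries. -/
theorem IsSym.lin (hΩ : IsOpen Ω) (hΩc : IsConnected Ω) (hI : IsOpen I)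
    (hIc : IsConnected I) (hf : ∀ u ∈ I, DifferentiableAt ℝ f u) {V W : VField}
    (hV : IsSym Ω I f V) (hW : IsSym Ω I f W) (r s : ℝ) : IsSym Ω I f (r • V + s • W) := by
  rw [isSym_iff_exists hΩ hΩc hI hIc hf] at hV hW ⊢
  obtain ⟨c, a, β, hβ, he, h⟩ := hV
  obtain ⟨d, b, γ, hγ, hd, k⟩ := hW
  refine ⟨r • c + s • d, r * a + s * b, fun p => r * β p + s * γ p,
    (contDiffOn_const.mul hβ).add (contDiffOn_const.mul hγ), fun q hq => ?_, fun p hp u hu => ?_⟩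
  · rw [genField_lin, Pi.add_apply, Pi.smul_apply, Pi.smul_apply, he hq, hd hq]; rfl
  · rw [kohnLaplace_lin hΩ r s hβ hγ hp, confFactor_lin]
    linear_combination r * h p hp u hu + s * k p hp u hu

theorem IsSym.of_mem_span (hΩ : IsOpen Ω) (hΩc : IsConnected Ω) (hI : IsOpen I)
    (hIc : IsConnected I) (hf : ∀ u ∈ I, DifferentiableAt ℝ f u) {S : Set VField}
    (hS : ∀ V ∈ S, IsSym Ω I f V) {V : VField} (hV : V ∈ Submodule.span ℝ S) :
    IsSym Ω I f V := by
  induction hV using Submodule.span_induction with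
  | mem V h => exact hS V h
  | zero =>
    refine (isSym_iff_exists hΩ hΩc hI hIc hf).2 ⟨0, 0, fun _ => 0, contDiffOn_const,
      fun z _ => ?_, fun p _ u _ => ?_⟩
    · refine Prod.ext (funext fun k => ?_) ?_
      · fin_cases k <;> simp [genField, affineField, confField]
      · simp [genField, affineField, confFactor]
    · rw [kohnLaplace_const]; simp [confFactor]
  | add V W _ _ hV hW =>
    have h := IsSym.lin hΩ hΩc hI hIc hf hV hW 1 1
    rwa [one_smul, one_smul] at h
  | smul r V _ hV =>
    have h := IsSym.lin hΩ hΩc hI hIc hf hV hV r 0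
    rwa [zero_smul, add_zero] at h

/-- Symmetries form a linear space and depend only on values over `Ω × I`; so one inclusion is
checked on generators and the other on normal forms. -/
theorem symSpannedBy_of (hΩ : IsOpen Ω) (hΩc : IsConnected Ω) (hI : IsOpen I)
    (hIc : IsConnected I) (hf : ∀ u ∈ I, DifferentiableAt ℝ f u) {S : Set VField}
    (hS : ∀ V ∈ S, IsSym Ω I f V)
    (h : ∀ (c : Fin 8 → ℝ) (a : ℝ) (β : H1 → ℝ), ContDiffOn ℝ ∞ β Ω → (∀ p ∈ Ω, ∀ u ∈ I,
      kohnLaplace β p + ((a - confFactor c p / 2) * u + β p) * deriv f u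
        + (3 / 2 * confFactor c p - a) * f u = 0) → SpannedOn (Ω ×ˢ I) S (genField c a β)) :
    SymSpannedBy Ω I f S := by
  intro V
  constructor
  · intro hV
    obtain ⟨c, a, β, hβ, he, hode⟩ := (isSym_iff_exists hΩ hΩc hI hIc hf).1 hV
    obtain ⟨W, hW, hW'⟩ := h c a β hβ hode
    exact ⟨W, hW, he.trans hW'⟩
  · rintro ⟨W, hW, he⟩
    exact (IsSym.of_mem_span hΩ hΩc hI hIc hf hS hW).congr hΩ hI hf he.symm

theorem IsSym.of_genField (hΩ : IsOpen Ω) (hI : I.Nonempty)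
    (hf : ∀ u ∈ I, DifferentiableAt ℝ f u) {V : VField} {c : Fin 8 → ℝ} {a : ℝ} {β : H1 → ℝ}
    (hβ : ContDiffOn ℝ ∞ β Ω) (hV : V = genField c a β) (h : ∀ p ∈ Ω, ∀ u ∈ I,
      kohnLaplace β p + ((a - confFactor c p / 2) * u + β p) * deriv f u
        + (3 / 2 * confFactor c p - a) * f u = 0) : IsSym Ω I f V :=
  hV ▸ (isSym_genField_iff hΩ hI hf c a hβ).2 h

end

/-! ### The generators in the general form -/

theorem fieldT_eq : fieldT = genField ![0, 0, 0, 0, 0, 0, 0, 1] 0 (fun _ => 0) := by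
  funext z
  refine Prod.ext (funext fun k => ?_) ?_
  · fin_cases k <;> simp [fieldT, genField, affineField, confField]
  · simp [fieldT, genField, affineField, confFactor]

theorem fieldR_eq : fieldR = genField ![0, 0, 0, 0, 1, 0, 0, 0] 0 (fun _ => 0) := by
  funext z
  refine Prod.ext (funext fun k => ?_) ?_
  · fin_cases k <;> simp [fieldR, genField, affineField, confField]
  · simp [fieldR, genField, affineField, confFactor]

theorem fieldX_eq : fieldX = genField ![0, 0, 0, 0, 0, 1, 0, 0] 0 (fun _ => 0) := by
  funext z
  refine Prod.ext (funext fun k => ?_) ?_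
  · fin_cases k <;> simp [fieldX, genField, affineField, confField]
  · simp [fieldX, genField, affineField, confFactor]

theorem fieldY_eq : fieldY = genField ![0, 0, 0, 0, 0, 0, 1, 0] 0 (fun _ => 0) := by
  funext z
  refine Prod.ext (funext fun k => ?_) ?_
  · fin_cases k <;> simp [fieldY, genField, affineField, confField]
  · simp [fieldY, genField, affineField, confFactor]

theorem fieldV1_eq : fieldV1 = genField ![1, 0, 0, 0, 0, 0, 0, 0] 0 (fun _ => 0) := by
  funext z
  refine Prod.ext (funext fun k => ?_) ?_
  · fin_cases k <;> simp [fieldV1, genField, affineField, confField]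
  · simp [fieldV1, genField, affineField, confFactor]

theorem fieldV2_eq : fieldV2 = genField ![0, 1, 0, 0, 0, 0, 0, 0] 0 (fun _ => 0) := by
  funext z
  refine Prod.ext (funext fun k => ?_) ?_
  · fin_cases k <;> simp [fieldV2, genField, affineField, confField]
  · simp [fieldV2, genField, affineField, confFactor]; ring

theorem fieldV3_eq : fieldV3 = genField ![0, 0, 1, 0, 0, 0, 0, 0] 0 (fun _ => 0) := by
  funext z
  refine Prod.ext (funext fun k => ?_) ?_
  · fin_cases k <;> simp [fieldV3, genField, affineField, confField]
  · simp [fieldV3, genField, affineField, confFactor]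
    left; ring

/-- The factor is 2 for the dilation, so the constant 1 cancels `-m/2` and leaves no vertical part.
-/
theorem fieldZ1_eq : fieldZ1 = genField ![0, 0, 0, 1, 0, 0, 0, 0] 1 (fun _ => 0) := by
  funext z
  refine Prod.ext (funext fun k => ?_) ?_
  · fin_cases k <;> simp [fieldZ1, genField, affineField, confField]
  · simp [fieldZ1, genField, affineField, confFactor]

theorem fieldZ2_eq : fieldZ2 = genField 0 1 (fun _ => 0) := by
  funext z
  refine Prod.ext (funext fun k => ?_) ?_
  · fin_cases k <;> simp [fieldZ2, genField, affineField, confField]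
  · simp [fieldZ2, genField, affineField, confFactor]

theorem fieldZ3_eq : fieldZ3 = genField ![0, 0, 0, 1, 0, 0, 0, 0] 1 (fun _ => -2) := by
  funext z
  refine Prod.ext (funext fun k => ?_) ?_
  · fin_cases k <;> simp [fieldZ3, genField, affineField, confField]
  · simp [fieldZ3, genField, affineField, confFactor]

theorem fieldZ_eq (p : ℝ) :
    fieldZ p = genField ![0, 0, 0, 1, 0, 0, 0, 0] (1 + 2 / (1 - p)) (fun _ => 0) := by
  funext z
  refine Prod.ext (funext fun k => ?_) ?_
  · fin_cases k <;> simp [fieldZ, genField, affineField, confField]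
  · simp [fieldZ, genField, affineField, confFactor]

theorem vertical_eq (β : H1 → ℝ) : (fun z => (0, β z.1) : VField) = genField 0 0 β := by
  funext z
  refine Prod.ext (funext fun k => ?_) ?_
  · fin_cases k <;> simp [genField, affineField, confField]
  · simp [genField, affineField, confFactor]

/-- The combination of the basic generators with the given coefficients. -/
noncomputable def basicComb (c : Fin 8 → ℝ) : VField :=
  c 4 • fieldR + c 5 • fieldX + c 6 • fieldY + c 7 • fieldT

theorem basicComb_mem {S : Set VField} (hS : basic ⊆ S) (c : Fin 8 → ℝ) :
    basicComb c ∈ Submodule.span ℝ S := by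
  have h : ∀ V ∈ basic, V ∈ Submodule.span ℝ S := fun V hV => Submodule.subset_span (hS hV)
  exact add_mem (add_mem (add_mem (Submodule.smul_mem _ _ (h _ (by simp [basic])))
    (Submodule.smul_mem _ _ (h _ (by simp [basic]))))
    (Submodule.smul_mem _ _ (h _ (by simp [basic]))))
    (Submodule.smul_mem _ _ (h _ (by simp [basic])))

/-- `Z₁` already carries the constant 1, so `Z₂` receives `a - c 3` rather than `a`. -/
theorem genField_eq_comb (c : Fin 8 → ℝ) (a : ℝ) (β : H1 → ℝ) : genField c a β =
    basicComb c + c 0 • fieldV1 + c 1 • fieldV2 + c 2 • fieldV3 + c 3 • fieldZ1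
      + (a - c 3) • fieldZ2 + fun z => (0, β z.1) := by
  funext z
  refine Prod.ext (funext fun k => ?_) ?_
  · fin_cases k <;> simp [genField, affineField, confField, basicComb, fieldR, fieldX, fieldY,
      fieldT, fieldV1, fieldV2, fieldV3, fieldZ1, fieldZ2] <;> ring
  · simp [genField, affineField, confFactor, basicComb, fieldR, fieldX, fieldY,
      fieldT, fieldV1, fieldV2, fieldV3, fieldZ1, fieldZ2]
    ring

/-! ### Elementary uniqueness statements -/

/-- The device for separating variables: an identity in `u` on the open set `I` may be
differentiated. -/
theorem hasDerivAt_eq_zero_of_vanish {I : Set ℝ} (hI : IsOpen I) {g : ℝ → ℝ} {g' u : ℝ}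
    (h : ∀ s ∈ I, g s = 0) (hu : u ∈ I) (hg : HasDerivAt g g' u) : g' = 0 := by
  have h0 : g =ᶠ[nhds u] fun _ => 0 := Filter.eventually_of_mem (hI.mem_nhds hu) h
  exact hg.unique ((hasDerivAt_const u (0 : ℝ)).congr_of_eventuallyEq h0)

theorem affine_eq_zero {I : Set ℝ} (hI : IsOpen I) (hIn : I.Nonempty) {A B : ℝ}
    (h : ∀ u ∈ I, A * u + B = 0) : A = 0 ∧ B = 0 := by
  obtain ⟨u, hu⟩ := hIn
  have hA : A * 1 = 0 := hasDerivAt_eq_zero_of_vanish hI h hu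
    (((hasDerivAt_id u).const_mul A).add_const B)
  rw [mul_one] at hA
  refine ⟨hA, ?_⟩
  have := h u hu
  rwa [hA, zero_mul, zero_add] at this

theorem exists_mem_ne {I : Set ℝ} (hI : IsOpen I) (hIn : I.Nonempty) (v : ℝ) :
    ∃ u ∈ I, u ≠ v := by
  by_contra! h
  have := affine_eq_zero hI hIn (A := 1) (B := -v) fun u hu => by rw [h u hu]; ring
  exact one_ne_zero this.1

/-- The gradient of an affine function at a single point of the open set determines its linear part.
-/
theorem confFactor_eq_const {Ω : Set H1} (hΩ : IsOpen Ω) (hΩn : Ω.Nonempty) {c : Fin 8 → ℝ}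
    {s : ℝ} (h : ∀ p ∈ Ω, confFactor c p = s) :
    c 0 = 0 ∧ c 1 = 0 ∧ c 2 = 0 ∧ 2 * c 3 = s := by
  obtain ⟨p, hp⟩ := hΩn
  have hi : ∀ i, pd i (confFactor c) p = 0 := fun i => by
    rw [pd_congr hΩ i h hp, pd_const]
  have hg : ∀ i, pd i (confFactor c) p = 2 * c 0 * (if 2 = i then 1 else 0)
      + 4 * c 2 * (if 0 = i then 1 else 0) - 4 * c 1 * (if 1 = i then 1 else 0) := by
    intro i
    unfold confFactor
    simp (disch := fun_prop) only [pd_mul, pd_add, pd_sub, pd_const, pd_coord]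
    ring
  have h0 := hi 0
  have h1 := hi 1
  have h2 := hi 2
  rw [hg] at h0 h1 h2
  simp at h0 h1 h2
  refine ⟨h2, h1, h0, ?_⟩
  have := h p hp
  rw [confFactor, h0, h1, h2] at this
  linarith

/-! ### The symmetry algebras for the special right-hand sides -/

section

variable {Ω : Set H1} {I : Set ℝ}

theorem isSym_basic (hΩ : IsOpen Ω) (hI : I.Nonempty) {f : ℝ → ℝ}
    (hf : ∀ u ∈ I, DifferentiableAt ℝ f u) {V : VField} (hV : V ∈ basic) : IsSym Ω I f V := by
  have h0 : ContDiffOn ℝ ∞ (fun _ : H1 => (0 : ℝ)) Ω := contDiffOn_const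
  simp only [basic, Set.mem_insert_iff, Set.mem_singleton_iff] at hV
  rcases hV with rfl | rfl | rfl | rfl
  · exact IsSym.of_genField hΩ hI hf h0 fieldT_eq fun p _ u _ => by
      rw [kohnLaplace_const]; simp [confFactor]
  · exact IsSym.of_genField hΩ hI hf h0 fieldR_eq fun p _ u _ => by
      rw [kohnLaplace_const]; simp [confFactor]
  · exact IsSym.of_genField hΩ hI hf h0 fieldX_eq fun p _ u _ => by
      rw [kohnLaplace_const]; simp [confFactor]
  · exact IsSym.of_genField hΩ hI hf h0 fieldY_eq fun p _ u _ => by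
      rw [kohnLaplace_const]; simp [confFactor]

theorem gensZero_eq_genField {V : VField} (hV : V ∈ gensZero Ω) :
    ∃ (c : Fin 8 → ℝ) (a : ℝ) (β : H1 → ℝ), ContDiffOn ℝ ∞ β Ω ∧
      (∀ p ∈ Ω, kohnLaplace β p = 0) ∧ V = genField c a β := by
  have h0 : ContDiffOn ℝ ∞ (fun _ : H1 => (0 : ℝ)) Ω := contDiffOn_const
  have h1 : ∀ p ∈ Ω, kohnLaplace (fun _ : H1 => (0 : ℝ)) p = 0 := fun p _ => kohnLaplace_const 0 p
  simp only [gensZero, basic, fieldsW, Set.mem_union, Set.mem_insert_iff, Set.mem_singleton_iff,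
    Set.mem_ofPred_eq] at hV
  rcases hV with ((rfl | rfl | rfl | rfl) | (rfl | rfl | rfl | rfl | rfl)) | ⟨β, hβ, hβ', rfl⟩
  · exact ⟨_, _, _, h0, h1, fieldT_eq⟩
  · exact ⟨_, _, _, h0, h1, fieldR_eq⟩
  · exact ⟨_, _, _, h0, h1, fieldX_eq⟩
  · exact ⟨_, _, _, h0, h1, fieldY_eq⟩
  · exact ⟨_, _, _, h0, h1, fieldV1_eq⟩
  · exact ⟨_, _, _, h0, h1, fieldV2_eq⟩
  · exact ⟨_, _, _, h0, h1, fieldV3_eq⟩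
  · exact ⟨_, _, _, h0, h1, fieldZ1_eq⟩
  · exact ⟨_, _, _, h0, h1, fieldZ2_eq⟩
  · exact ⟨_, _, _, hβ, fun p hp => by simpa using hβ' p hp, vertical_eq β⟩

theorem genField_mem_span_gensZero {β : H1 → ℝ} (hβ : ContDiffOn ℝ ∞ β Ω)
    (h : ∀ p ∈ Ω, kohnLaplace β p = 0) (c : Fin 8 → ℝ) (a : ℝ) :
    genField c a β ∈ Submodule.span ℝ (gensZero Ω) := by
  rw [genField_eq_comb]
  have hb : basic ⊆ gensZero Ω := fun V hV => Or.inl (Or.inl hV)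
  have hg : ∀ V ∈ gensZero Ω, V ∈ Submodule.span ℝ (gensZero Ω) := fun V hV =>
    Submodule.subset_span hV
  refine add_mem (add_mem (add_mem (add_mem (add_mem (add_mem (basicComb_mem hb c)
    (Submodule.smul_mem _ _ (hg _ ?_))) (Submodule.smul_mem _ _ (hg _ ?_)))
    (Submodule.smul_mem _ _ (hg _ ?_))) (Submodule.smul_mem _ _ (hg _ ?_)))
    (Submodule.smul_mem _ _ (hg _ ?_))) (hg _ ?_)
  · simp [gensZero]
  · simp [gensZero]
  · simp [gensZero]
  · simp [gensZero]
  · simp [gensZero]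
  · exact Or.inr ⟨β, hβ, fun p hp => by rw [h p hp]; ring, rfl⟩

theorem symSpannedBy_zero (hΩ : IsOpen Ω) (hΩc : IsConnected Ω) (hI : IsOpen I)
    (hIc : IsConnected I) : SymSpannedBy Ω I (fun _ => 0) (gensZero Ω) := by
  have hf : ∀ u ∈ I, DifferentiableAt ℝ (fun _ : ℝ => (0 : ℝ)) u := fun u _ => by fun_prop
  refine symSpannedBy_of hΩ hΩc hI hIc hf (fun V hV => ?_) fun c a β hβ h => ?_
  · obtain ⟨c, a, β, hβ, hβ', rfl⟩ := gensZero_eq_genField hV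
    exact IsSym.of_genField hΩ hIc.nonempty hf hβ rfl fun p hp u _ => by
      rw [hβ' p hp]; simp
  · refine ⟨_, genField_mem_span_gensZero hβ (fun p hp => ?_) c a, Set.eqOn_refl _ _⟩
    obtain ⟨u, hu⟩ := hIc.nonempty
    simpa using h p hp u hu

/-! ### Constant right-hand sides -/

theorem hasFDerivAt_shift (k : ℝ) (z : H1 × ℝ) : HasFDerivAt (shift k)
    ((ContinuousLinearMap.fst ℝ H1 ℝ).prod (ContinuousLinearMap.snd ℝ H1 ℝ +
      (k * z.1 0) • (ContinuousLinearMap.proj (R := ℝ) (φ := fun _ : Fin 3 => ℝ) 0).comp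
        (ContinuousLinearMap.fst ℝ H1 ℝ))) z := by
  have h0 : HasFDerivAt (fun z : H1 × ℝ => z.1 0)
      ((ContinuousLinearMap.proj (R := ℝ) (φ := fun _ : Fin 3 => ℝ) 0).comp
        (ContinuousLinearMap.fst ℝ H1 ℝ)) z :=
    ((ContinuousLinearMap.proj (R := ℝ) (φ := fun _ : Fin 3 => ℝ) 0).comp
        (ContinuousLinearMap.fst ℝ H1 ℝ)).hasFDerivAt
  have h := (hasFDerivAt_fst (p := z)).prodMk
    (hasFDerivAt_snd.fun_add (((h0.pow 2).const_mul k).mul_const (2⁻¹ : ℝ)))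
  refine HasFDerivAt.congr_fderiv (f := shift k) h ?_
  ext v
  · rfl
  · simp; ring
  · rfl
  · simp

/-- The inverse of the derivative of `shift k` at `z`. -/
noncomputable def shiftDeriv (k : ℝ) (z : H1 × ℝ) : (H1 × ℝ) ≃L[ℝ] (H1 × ℝ) :=
  ContinuousLinearEquiv.equivOfInverse
    ((ContinuousLinearMap.fst ℝ H1 ℝ).prod (ContinuousLinearMap.snd ℝ H1 ℝ +
      (k * z.1 0) • (ContinuousLinearMap.proj (R := ℝ) (φ := fun _ : Fin 3 => ℝ) 0).comp
        (ContinuousLinearMap.fst ℝ H1 ℝ)))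
    ((ContinuousLinearMap.fst ℝ H1 ℝ).prod (ContinuousLinearMap.snd ℝ H1 ℝ -
      (k * z.1 0) • (ContinuousLinearMap.proj (R := ℝ) (φ := fun _ : Fin 3 => ℝ) 0).comp
        (ContinuousLinearMap.fst ℝ H1 ℝ)))
    (fun v => by ext <;> simp) (fun v => by ext <;> simp)

theorem pullback_shift (k : ℝ) (V : VField) (z : H1 × ℝ) :
    VectorField.pullback ℝ (shift k) V z =
      ((V (shift k z)).1, (V (shift k z)).2 - k * z.1 0 * (V (shift k z)).1 0) := by
  have h : fderiv ℝ (shift k) z = (shiftDeriv k z : (H1 × ℝ) →L[ℝ] (H1 × ℝ)) :=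
    (hasFDerivAt_shift k z).fderiv
  rw [VectorField.pullback, h, ContinuousLinearMap.inverse_equiv]
  rfl

/-- Pullback under `shift k` as a linear map. -/
noncomputable def pullbackShift (k : ℝ) : VField →ₗ[ℝ] VField where
  toFun := VectorField.pullback ℝ (shift k)
  map_add' V W := by
    funext z
    exact map_add (fderiv ℝ (shift k) z).inverse _ _
  map_smul' r V := by
    funext z
    exact map_smul (fderiv ℝ (shift k) z).inverse r _

/-- The change of the free term of a field under pullback by `shift k`. -/
noncomputable def shiftTerm (k : ℝ) (c : Fin 8 → ℝ) (a : ℝ) (p : H1) : ℝ :=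
  (a - confFactor c p / 2) * (k * p 0 ^ 2 / 2) - k * p 0 * confField c p 0

/-- The shift fixes the space variables and translates `u` by a function of them, so only the free
term changes. -/
theorem pullback_genField (k : ℝ) (c : Fin 8 → ℝ) (a : ℝ) (β : H1 → ℝ) :
    VectorField.pullback ℝ (shift k) (genField c a β)
      = genField c a (fun p => β p + shiftTerm k c a p) := by
  funext z
  rw [pullback_shift]
  refine Prod.ext rfl ?_
  simp only [genField, affineField, shift, shiftTerm]
  ring

theorem contDiff_shiftTerm (k : ℝ) (c : Fin 8 → ℝ) (a : ℝ) : ContDiff ℝ ∞ (shiftTerm k c a) := by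
  have h1 := contDiff_confFactor c
  have h2 : ContDiff ℝ ∞ (fun p => confField c p 0) := contDiff_pi.1 (contDiff_confField c) 0
  unfold shiftTerm
  fun_prop

set_option linter.unusedSimpArgs false in
theorem opX_shiftTerm (k : ℝ) (c : Fin 8 → ℝ) (a : ℝ) : opX (shiftTerm k c a) =
    fun p => -(c 2 + c 0 * p 1) * k * p 0 ^ 2 + (a - confFactor c p) * k * p 0
      - k * confField c p 0 := by
  funext p
  unfold shiftTerm
  simp only [confFactor, confField, Matrix.cons_val, div_eq_mul_inv]
  simp (disch := fun_prop) only [opX, pd_mul, pd_add, pd_sub, pd_const, pd_coord, pd_pow,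
    Fin.reduceEq, if_true, if_false]
  push_cast; ring

set_option linter.unusedSimpArgs false in
theorem opY_shiftTerm (k : ℝ) (c : Fin 8 → ℝ) (a : ℝ) : opY (shiftTerm k c a) =
    fun p => (c 1 + c 0 * p 0) * k * p 0 ^ 2 - k * p 0 * confRot c p := by
  funext p
  unfold shiftTerm
  simp only [confFactor, confField, confRot, Matrix.cons_val, div_eq_mul_inv]
  simp (disch := fun_prop) only [opY, pd_mul, pd_add, pd_sub, pd_const, pd_coord, pd_pow,
    Fin.reduceEq, if_true, if_false]
  push_cast; ring

set_option linter.unusedSimpArgs false in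
-- For `f = k` the scalar equation is `Δβ = k (a - 3m/2)`, and this exhibits `shiftTerm` as a
-- particular solution.
theorem kohnLaplace_shiftTerm (k : ℝ) (c : Fin 8 → ℝ) (a : ℝ) (p : H1) :
    kohnLaplace (shiftTerm k c a) p = k * (a - 3 / 2 * confFactor c p) := by
  rw [kohnLaplace, opX_shiftTerm, opY_shiftTerm]
  simp only [confFactor, confField, confRot, Matrix.cons_val]
  simp (disch := fun_prop) only [opX, opY, pd_mul, pd_add, pd_sub, pd_neg, pd_const, pd_coord,
    pd_pow, Fin.reduceEq, if_true, if_false]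
  push_cast; ring

theorem symSpannedBy_const (hΩ : IsOpen Ω) (hΩc : IsConnected Ω) (hI : IsOpen I)
    (hIc : IsConnected I) (k : ℝ) :
    SymSpannedBy Ω I (fun _ => k) (VectorField.pullback ℝ (shift k) '' gensZero Ω) := by
  have hf : ∀ u ∈ I, DifferentiableAt ℝ (fun _ : ℝ => k) u := fun u _ => by fun_prop
  have hst : ∀ c a, ContDiffOn ℝ ∞ (shiftTerm k c a) Ω := fun c a =>
    (contDiff_shiftTerm k c a).contDiffOn
  refine symSpannedBy_of hΩ hΩc hI hIc hf ?_ fun c a β hβ h => ?_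
  · rintro _ ⟨V, hV, rfl⟩
    obtain ⟨c, a, β, hβ, hβ', rfl⟩ := gensZero_eq_genField hV
    refine IsSym.of_genField hΩ hIc.nonempty hf (hβ.add (hst c a)) (pullback_genField k c a β)
      fun p hp u _ => ?_
    have := kohnLaplace_lin hΩ 1 1 hβ (hst c a) hp
    simp only [one_mul] at this
    rw [this, hβ' p hp, kohnLaplace_shiftTerm, deriv_const]
    ring
  -- Subtracting the particular solution leaves a solution for `f = 0`, whose pullback is the given
  -- field.
  · have hl : ∀ p ∈ Ω, kohnLaplace (fun q => 1 * β q + (-1) * shiftTerm k c a q) p = 0 := by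
      intro p hp
      obtain ⟨u, hu⟩ := hIc.nonempty
      have := h p hp u hu
      rw [deriv_const] at this
      rw [kohnLaplace_lin hΩ 1 (-1) hβ (hst c a) hp, kohnLaplace_shiftTerm]
      linear_combination this
    have hm := genField_mem_span_gensZero
      ((contDiffOn_const.mul hβ).add (contDiffOn_const.mul (hst c a))) hl c a
    refine ⟨_, ?_, Set.eqOn_refl _ _⟩
    have he : genField c a β = pullbackShift k
        (genField c a fun q => 1 * β q + (-1) * shiftTerm k c a q) := by
      refine Eq.trans ?_ (pullback_genField k c a _).symm
      congr 1
      funext p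
      ring
    have hs : VectorField.pullback ℝ (shift k) '' gensZero Ω = pullbackShift k '' gensZero Ω := rfl
    rw [he, hs, Submodule.span_image]
    exact Submodule.mem_map_of_mem hm

/-- Only the second `x`-derivative sees the added term. The regularity is `C²`, as for classical
solutions, so the lemmas for smooth functions are not available. -/
theorem kohnLaplace_add_sq {w : H1 → ℝ} (hΩ : IsOpen Ω) (hw : ContDiffOn ℝ 2 w Ω) (k : ℝ)
    {p : H1} (hp : p ∈ Ω) :
    kohnLaplace (fun p => w p + k * p 0 ^ 2 / 2) p = kohnLaplace w p + k := by
  have hw' : ∀ q ∈ Ω, ContDiffAt ℝ 2 w q := fun q hq => hw.contDiffAt (hΩ.mem_nhds hq)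
  have hd : ∀ i, DifferentiableAt ℝ (pd i w) p := fun i =>
    (((hw' p hp).fderiv_right (m := 1) (by norm_num)).differentiableAt (by norm_num)).clm_apply
      (differentiableAt_const _)
  have hg : ContDiff ℝ 2 (fun p : H1 => k * p 0 ^ 2 / 2) := by fun_prop
  have h1 : ∀ i, ∀ q ∈ Ω, pd i (fun p => w p + k * p 0 ^ 2 / 2) q
      = pd i w q + k * q 0 * (if 0 = i then 1 else 0) := by
    intro i q hq
    have hwq := (hw' q hq).differentiableAt (by norm_num)
    simp only [div_eq_mul_inv]
    simp (disch := fun_prop) only [pd_add, pd_mul, pd_pow, pd_const, pd_coord]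
    push_cast; ring
  have h2 : ∀ i j, pd j (pd i (fun p => w p + k * p 0 ^ 2 / 2)) p
      = pd j (pd i w) p + k * (if 0 = j then 1 else 0) * (if 0 = i then 1 else 0) := by
    intro i j
    have hdi := hd i
    rw [pd_congr hΩ j (h1 i) hp]
    simp (disch := fun_prop) only [pd_add, pd_mul, pd_const, pd_coord]
    ring
  rw [kohnLaplace_eq ((hw' p hp).add hg.contDiffAt), kohnLaplace_eq (hw' p hp)]
  simp only [h2, Fin.reduceEq, if_true, if_false]
  ring

theorem isSolution_const_iff (hΩ : IsOpen Ω) (k : ℝ) (w : H1 → ℝ) :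
    IsSolution Ω (fun _ => k) w ↔
      IsSolution Ω (fun _ => 0) (fun p => w p + k * p 0 ^ 2 / 2) := by
  have hg : ContDiff ℝ 2 (fun p : H1 => k * p 0 ^ 2 / 2) := by fun_prop
  constructor
  · rintro ⟨h1, h2⟩
    refine ⟨h1.add hg.contDiffOn, fun p hp => ?_⟩
    rw [kohnLaplace_add_sq hΩ h1 k hp, add_zero]
    exact h2 p hp
  · rintro ⟨h1, h2⟩
    have hw : ContDiffOn ℝ 2 w Ω := by
      refine (h1.sub hg.contDiffOn).congr fun p _ => ?_
      simp
    refine ⟨hw, fun p hp => ?_⟩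
    have := h2 p hp
    rwa [kohnLaplace_add_sq hΩ hw k hp, add_zero] at this

end

section

variable {Ω : Set H1} {I : Set ℝ}

/-! ### Linear right-hand sides -/

/-- The scalar equation is `k m u + (Δβ + kβ) = 0`: separation in `u` gives `m = 0`, while `a` stays
free. -/
theorem symSpannedBy_linear (hΩ : IsOpen Ω) (hΩc : IsConnected Ω) (hI : IsOpen I)
    (hIc : IsConnected I) {k : ℝ} (hk : k ≠ 0) :
    SymSpannedBy Ω I (fun u => k * u) (basic ∪ {fieldZ2} ∪ fieldsW Ω k) := by
  have hd : ∀ u : ℝ, HasDerivAt (fun u => k * u) k u := fun u => by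
    simpa using (hasDerivAt_id u).const_mul k
  have hf : ∀ u ∈ I, DifferentiableAt ℝ (fun u => k * u) u := fun u _ => (hd u).differentiableAt
  have h0 : ContDiffOn ℝ ∞ (fun _ : H1 => (0 : ℝ)) Ω := contDiffOn_const
  refine symSpannedBy_of hΩ hΩc hI hIc hf ?_ fun c a β hβ h => ?_
  · rintro V ((hV | rfl) | ⟨β, hβ, hβ', rfl⟩)
    · exact isSym_basic hΩ hIc.nonempty hf hV
    · exact IsSym.of_genField hΩ hIc.nonempty hf h0 fieldZ2_eq fun p _ u _ => by
        rw [kohnLaplace_const, (hd u).deriv]; simp [confFactor]; ring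
    · exact IsSym.of_genField hΩ hIc.nonempty hf hβ (vertical_eq β) fun p hp u _ => by
        rw [(hd u).deriv]; simp [confFactor]; linear_combination hβ' p hp
  · have hm : ∀ p ∈ Ω, confFactor c p = 0 ∧ kohnLaplace β p + k * β p = 0 := by
      intro p hp
      have := affine_eq_zero hI hIc.nonempty (A := k * confFactor c p)
        (B := kohnLaplace β p + k * β p) fun u hu => by
          have := h p hp u hu
          rw [(hd u).deriv] at this
          linear_combination this
      exact ⟨(mul_eq_zero.1 this.1).resolve_left hk, this.2⟩
    obtain ⟨c0, c1, c2, c3⟩ := confFactor_eq_const hΩ hΩc.nonempty fun p hp => (hm p hp).1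
    have c3' : c 3 = 0 := by linarith
    refine ⟨basicComb c + a • fieldZ2 + fun z => (0, β z.1), ?_, fun z _ => ?_⟩
    · refine add_mem (add_mem (basicComb_mem (fun V hV => Or.inl (Or.inl hV)) c)
        (Submodule.smul_mem _ _ (Submodule.subset_span (Or.inl (Or.inr rfl)))))
        (Submodule.subset_span (Or.inr ⟨β, hβ, fun p hp => (hm p hp).2, rfl⟩))
    · rw [genField_eq_comb, c0, c1, c2, c3']
      simp

/-! ### Powers -/

theorem PowerDomain.rpow_ne_zero {p : ℝ} (h : PowerDomain p I) {u : ℝ} (hu : u ∈ I)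
    (hu0 : u ≠ 0) : u ^ p ≠ 0 := by
  rcases h with h | ⟨n, rfl⟩ | ⟨⟨n, rfl⟩, -⟩
  · exact (Real.rpow_pos_of_pos (h hu) p).ne'
  · rw [Real.rpow_natCast]; exact pow_ne_zero n hu0
  · rw [Real.rpow_intCast]; exact zpow_ne_zero n hu0

/-- This alternative is the hypothesis under which a real power is differentiable at `u`. -/
theorem PowerDomain.ne_zero_or {p : ℝ} (h : PowerDomain p I) (hp : p ≠ 0) {u : ℝ}
    (hu : u ∈ I) : u ≠ 0 ∨ 1 ≤ p := by
  rcases h with h | ⟨n, rfl⟩ | ⟨-, h⟩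
  · exact Or.inl (h hu).ne'
  · refine Or.inr ?_
    have : n ≠ 0 := fun hn => hp (by rw [hn]; simp)
    exact_mod_cast Nat.one_le_iff_ne_zero.2 this
  · exact Or.inl fun hu0 => h (hu0 ▸ hu)

theorem mul_rpow_sub_one {p : ℝ} (hp : p ≠ 0) (u : ℝ) : u * u ^ (p - 1) = u ^ p := by
  rcases eq_or_ne u 0 with rfl | hu
  · rw [zero_mul, Real.zero_rpow hp]
  · rw [Real.rpow_sub_one hu, mul_div_cancel₀ _ hu]

/-- Differentiation removes the constant, and division by `u ^ (p - 2)`, nonzero off the origin,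
leaves an affine function of `u`. -/
theorem rpow_coeff_eq_zero (hI : IsOpen I) (hIn : I.Nonempty) {p : ℝ} (hp0 : p ≠ 0)
    (hp1 : p ≠ 1) (h : PowerDomain p I) {P Q E : ℝ}
    (hPQ : ∀ u ∈ I, P * u ^ p + Q * u ^ (p - 1) + E = 0) : P = 0 ∧ Q = 0 := by
  have hJ : IsOpen (I \ {0}) := hI.sdiff isClosed_singleton
  have hJn : (I \ {0}).Nonempty := by
    obtain ⟨u, hu, hu0⟩ := exists_mem_ne hI hIn 0
    exact ⟨u, hu, hu0⟩
  have key : ∀ u ∈ I \ {0}, P * p * u + Q * (p - 1) = 0 := by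
    rintro u ⟨hu, hu0⟩
    have hu0 : u ≠ 0 := hu0
    have h1 := hasDerivAt_eq_zero_of_vanish hI hPQ hu
      ((((Real.hasDerivAt_rpow_const (p := p) (Or.inl hu0)).const_mul P).add
        ((Real.hasDerivAt_rpow_const (p := p - 1) (Or.inl hu0)).const_mul Q)).add_const E)
    have h2 : u ^ (p - 1 - 1) ≠ 0 := by
      rw [Real.rpow_sub_one hu0, Real.rpow_sub_one hu0]
      exact div_ne_zero (div_ne_zero (h.rpow_ne_zero hu hu0) hu0) hu0
    have h3 : u ^ (p - 1) = u * u ^ (p - 1 - 1) := by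
      rw [Real.rpow_sub_one hu0 (p - 1), mul_div_cancel₀ _ hu0]
    rw [h3] at h1
    refine (mul_eq_zero.1 ?_).resolve_right h2
    linear_combination h1
  obtain ⟨h1, h2⟩ := affine_eq_zero hJ hJn key
  exact ⟨(mul_eq_zero.1 h1).resolve_right hp0, (mul_eq_zero.1 h2).resolve_right (sub_ne_zero.2 hp1)⟩

theorem hasDerivAt_mul_rpow {p : ℝ} (hp0 : p ≠ 0) (h : PowerDomain p I) (k : ℝ) {u : ℝ}
    (hu : u ∈ I) : HasDerivAt (fun u => k * u ^ p) (k * (p * u ^ (p - 1))) u :=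
  (Real.hasDerivAt_rpow_const (h.ne_zero_or hp0 hu)).const_mul k

/-- These are the coefficients of `u ^ p` and `u ^ (p - 1)`. The exponent 3 is critical because the
conformal factor then disappears from the first condition. -/
theorem power_conditions (hI : IsOpen I) (hIn : I.Nonempty) {k p : ℝ} (hk : k ≠ 0)
    (hp0 : p ≠ 0) (hp1 : p ≠ 1) (h : PowerDomain p I) {c : Fin 8 → ℝ} {a : ℝ} {β : H1 → ℝ}
    (hode : ∀ q ∈ Ω, ∀ u ∈ I, kohnLaplace β q + ((a - confFactor c q / 2) * u + β q)
      * deriv (fun u => k * u ^ p) u + (3 / 2 * confFactor c q - a) * (k * u ^ p) = 0)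
    {q : H1} (hq : q ∈ Ω) : (p - 1) * a = (p - 3) / 2 * confFactor c q ∧ β q = 0 := by
  obtain ⟨h1, h2⟩ := rpow_coeff_eq_zero hI hIn hp0 hp1 h
    (P := k * (p * (a - confFactor c q / 2) + (3 / 2 * confFactor c q - a)))
    (Q := k * p * β q) (E := kohnLaplace β q) fun u hu => by
      have := hode q hq u hu
      rw [(hasDerivAt_mul_rpow hp0 h k hu).deriv] at this
      linear_combination this - k * p * (a - confFactor c q / 2) * mul_rpow_sub_one hp0 u
  refine ⟨?_, (mul_eq_zero.1 h2).resolve_left (mul_ne_zero hk hp0)⟩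
  linear_combination (mul_eq_zero.1 h1).resolve_left hk

theorem isSym_fieldZ (hΩ : IsOpen Ω) (hIn : I.Nonempty) {k p : ℝ} (hp0 : p ≠ 0)
    (hp1 : p ≠ 1) (h : PowerDomain p I) : IsSym Ω I (fun u => k * u ^ p) (fieldZ p) := by
  have hp1' : 1 - p ≠ 0 := sub_ne_zero.2 hp1.symm
  refine IsSym.of_genField hΩ hIn
    (fun u hu => (hasDerivAt_mul_rpow hp0 h k hu).differentiableAt)
    (contDiffOn_const (c := (0 : ℝ))) (fieldZ_eq p) fun q _ u hu => ?_
  rw [kohnLaplace_const, (hasDerivAt_mul_rpow hp0 h k hu).deriv, ← mul_rpow_sub_one hp0 u]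
  simp [confFactor]
  field_simp
  ring

theorem symSpannedBy_power (hΩ : IsOpen Ω) (hΩc : IsConnected Ω) (hI : IsOpen I)
    (hIc : IsConnected I) {k p : ℝ} (hk : k ≠ 0) (hp0 : p ≠ 0) (hp1 : p ≠ 1) (hp3 : p ≠ 3)
    (h : PowerDomain p I) : SymSpannedBy Ω I (fun u => k * u ^ p) (basic ∪ {fieldZ p}) := by
  have hf : ∀ u ∈ I, DifferentiableAt ℝ (fun u => k * u ^ p) u := fun u hu =>
    (hasDerivAt_mul_rpow hp0 h k hu).differentiableAt
  refine symSpannedBy_of hΩ hΩc hI hIc hf ?_ fun c a β hβ hode => ?_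
  · rintro V (hV | rfl)
    · exact isSym_basic hΩ hIc.nonempty hf hV
    · exact isSym_fieldZ hΩ hIc.nonempty hp0 hp1 h
  · have hc := fun q (hq : q ∈ Ω) => power_conditions hI hIc.nonempty hk hp0 hp1 h hode hq
    have hp3' : p - 3 ≠ 0 := sub_ne_zero.2 hp3
    obtain ⟨c0, c1, c2, c3⟩ := confFactor_eq_const hΩ hΩc.nonempty (c := c)
      (s := 2 * (p - 1) * a / (p - 3)) fun q hq => by
        rw [eq_div_iff hp3']
        linear_combination -2 * (hc q hq).1
    have hp1' : 1 - p ≠ 0 := sub_ne_zero.2 hp1.symm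
    -- The constant value of `m` gives `(p - 3) c 3 = (p - 1) a`; the excess of `a` over `c 3` is
    -- the vertical weight of the dilation.
    have ha : a - c 3 = c 3 * (2 / (1 - p)) := by
      rw [eq_div_iff hp3'] at c3
      field_simp
      linear_combination c3 / 2
    refine ⟨basicComb c + c 3 • fieldZ p, ?_, fun z hz => ?_⟩
    · exact add_mem (basicComb_mem (fun V hV => Or.inl hV) c)
        (Submodule.smul_mem _ _ (Submodule.subset_span (Or.inr rfl)))
    · rw [genField_eq_comb, c0, c1, c2, ha]
      refine Prod.ext (by simp [fieldZ1, fieldZ, fieldZ2]) ?_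
      simp [fieldZ1, fieldZ, fieldZ2, (hc z.1 hz.1).2]
      ring

/-- The conditions reduce to `a = 0` and `β = 0`, with all eight parameters free. The dilation fits
in since `1 + 2 / (1 - 3) = 0`. -/
theorem symSpannedBy_cube (hΩ : IsOpen Ω) (hΩc : IsConnected Ω) (hI : IsOpen I)
    (hIc : IsConnected I) {k : ℝ} (hk : k ≠ 0) :
    SymSpannedBy Ω I (fun u => k * u ^ (3 : ℝ))
      (basic ∪ {fieldZ 3, fieldV1, fieldV2, fieldV3}) := by
  have h : PowerDomain 3 I := Or.inr (Or.inl ⟨3, by norm_num⟩)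
  have h30 : (3 : ℝ) ≠ 0 := by norm_num
  have h31 : (3 : ℝ) ≠ 1 := by norm_num
  have hf : ∀ u ∈ I, DifferentiableAt ℝ (fun u => k * u ^ (3 : ℝ)) u := fun u hu =>
    (hasDerivAt_mul_rpow h30 h k hu).differentiableAt
  have h0 : ContDiffOn ℝ ∞ (fun _ : H1 => (0 : ℝ)) Ω := contDiffOn_const
  have hV : ∀ c : Fin 8 → ℝ, IsSym Ω I (fun u => k * u ^ (3 : ℝ)) (genField c 0 fun _ => 0) :=
    fun c => IsSym.of_genField hΩ hIc.nonempty hf h0 rfl fun q _ u hu => by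
      rw [kohnLaplace_const, (hasDerivAt_mul_rpow h30 h k hu).deriv, ← mul_rpow_sub_one h30 u]
      ring
  refine symSpannedBy_of hΩ hΩc hI hIc hf ?_ fun c a β hβ hode => ?_
  · rintro V (hb | rfl | rfl | rfl | rfl)
    · exact isSym_basic hΩ hIc.nonempty hf hb
    · exact isSym_fieldZ hΩ hIc.nonempty h30 h31 h
    · rw [fieldV1_eq]; exact hV _
    · rw [fieldV2_eq]; exact hV _
    · rw [fieldV3_eq]; exact hV _
  · have hc := fun q (hq : q ∈ Ω) => power_conditions hI hIc.nonempty hk h30 h31 h hode hq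
    obtain ⟨q, hq⟩ := hΩc.nonempty
    have ha : a = 0 := by linarith [(hc q hq).1]
    have hs : ∀ V ∈ basic ∪ {fieldZ 3, fieldV1, fieldV2, fieldV3},
        V ∈ Submodule.span ℝ (basic ∪ {fieldZ 3, fieldV1, fieldV2, fieldV3}) :=
      fun V hV => Submodule.subset_span hV
    refine ⟨basicComb c + c 3 • fieldZ 3 + c 0 • fieldV1 + c 1 • fieldV2 + c 2 • fieldV3, ?_,
      fun z hz => ?_⟩
    · exact add_mem (add_mem (add_mem (add_mem (basicComb_mem (fun V hV => Or.inl hV) c)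
        (Submodule.smul_mem _ _ (hs _ (by simp)))) (Submodule.smul_mem _ _ (hs _ (by simp))))
        (Submodule.smul_mem _ _ (hs _ (by simp)))) (Submodule.smul_mem _ _ (hs _ (by simp)))
    · rw [genField_eq_comb, ha]
      refine Prod.ext ?_ ?_
      · simp only [Prod.fst_add, Pi.add_apply, Pi.smul_apply, Prod.smul_fst,
          show (fieldZ 3 z).1 = (fieldZ1 z).1 from rfl, show (fieldZ2 z).1 = 0 from rfl]
        module
      · simp [fieldZ1, fieldZ, fieldZ2, (hc z.1 hz.1).2]
        ring

/-! ### Exponentials -/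

theorem symSpannedBy_exp (hΩ : IsOpen Ω) (hΩc : IsConnected Ω) (hI : IsOpen I)
    (hIc : IsConnected I) {k : ℝ} (hk : k ≠ 0) :
    SymSpannedBy Ω I (fun u => k * Real.exp u) (basic ∪ {fieldZ3}) := by
  have hd : ∀ u : ℝ, HasDerivAt (fun u => k * Real.exp u) (k * Real.exp u) u := fun u =>
    (Real.hasDerivAt_exp u).const_mul k
  have hf : ∀ u ∈ I, DifferentiableAt ℝ (fun u => k * Real.exp u) u := fun u _ =>
    (hd u).differentiableAt
  refine symSpannedBy_of hΩ hΩc hI hIc hf ?_ fun c a β hβ hode => ?_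
  · rintro V (hb | rfl)
    · exact isSym_basic hΩ hIc.nonempty hf hb
    · refine IsSym.of_genField hΩ hIc.nonempty hf
        (contDiffOn_const (c := (-2 : ℝ))) fieldZ3_eq fun q _ u hu => ?_
      rw [kohnLaplace_const, (hd u).deriv]
      simp [confFactor]
      ring
  · have hc : ∀ q ∈ Ω, confFactor c q = 2 * a ∧ β q = -(2 * a) := by
      intro q hq
      -- Differentiation in `u` kills `Δβ`, and the common factor `k e^u` can be divided out.
      have key : ∀ u ∈ I, (a - confFactor c q / 2) * u
          + (β q + confFactor c q) = 0 := by
        intro u hu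
        have h1 := hasDerivAt_eq_zero_of_vanish hI
          (g := fun u => ((a - confFactor c q / 2) * u + (β q + 3 / 2 * confFactor c q - a))
            * (k * Real.exp u) + kohnLaplace β q) (fun s hs => by
            have := hode q hq s hs
            rw [(hd s).deriv] at this
            linear_combination this) hu
          (((((hasDerivAt_id u).const_mul (a - confFactor c q / 2)).add_const _).mul
            (hd u)).add_const _)
        have h2 : k * Real.exp u ≠ 0 := mul_ne_zero hk (Real.exp_pos u).ne'
        refine (mul_eq_zero.1 ?_).resolve_right h2
        simp only [id] at h1
        linear_combination h1
      obtain ⟨h1, h2⟩ := affine_eq_zero hI hIc.nonempty key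
      constructor <;> linarith
    obtain ⟨c0, c1, c2, c3⟩ := confFactor_eq_const hΩ hΩc.nonempty fun q hq => (hc q hq).1
    have ha : a = c 3 := by linarith
    refine ⟨basicComb c + c 3 • fieldZ3, ?_, fun z hz => ?_⟩
    · exact add_mem (basicComb_mem (fun V hV => Or.inl hV) c)
        (Submodule.smul_mem _ _ (Submodule.subset_span (Or.inr rfl)))
    · rw [genField_eq_comb, c0, c1, c2, ha]
      refine Prod.ext (by simp [fieldZ1, fieldZ3]) ?_
      simp [fieldZ1, fieldZ3, (hc z.1 hz.1).2, ha]
      ring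

/-! ### Arbitrary right-hand sides -/

theorem differentiableAt_of_contDiffOn (hI : IsOpen I) {f : ℝ → ℝ} (hf : ContDiffOn ℝ ∞ f I) :
    ∀ u ∈ I, DifferentiableAt ℝ f u := fun _ hu =>
  (hf.contDiffAt (hI.mem_nhds hu)).differentiableAt (by simp)

theorem isSym_of_spannedOn_basic (hΩ : IsOpen Ω) (hΩc : IsConnected Ω) (hI : IsOpen I)
    (hIc : IsConnected I) {f : ℝ → ℝ} (hf : ∀ u ∈ I, DifferentiableAt ℝ f u) {V : VField}
    (hV : SpannedOn (Ω ×ˢ I) basic V) : IsSym Ω I f V := by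
  obtain ⟨W, hW, he⟩ := hV
  exact (IsSym.of_mem_span hΩ hΩc hI hIc hf
    (fun V hV => isSym_basic hΩ hIc.nonempty hf hV) hW).congr hΩ hI hf he.symm

theorem spannedOn_basic_genField (hΩ : IsOpen Ω) (hΩn : Ω.Nonempty) {c : Fin 8 → ℝ} {β : H1 → ℝ}
    (hm : ∀ p ∈ Ω, confFactor c p = 0) (hβ : ∀ p ∈ Ω, β p = 0) :
    SpannedOn (Ω ×ˢ I) basic (genField c 0 β) := by
  obtain ⟨c0, c1, c2, c3⟩ := confFactor_eq_const hΩ hΩn hm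
  have c3' : c 3 = 0 := by linarith
  refine ⟨basicComb c, basicComb_mem le_rfl c, fun z hz => ?_⟩
  rw [genField_eq_comb, c0, c1, c2, c3']
  refine Prod.ext (by simp) ?_
  simp [hβ z.1 hz.1]

theorem vertical_eq_zero_of_spannedOn_basic {V : VField} (hV : SpannedOn (Ω ×ˢ I) basic V) :
    ∀ z ∈ Ω ×ˢ I, (V z).2 = 0 := by
  obtain ⟨W, hW, he⟩ := hV
  have h : ∀ z, (W z).2 = 0 := by
    clear he
    induction hW using Submodule.span_induction with
    | mem V h =>
      simp only [basic, Set.mem_insert_iff, Set.mem_singleton_iff] at h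
      rcases h with rfl | rfl | rfl | rfl <;> intro z <;> rfl
    | zero => intro z; rfl
    | add V W _ _ hV hW => intro z; simp [hV z, hW z]
    | smul r V _ hV => intro z; simp [hV z]
  intro z hz
  rw [he hz, h z]

/-- The three test functions `0`, `1` and `u` already force `m`, `a` and `β` to vanish. -/
theorem isSym_forall_iff (hΩ : IsOpen Ω) (hΩc : IsConnected Ω) (hI : IsOpen I)
    (hIc : IsConnected I) (V : VField) :
    (∀ f : ℝ → ℝ, ContDiffOn ℝ ∞ f I → IsSym Ω I f V) ↔ SpannedOn (Ω ×ˢ I) basic V := by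
  constructor
  · intro h
    have hd : ∀ u : ℝ, HasDerivAt (fun u : ℝ => u) 1 u := fun u => hasDerivAt_id u
    obtain ⟨c, a, β, hβ, he⟩ := (h (fun _ => 0) contDiffOn_const).exists_eq_genField hΩ hΩc hI hIc
      (fun u _ => by fun_prop)
    have key : ∀ f : ℝ → ℝ, ContDiffOn ℝ ∞ f I → ∀ p ∈ Ω, ∀ u ∈ I,
        kohnLaplace β p + ((a - confFactor c p / 2) * u + β p) * deriv f u
          + (3 / 2 * confFactor c p - a) * f u = 0 := fun f hf =>
      have hf' := differentiableAt_of_contDiffOn hI hf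
      (isSym_genField_iff hΩ hIc.nonempty hf' c a hβ).1 ((h f hf).congr hΩ hI hf' he)
    have hz : ∀ p ∈ Ω, a - confFactor c p / 2 = 0 ∧ β p = 0 ∧ 3 / 2 * confFactor c p - a = 0 := by
      intro p hp
      obtain ⟨u, hu⟩ := hIc.nonempty
      have h0 := key (fun _ => 0) contDiffOn_const p hp u hu
      have h1 := key (fun _ => 1) contDiffOn_const p hp u hu
      simp only [deriv_const] at h0 h1
      have h2 : 3 / 2 * confFactor c p - a = 0 := by linear_combination h1 - h0
      have h3 := affine_eq_zero hI hIc.nonempty (A := a - confFactor c p / 2) (B := β p)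
        fun s hs => by
          have h4 := key (fun u => u) contDiffOn_id p hp s hs
          rw [(hd s).deriv] at h4
          linear_combination h4 - h0 - s * h2
      exact ⟨h3.1, h3.2, h2⟩
    have ha : a = 0 := by
      obtain ⟨p, hp⟩ := hΩc.nonempty
      linarith [(hz p hp).1, (hz p hp).2.2]
    subst ha
    obtain ⟨W, hW, hW'⟩ := spannedOn_basic_genField (I := I) hΩ hΩc.nonempty (c := c) (β := β)
      (fun p hp => by linarith [(hz p hp).1]) fun p hp => (hz p hp).2.1
    exact ⟨W, hW, he.trans hW'⟩
  · intro h f hf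
    exact isSym_of_spannedOn_basic hΩ hΩc hI hIc (differentiableAt_of_contDiffOn hI hf) h

end

/-! ### Flows -/

theorem isFlow_of {Φ : ℝ → H1 → H1} {V : VField} (h0 : ∀ p, Φ 0 p = p)
    (hV : ∀ z, (V z).2 = 0)
    (h : ∀ p u s k, HasDerivAt (fun r => Φ r p k) ((V (Φ s p, u)).1 k) s) : IsFlow Φ V := by
  intro p u
  refine ⟨h0 p, fun s => ?_⟩
  have h1 : HasDerivAt (fun r => Φ r p) (V (Φ s p, u)).1 s := hasDerivAt_pi.2 (h p u s)
  have h2 := h1.prodMk (hasDerivAt_const s u)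
  rwa [← hV (Φ s p, u)] at h2

theorem isFlow_fieldT : IsFlow (fun s p => ![p 0, p 1, p 2 + s]) fieldT := by
  refine isFlow_of (fun p => ?_) (fun _ => rfl) fun p u s k => ?_
  · funext k; fin_cases k <;> simp
  · fin_cases k
    · exact hasDerivAt_const s (p 0)
    · exact hasDerivAt_const s (p 1)
    · exact (hasDerivAt_id s).const_add (p 2)

theorem isFlow_fieldR : IsFlow (fun s p => ![p 0 * Real.cos s + p 1 * Real.sin s,
    -p 0 * Real.sin s + p 1 * Real.cos s, p 2]) fieldR := by
  refine isFlow_of (fun p => ?_) (fun _ => rfl) fun p u s k => ?_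
  · funext k; fin_cases k <;> simp
  · have hs := Real.hasDerivAt_sin s
    have hc := Real.hasDerivAt_cos s
    fin_cases k
    · refine ((hc.const_mul (p 0)).add (hs.const_mul (p 1))).congr_deriv ?_
      simp [fieldR]
    · refine ((hs.const_mul (-p 0)).add (hc.const_mul (p 1))).congr_deriv ?_
      simp [fieldR]; ring
    · exact hasDerivAt_const s (p 2)

theorem isFlow_fieldX : IsFlow (fun s p => Heis.mul ![s, 0, 0] p) fieldX := by
  refine isFlow_of (fun p => ?_) (fun _ => rfl) fun p u s k => ?_
  · funext k; fin_cases k <;> simp [Heis.mul]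
  · fin_cases k
    · exact (hasDerivAt_id s).add_const (p 0)
    · exact hasDerivAt_const s (0 + p 1)
    · have h := ((((hasDerivAt_id s).mul_const (p 1)).const_sub (0 * p 0)).const_mul 2).const_add
        (0 + p 2)
      refine h.congr_deriv ?_
      simp [fieldX, Heis.mul]

theorem isFlow_fieldY : IsFlow (fun s p => Heis.mul ![0, s, 0] p) fieldY := by
  refine isFlow_of (fun p => ?_) (fun _ => rfl) fun p u s k => ?_
  · funext k; fin_cases k <;> simp [Heis.mul]
  · fin_cases k
    · exact hasDerivAt_const s (0 + p 0)
    · exact (hasDerivAt_id s).add_const (p 1)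
    · have h := ((((hasDerivAt_id s).mul_const (p 0)).sub_const (0 * p 1)).const_mul 2).const_add
        (0 + p 2)
      refine h.congr_deriv ?_
      simp [fieldY, Heis.mul]

/-! ### Classification of the right-hand sides -/

section

variable {I : Set ℝ} {f : ℝ → ℝ}

theorem contDiffOn_deriv (hI : IsOpen I) (hf : ContDiffOn ℝ ∞ f I) :
    ContDiffOn ℝ ∞ (deriv f) I :=
  ((contDiffOn_infty_iff_deriv_of_isOpen hI).1 hf).2

theorem hasDerivAt_of_contDiffOn (hI : IsOpen I) (hf : ContDiffOn ℝ ∞ f I) {u : ℝ} (hu : u ∈ I) :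
    HasDerivAt f (deriv f u) u :=
  (differentiableAt_of_contDiffOn hI hf u hu).hasDerivAt

theorem exists_eq_affine_of_deriv (hI : IsOpen I) (hIc : IsConnected I)
    (hf : ContDiffOn ℝ ∞ f I) {r : ℝ} (h : ∀ u ∈ I, deriv f u = r) :
    ∃ s, ∀ u ∈ I, f u = r * u + s := by
  obtain ⟨v, hv⟩ := hIc.nonempty
  refine ⟨f v - r * v, fun u hu => ?_⟩
  have := eq_of_hasDerivAt_zero hI hIc (g := fun s => f s - r * s) (fun s hs => by
    have h1 := (hasDerivAt_of_contDiffOn hI hf hs).fun_sub ((hasDerivAt_id s).const_mul r)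
    rwa [h s hs, mul_one, sub_self] at h1) hu hv
  linear_combination this

theorem isEquivListed_of_affine {r s : ℝ} (h : ∀ u ∈ I, f u = r * u + s) :
    IsEquivListed I f := by
  rcases eq_or_ne r 0 with rfl | hr
  · refine ⟨1, 0, one_ne_zero, Or.inl ⟨s, ?_⟩⟩
    rintro _ ⟨u, hu, rfl⟩
    simp [h u hu]
  -- The translation by `s / r` absorbs the constant term.
  · refine ⟨1, s / r, one_ne_zero, Or.inr (Or.inl ⟨r, hr, ?_⟩)⟩
    rintro _ ⟨u, hu, rfl⟩
    simp only [one_mul, div_one, add_sub_cancel_right, h u hu]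
    field_simp

/-- If `(u - w) f'` vanishes then so does `f'`. -/
theorem deriv_eq_zero_of_mul (hI : IsOpen I) (hf : ContDiffOn ℝ ∞ f I) {w : ℝ}
    (h : ∀ u ∈ I, (u - w) * deriv f u = 0) : ∀ u ∈ I, deriv f u = 0 := by
  intro u hu
  rcases eq_or_ne u w with rfl | huw
  -- At the singular point itself, the derivative of the product is `f' w`.
  · have h1 := hasDerivAt_eq_zero_of_vanish hI h hu (((hasDerivAt_id u).sub_const u).mul
      (hasDerivAt_of_contDiffOn hI (contDiffOn_deriv hI hf) hu))
    simpa using h1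
  · exact (mul_eq_zero.1 (h u hu)).resolve_left (sub_ne_zero.2 huw)

/-- Only constants satisfy both `f = l f' + n` and `(u - w) f' = k`. -/
theorem deriv_eq_zero_of_two (hI : IsOpen I) (hf : ContDiffOn ℝ ∞ f I)
    {l n w k : ℝ} (h1 : ∀ u ∈ I, f u = l * deriv f u + n)
    (h2 : ∀ u ∈ I, (u - w) * deriv f u = k) : ∀ u ∈ I, deriv f u = 0 := by
  have hg := contDiffOn_deriv hI hf
  -- Both relations are differentiated and `f''` is eliminated.
  have h3 : ∀ u ∈ I, (u + (l - w)) * deriv f u = 0 := by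
    intro u hu
    have hfu := hasDerivAt_of_contDiffOn hI hf hu
    have hgu := hasDerivAt_of_contDiffOn hI hg hu
    have a1 := hasDerivAt_eq_zero_of_vanish hI (g := fun u => f u - (l * deriv f u + n))
      (fun s hs => by rw [h1 s hs, sub_self]) hu (hfu.fun_sub ((hgu.const_mul l).add_const n))
    have a2 := hasDerivAt_eq_zero_of_vanish hI (g := fun u => (u - w) * deriv f u - k)
      (fun s hs => by rw [h2 s hs, sub_self]) hu
      ((((hasDerivAt_id u).sub_const w).fun_mul hgu).sub_const k)
    simp only [id] at a2
    linear_combination l * a2 + (u - w) * a1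
  refine deriv_eq_zero_of_mul hI hf (w := w - l) fun u hu => ?_
  rw [← h3 u hu]
  ring

/-- Smooth solutions of Euler's equation `(u - w) f' = s f` near the singular point `w` are
monomials. -/
theorem eq_monomial_of_euler (hI : IsOpen I) (hIc : IsConnected I) {w : ℝ} (hw : w ∈ I) (n : ℕ) :
    ∀ (s : ℝ) (f : ℝ → ℝ), s < n → ContDiffOn ℝ ∞ f I →
      (∀ u ∈ I, (u - w) * deriv f u = s * f u) →
      ∃ (j : ℕ) (K : ℝ), (∀ u ∈ I, f u = K * (u - w) ^ j) ∧ (s = j ∨ K = 0) := by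
  induction n with
  | zero =>
    -- For `s < 0`, `f ^ 2` is nonincreasing along the segment from `w` to `u`, by the equation, and
    -- it starts at 0 since `s * f w = 0`.
    intro s f hs hf h
    have hs : s < 0 := by simpa using hs
    refine ⟨0, 0, fun u hu => ?_, Or.inr rfl⟩
    have hconv : Convex ℝ I := Real.convex_iff_isPreconnected.2 hIc.isPreconnected
    have hmem : ∀ r ∈ Set.Icc (0 : ℝ) 1, w + r * (u - w) ∈ I := fun r hr => by
      have := hconv hw hu (sub_nonneg.2 hr.2) hr.1 (by ring)
      simp only [smul_eq_mul] at this
      convert this using 1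
      ring
    have hd : ∀ r ∈ Set.Icc (0 : ℝ) 1, HasDerivAt (fun r => f (w + r * (u - w)) ^ 2)
        (2 * f (w + r * (u - w)) * (deriv f (w + r * (u - w)) * (u - w))) r := by
      intro r hr
      have h1 : HasDerivAt (fun r => w + r * (u - w)) (u - w) r := by
        simpa using ((hasDerivAt_id r).mul_const (u - w)).const_add w
      have h2 : HasDerivAt (fun r => f (w + r * (u - w)))
          (deriv f (w + r * (u - w)) * (u - w)) r :=
        HasDerivAt.comp r (hasDerivAt_of_contDiffOn hI hf (hmem r hr)) h1
      refine (h2.fun_pow 2).congr_deriv ?_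
      simp
    have hanti : AntitoneOn (fun r => f (w + r * (u - w)) ^ 2) (Set.Icc (0 : ℝ) 1) := by
      refine antitoneOn_of_deriv_nonpos (convex_Icc 0 1)
        (fun r hr => (hd r hr).continuousAt.continuousWithinAt)
        (fun r hr => (hd r (interior_subset hr)).differentiableAt.differentiableWithinAt)
        fun r hr => ?_
      have hr' := interior_subset hr
      rw [interior_Icc] at hr
      rw [(hd r hr').deriv]
      have he := h _ (hmem r hr')
      have h3 : r * (2 * f (w + r * (u - w)) * (deriv f (w + r * (u - w)) * (u - w)))
          = 2 * s * f (w + r * (u - w)) ^ 2 := by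
        linear_combination 2 * f (w + r * (u - w)) * he
      have h4 : r * (2 * f (w + r * (u - w)) * (deriv f (w + r * (u - w)) * (u - w))) ≤ 0 := by
        rw [h3]
        exact mul_nonpos_of_nonpos_of_nonneg (by linarith) (sq_nonneg _)
      exact nonpos_of_mul_nonpos_right h4 hr.1
    have h5 := hanti (Set.left_mem_Icc.2 zero_le_one) (Set.right_mem_Icc.2 zero_le_one) zero_le_one
    have h6 : f w = 0 := by
      have := h w hw
      rw [sub_self, zero_mul] at this
      exact (mul_eq_zero.1 this.symm).resolve_left hs.ne
    simp only [zero_mul, add_zero, one_mul, add_sub_cancel, h6] at h5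
    have h7 : f u ^ 2 = 0 := le_antisymm (by simpa using h5) (sq_nonneg _)
    rw [zero_mul]
    exact pow_eq_zero_iff (two_ne_zero) |>.1 h7
  | succ n ih =>
    intro s f hs hf h
    have hg := contDiffOn_deriv hI hf
    -- The derivative solves Euler's equation with exponent `s - 1`, so the bound on `s` drops by
    -- one.
    obtain ⟨j, K, hK, hjK⟩ := ih (s - 1) (deriv f) (by push_cast at hs; linarith) hg
      fun u hu => by
        have a1 := hasDerivAt_eq_zero_of_vanish hI
          (g := fun u => (u - w) * deriv f u - s * f u)
          (fun r hr => by rw [h r hr, sub_self]) hu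
          ((((hasDerivAt_id u).sub_const w).fun_mul
            (hasDerivAt_of_contDiffOn hI hg hu)).fun_sub
            ((hasDerivAt_of_contDiffOn hI hf hu).const_mul s))
        simp only [id] at a1
        linear_combination a1
    have hj : (j : ℝ) + 1 ≠ 0 := by positivity
    have hf' : ∀ u ∈ I, f u = K / (j + 1) * (u - w) ^ (j + 1) + f w := by
      intro u hu
      have := eq_of_hasDerivAt_zero hI hIc
        (g := fun u => f u - K / (j + 1) * (u - w) ^ (j + 1)) (fun r hr => by
          have h1 := (hasDerivAt_of_contDiffOn hI hf hr).fun_sub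
            ((((hasDerivAt_id r).sub_const w).fun_pow (j + 1)).const_mul (K / (j + 1)))
          refine h1.congr_deriv ?_
          rw [hK r hr]
          push_cast
          simp only [id]
          field_simp
          ring) hu hw
      simp only [sub_self, ne_eq, Nat.add_eq_zero_iff, one_ne_zero, and_false, not_false_eq_true,
        zero_pow, mul_zero, sub_zero] at this
      linear_combination this
    -- Evaluation at `w` fixes the integration constant: either it is 0, or `s = 0`; then the
    -- exponent `-1` of `f'` is not natural, so `K = 0` and `f` is constant.
    have hc : s * f w = 0 := by
      have := h w hw
      rw [sub_self, zero_mul] at this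
      exact this.symm
    rcases mul_eq_zero.1 hc with rfl | h0
    · have hK0 : K = 0 := hjK.resolve_left fun h => hj (by linarith)
      refine ⟨0, f w, fun u hu => ?_, Or.inl (by simp)⟩
      rw [hf' u hu, hK0]
      simp
    · refine ⟨j + 1, K / (j + 1), fun u hu => ?_, ?_⟩
      · rw [hf' u hu, h0, add_zero]
      · rcases hjK with h | h
        · exact Or.inl (by push_cast; linarith)
        · exact Or.inr (by rw [h, zero_div])

/-- Away from the singular point the solutions of Euler's equation are powers. -/
theorem eq_rpow_of_euler (hI : IsOpen I) (hIc : IsConnected I) (hf : ContDiffOn ℝ ∞ f I)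
    {s w σ : ℝ} (hσ : ∀ u ∈ I, 0 < σ * u + -σ * w)
    (h : ∀ u ∈ I, (u - w) * deriv f u = s * f u) :
    ∃ K : ℝ, ∀ u ∈ I, f u = K * (σ * u + -σ * w) ^ s := by
  obtain ⟨v, hv⟩ := hIc.nonempty
  refine ⟨f v * (σ * v + -σ * w) ^ (-s), fun u hu => ?_⟩
  -- The quotient of `f` by the expected power is constant.
  have key := eq_of_hasDerivAt_zero hI hIc
    (g := fun u => f u * (σ * u + -σ * w) ^ (-s)) (fun r hr => by
      have hp := hσ r hr
      have h1 : HasDerivAt (fun u => σ * u + -σ * w) σ r := by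
        simpa using ((hasDerivAt_id r).const_mul σ).add_const (-σ * w)
      refine ((hasDerivAt_of_contDiffOn hI hf hr).fun_mul
        (h1.rpow_const (p := -s) (Or.inl hp.ne'))).congr_deriv ?_
      have h2 : (σ * r + -σ * w) ^ (-s) = (σ * r + -σ * w) * (σ * r + -σ * w) ^ (-s - 1) := by
        rw [Real.rpow_sub_one hp.ne', mul_div_cancel₀ _ hp.ne']
      rw [h2]
      linear_combination σ * (σ * r + -σ * w) ^ (-s - 1) * h r hr) hu hv
  rw [← key, mul_assoc, ← Real.rpow_add (hσ u hu), neg_add_cancel, Real.rpow_zero, mul_one]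

/-- The exponents 0 and 1 would make `f` affine. If `w ∈ I`, smoothness at `w` gives a natural
exponent; otherwise the interval lies on one side of `w`, and a sign `σ = ±1` makes the base
positive. -/
theorem isEquivListed_of_euler (hI : IsOpen I) (hIc : IsConnected I) (hf : ContDiffOn ℝ ∞ f I)
    (hna : ∀ r s, ¬ ∀ u ∈ I, f u = r * u + s) {s w : ℝ}
    (h : ∀ u ∈ I, (u - w) * deriv f u = s * f u) : IsEquivListed I f := by
  have hs0 : s ≠ 0 := by
    rintro rfl
    obtain ⟨r, hr⟩ := exists_eq_affine_of_deriv hI hIc hf (r := 0)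
      (deriv_eq_zero_of_mul hI hf (w := w) fun u hu => by rw [h u hu, zero_mul])
    exact hna _ _ hr
  have hs1 : s ≠ 1 := by
    rintro rfl
    have hg := contDiffOn_deriv hI hf
    obtain ⟨r, hr⟩ := exists_eq_affine_of_deriv hI hIc hg (r := 0)
      (deriv_eq_zero_of_mul hI hg (w := w) fun u hu => by
        have a1 := hasDerivAt_eq_zero_of_vanish hI
          (g := fun u => (u - w) * deriv f u - 1 * f u)
          (fun r hr => by rw [h r hr, sub_self]) hu
          ((((hasDerivAt_id u).sub_const w).fun_mul
            (hasDerivAt_of_contDiffOn hI hg hu)).fun_sub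
            ((hasDerivAt_of_contDiffOn hI hf hu).const_mul 1))
        simp only [id] at a1
        linear_combination a1)
    obtain ⟨t, ht⟩ := exists_eq_affine_of_deriv hI hIc hf (r := r) fun u hu => by
      rw [hr u hu]; ring
    exact hna _ _ ht
  by_cases hw : w ∈ I
  · obtain ⟨n, hn⟩ := exists_nat_gt s
    obtain ⟨j, K, hK, hj⟩ := eq_monomial_of_euler hI hIc hw n s f hn hf h
    have hK0 : K ≠ 0 := by
      rintro rfl
      exact hna 0 0 fun u hu => by rw [hK u hu]; ring
    have hsj := hj.resolve_right hK0
    refine ⟨1, -w, one_ne_zero, Or.inr (Or.inr (Or.inl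
      ⟨K, s, hK0, hs0, hs1, Or.inr (Or.inl ⟨j, hsj⟩), ?_⟩))⟩
    rintro _ ⟨u, hu, rfl⟩
    have e : (1 * u + -w - -w) / 1 = u := by ring
    simp only [e, hK u hu, hsj, Real.rpow_natCast]
    rw [one_mul, one_mul, ← sub_eq_add_neg]
  · have hpow : ∀ σ : ℝ, σ ≠ 0 → (∀ u ∈ I, 0 < σ * u + -σ * w) → IsEquivListed I f := by
      intro σ hσ0 hσ
      obtain ⟨K, hK⟩ := eq_rpow_of_euler hI hIc hf hσ h
      have hK0 : K ≠ 0 := by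
        rintro rfl
        exact hna 0 0 fun u hu => by rw [hK u hu]; ring
      refine ⟨σ, -σ * w, hσ0, Or.inr (Or.inr (Or.inl
        ⟨σ * K, s, mul_ne_zero hσ0 hK0, hs0, hs1, Or.inl ?_, ?_⟩))⟩
      · rintro _ ⟨u, hu, rfl⟩
        exact hσ u hu
      · rintro _ ⟨u, hu, rfl⟩
        simp only [add_sub_cancel_right, mul_div_cancel_left₀ _ hσ0, hK u hu, mul_assoc]
    have hoc := hIc.isPreconnected.ordConnected
    by_cases hlt : ∃ u ∈ I, u < w
    · obtain ⟨v, hv, hvw⟩ := hlt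
      refine hpow (-1) (by norm_num) fun u hu => ?_
      have : u < w := by
        by_contra! hge
        exact hw (hoc.out hv hu ⟨hvw.le, hge⟩)
      linarith
    · push Not at hlt
      refine hpow 1 one_ne_zero fun u hu => ?_
      have : w < u := lt_of_le_of_ne (hlt u hu) fun he => hw (he ▸ hu)
      linarith

/-- The solutions are `K e^(u/l)`, with `l ≠ 0` as `f` is not affine; the change of unknown is `v =
u / l`. -/
theorem isEquivListed_of_exp (hI : IsOpen I) (hIc : IsConnected I) (hf : ContDiffOn ℝ ∞ f I)
    (hna : ∀ r s, ¬ ∀ u ∈ I, f u = r * u + s) {l : ℝ}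
    (h : ∀ u ∈ I, f u = l * deriv f u) : IsEquivListed I f := by
  have hl : l ≠ 0 := by
    rintro rfl
    exact hna 0 0 fun u hu => by rw [h u hu]; ring
  obtain ⟨v, hv⟩ := hIc.nonempty
  have key : ∀ u ∈ I, f u = f v * Real.exp (-(1 / l * v)) * Real.exp (1 / l * u) := by
    intro u hu
    have := eq_of_hasDerivAt_zero hI hIc (g := fun u => f u * Real.exp (-(1 / l * u)))
      (fun r hr => by
        have h1 : HasDerivAt (fun u => -(1 / l * u)) (-(1 / l)) r := by
          simpa using ((hasDerivAt_id r).const_mul (1 / l)).fun_neg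
        refine ((hasDerivAt_of_contDiffOn hI hf hr).fun_mul h1.exp).congr_deriv ?_
        rw [h r hr]
        field_simp
        ring) hu hv
    rw [← this, mul_assoc, ← Real.exp_add, neg_add_cancel, Real.exp_zero, mul_one]
  set K := f v * Real.exp (-(1 / l * v)) with hKdef
  have hK0 : K ≠ 0 := fun hK => hna 0 0 fun u hu => by rw [key u hu, hK]; ring
  refine ⟨1 / l, 0, one_div_ne_zero hl, Or.inr (Or.inr (Or.inr
    ⟨1 / l * K, mul_ne_zero (one_div_ne_zero hl) hK0, ?_⟩))⟩
  rintro _ ⟨u, hu, rfl⟩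
  simp only [add_zero, sub_zero, mul_div_cancel_left₀ _ (one_div_ne_zero hl)]
  rw [key u hu]
  ring

/-- The classification of the right-hand sides for which the determining equation has a nontrivial
solution. -/
theorem isEquivListed_of_determining {ι : Type*} (hI : IsOpen I) (hIc : IsConnected I)
    (hf : ContDiffOn ℝ ∞ f I) {α β E : ι → ℝ} {a : ℝ}
    (hode : ∀ p, ∀ u ∈ I, E p + (α p * u + β p) * deriv f u + (2 * a - 3 * α p) * f u = 0)
    (hE : ∀ r s, (∀ p, β p = r * α p + s) → ∀ p, E p = 0)
    (hnt : ∃ p, α p ≠ 0 ∨ β p ≠ 0 ∨ a ≠ 0) : IsEquivListed I f := by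
  by_cases hna : ∃ r s, ∀ u ∈ I, f u = r * u + s
  · obtain ⟨r, s, h⟩ := hna
    exact isEquivListed_of_affine h
  push Not at hna
  have hna' : ∀ r s, ¬ ∀ u ∈ I, f u = r * u + s := fun r s h => by
    obtain ⟨u, hu, h'⟩ := hna r s
    exact h' (h u hu)
  have hd0 : ¬ ∀ u ∈ I, deriv f u = 0 := fun h => by
    obtain ⟨s, hs⟩ := exists_eq_affine_of_deriv hI hIc hf h
    exact hna' _ _ hs
  -- Since `f` is not affine, `1` and `f'` are linearly independent on `I`.
  have hN : ∀ x y, (∀ u ∈ I, x * deriv f u + y = 0) → x = 0 ∧ y = 0 := by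
    intro x y h
    have hx : x = 0 := by
      by_contra hx
      obtain ⟨s, hs⟩ := exists_eq_affine_of_deriv hI hIc hf (r := -y / x) fun u hu => by
        rw [eq_div_iff hx]; linear_combination h u hu
      exact hna' _ _ hs
    obtain ⟨u, hu⟩ := hIc.nonempty
    have := h u hu
    rw [hx, zero_mul, zero_add] at this
    exact ⟨hx, this⟩
  have hM : ∀ l n w k, (∀ u ∈ I, f u = l * deriv f u + n) →
      ¬ ∀ u ∈ I, (u - w) * deriv f u = k := fun l n w k h1 h2 =>
    hd0 (deriv_eq_zero_of_two hI hf h1 h2)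
  obtain ⟨p, hp⟩ := hnt
  by_cases hα : α p = 0
  · have ha : a ≠ 0 := by
      rintro rfl
      have hb := (hN (β p) (E p) fun u hu => by
        have := hode p u hu
        rw [hα] at this
        linear_combination this).1
      exact hp.elim (fun h => h hα) fun h => h.elim (fun h => h hb) fun h => h rfl
    have h1 : ∀ u ∈ I, f u = -β p / (2 * a) * deriv f u + -E p / (2 * a) := by
      intro u hu
      have := hode p u hu
      rw [hα] at this
      field_simp
      linear_combination this
    -- A point with `α q ≠ 0` would, after substitution of `h1` for `f`, give the second relation
    -- excluded by `hM`.
    have h2 : ∀ q, α q = 0 := by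
      intro q
      by_contra hq
      generalize -β p / (2 * a) = l at h1
      generalize -E p / (2 * a) = n at h1
      refine hM l n (-(β q + (2 * a - 3 * α q) * l) / α q)
        (-((2 * a - 3 * α q) * n + E q) / α q) h1 fun u hu => ?_
      have := hode q u hu
      rw [h1 u hu] at this
      field_simp
      linear_combination this
    have h3 : ∀ q, β q = β p := by
      intro q
      refine sub_eq_zero.1 (hN (β q - β p) (E q - E p) fun u hu => ?_).1
      have e1 := hode q u hu
      have e2 := hode p u hu
      rw [h2] at e1 e2
      linear_combination e1 - e2
    -- Now `β` is constant, so the inhomogeneity vanishes and `f = l f'` remains.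
    have h4 := hE 0 (β p) fun q => by rw [h3 q]; ring
    refine isEquivListed_of_exp hI hIc hf hna' (l := -β p / (2 * a)) fun u hu => ?_
    rw [h1 u hu, h4 p]
    ring
  · set w := -β p / α p with hw
    set s := -(2 * a - 3 * α p) / α p with hs
    set ε := E p / α p with hε
    have h1 : ∀ u ∈ I, (u - w) * deriv f u = s * f u - ε := by
      intro u hu
      rw [hw, hs, hε]
      field_simp
      linear_combination hode p u hu
    have h2 : ∀ q, ∀ u ∈ I, (α q * s + (2 * a - 3 * α q)) * f u
        + (β q + α q * w) * deriv f u + (E q - α q * ε) = 0 := fun q u hu => by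
      linear_combination hode q u hu - α q * h1 u hu
    -- Otherwise `h2` could be solved for `f`, which contradicts `hM` when combined with `h1`.
    have h3 : ∀ q, α q * s + (2 * a - 3 * α q) = 0 := by
      intro q
      by_contra hx
      set x := α q * s + (2 * a - 3 * α q)
      have hfl : ∀ u ∈ I, f u = -(β q + α q * w) / x * deriv f u + -(E q - α q * ε) / x := by
        intro u hu
        field_simp
        linear_combination h2 q u hu
      refine hM _ _ (w + s * (-(β q + α q * w) / x)) (s * (-(E q - α q * ε) / x) - ε) hfl
        fun u hu => ?_
      linear_combination h1 u hu + s * hfl u hu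
    have h4 : ∀ q, β q + α q * w = 0 ∧ E q - α q * ε = 0 := fun q => hN _ _ fun u hu => by
      have := h2 q u hu
      rw [h3 q] at this
      linear_combination this
    -- All points share the singular point `w`, that is `β = -w α`; so `E` vanishes and `h1` becomes
    -- Euler's equation.
    have h5 := hE (-w) 0 fun q => by linear_combination (h4 q).1
    have h6 : ε = 0 := by rw [hε, h5 p, zero_div]
    refine isEquivListed_of_euler hI hIc hf hna' (s := s) (w := w) fun u hu => ?_
    rw [h1 u hu, h6, sub_zero]

end

/-! ### Enlarged symmetry algebras and the list -/

section

variable {Ω : Set H1} {I : Set ℝ} {f : ℝ → ℝ}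

/-- The classification is applied to a symmetry outside the basic span, with `E = Δβ`. Its
hypothesis on `E` holds because `α = a - m/2` and constants are annihilated by `Δ`. -/
theorem isEquivListed_of_not_symSpannedBy (hΩ : IsOpen Ω) (hΩc : IsConnected Ω) (hI : IsOpen I)
    (hIc : IsConnected I) (hf : ContDiffOn ℝ ∞ f I) (h : ¬ SymSpannedBy Ω I f basic) :
    IsEquivListed I f := by
  have hf' := differentiableAt_of_contDiffOn hI hf
  obtain ⟨V, hV, hVn⟩ : ∃ V, IsSym Ω I f V ∧ ¬ SpannedOn (Ω ×ˢ I) basic V := by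
    by_contra! hall
    exact h fun V => ⟨hall V, isSym_of_spannedOn_basic hΩ hΩc hI hIc hf'⟩
  obtain ⟨c, a, β, hβ, he, hode⟩ := (isSym_iff_exists hΩ hΩc hI hIc hf').1 hV
  have hα : ContDiffOn ℝ ∞ (fun p => a - confFactor c p / 2) Ω :=
    contDiffOn_const.sub ((contDiff_confFactor c).contDiffOn.div_const 2)
  refine isEquivListed_of_determining (ι := Ω) hI hIc hf (a := a)
    (α := fun p => a - confFactor c p / 2) (β := fun p => β p) (E := fun p => kohnLaplace β p)
    (fun p u hu => ?_) (fun r s hrs p => ?_) ?_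
  · linear_combination hode p p.2 u hu
  · have h1 : ∀ q ∈ Ω, β q = r * (a - confFactor c q / 2) + s * 1 := fun q hq => by
      rw [mul_one]; exact hrs ⟨q, hq⟩
    rw [kohnLaplace_congr hΩ h1 p.2, kohnLaplace_lin hΩ r s hα contDiffOn_const p.2,
      kohnLaplace_factor, kohnLaplace_const]
    ring
  · by_contra! hall
    obtain ⟨p₀, hp₀⟩ := hΩc.nonempty
    have ha : a = 0 := (hall ⟨p₀, hp₀⟩).2.2
    subst ha
    obtain ⟨W, hW, hW'⟩ := spannedOn_basic_genField (I := I) hΩ hΩc.nonempty (c := c) (β := β)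
      (fun p hp => by linarith [(hall ⟨p, hp⟩).1]) fun p hp => (hall ⟨p, hp⟩).2.1
    exact hVn ⟨W, hW, he.trans hW'⟩

/-- A symmetry which moves the unknown is not a combination of the basic ones. -/
theorem not_symSpannedBy_of_vertical {V : VField} (hV : IsSym Ω I f V) {z : H1 × ℝ}
    (hz : z ∈ Ω ×ˢ I) (hVz : (V z).2 ≠ 0) : ¬ SymSpannedBy Ω I f basic := fun h =>
  hVz (vertical_eq_zero_of_spannedOn_basic ((h V).1 hV) z hz)

theorem deriv_eq_of_eqOn (hI : IsOpen I) {g : ℝ → ℝ} {g' u : ℝ} (h : ∀ s ∈ I, f s = g s)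
    (hu : u ∈ I) (hg : HasDerivAt g g' u) : deriv f u = g' :=
  (hg.congr_of_eventuallyEq (Filter.eventually_of_mem (hI.mem_nhds hu) h)).deriv

/-- Combinations of the basic fields have no vertical part. In each case a symmetry with nonzero
vertical part is exhibited: `∂ᵤ` for constants, and otherwise `Z₂`, `Z` or `Z₃` for the unknown `v =
a u + b`, written in terms of `u`. -/
theorem not_symSpannedBy_of_isEquivListed (hΩ : IsOpen Ω) (hΩc : IsConnected Ω) (hI : IsOpen I)
    (hIc : IsConnected I) (hf : ContDiffOn ℝ ∞ f I) (h : IsEquivListed I f) :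
    ¬ SymSpannedBy Ω I f basic := by
  have hf' := differentiableAt_of_contDiffOn hI hf
  obtain ⟨p₀, hp₀⟩ := hΩc.nonempty
  have hconst : ∀ b : ℝ, ContDiffOn ℝ ∞ (fun _ : H1 => b) Ω := fun b => contDiffOn_const
  obtain ⟨a, b, ha, hl⟩ := h
  -- At a point with `a v + b ≠ 0` the fields `Z₂` and `Z` for the new unknown really move it.
  obtain ⟨v, hv, hvb⟩ := exists_mem_ne hI hIc.nonempty (-b / a)
  have hv0 : v + b / a ≠ 0 := fun h0 => hvb (by linear_combination h0)
  have hlin : ∀ u, HasDerivAt (fun u => a * u + b) a u := fun u => by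
    simpa using ((hasDerivAt_id u).const_mul a).add_const b
  have hinv : ∀ u, (a * u + b - b) / a = u := fun u => by field_simp; ring
  rcases hl with ⟨k, hk⟩ | ⟨k, -, hk⟩ | ⟨k, p, -, hp0, hp1, hpd, hk⟩ | ⟨k, -, hk⟩ <;>
    rw [Set.forall_mem_image] at hk <;> simp only [hinv] at hk
  · have hfe : ∀ u ∈ I, f u = k / a := fun u hu => by
      rw [eq_div_iff ha, mul_comm]; exact hk hu
    refine not_symSpannedBy_of_vertical (IsSym.of_genField hΩ hIc.nonempty hf' (hconst 1)
      (vertical_eq _) fun p hp u hu => ?_) (z := (p₀, v)) ⟨hp₀, hv⟩ one_ne_zero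
    rw [kohnLaplace_const, deriv_eq_of_eqOn hI hfe hu (hasDerivAt_const u _)]
    simp [confFactor]
  · have hfe : ∀ u ∈ I, f u = k / a * (a * u + b) := fun u hu => by
      field_simp; linear_combination hk hu
    refine not_symSpannedBy_of_vertical (V := genField 0 1 fun _ => b / a)
      (IsSym.of_genField hΩ hIc.nonempty hf' (hconst _) rfl fun p hp u hu => ?_)
      (z := (p₀, v)) ⟨hp₀, hv⟩ (by simpa [genField, affineField, confFactor] using hv0)
    rw [kohnLaplace_const, deriv_eq_of_eqOn hI hfe hu ((hlin u).const_mul _), hfe u hu]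
    simp only [confFactor, Pi.zero_apply]
    field_simp
    ring
  · have hfe : ∀ u ∈ I, f u = k / a * (a * u + b) ^ p := fun u hu => by
      field_simp; linear_combination hk hu
    have hp1' : 1 - p ≠ 0 := sub_ne_zero.2 hp1.symm
    refine not_symSpannedBy_of_vertical (V := genField ![0, 0, 0, 1, 0, 0, 0, 0] (1 + 2 / (1 - p))
      fun _ => 2 / (1 - p) * (b / a))
      (IsSym.of_genField hΩ hIc.nonempty hf' (hconst _) rfl fun q hq u hu => ?_)
      (z := (p₀, v)) ⟨hp₀, hv⟩ ?_
    · have hd := (hlin u).rpow_const (p := p) (hpd.ne_zero_or hp0 ⟨u, hu, rfl⟩)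
      rw [kohnLaplace_const, deriv_eq_of_eqOn hI hfe hu (hd.const_mul _), hfe u hu,
        ← mul_rpow_sub_one hp0 (a * u + b)]
      simp [confFactor]
      field_simp
      ring
    · have := mul_ne_zero (div_ne_zero two_ne_zero hp1') hv0
      simpa [genField, affineField, confFactor, mul_add] using this
  · have hfe : ∀ u ∈ I, f u = k / a * Real.exp (a * u + b) := fun u hu => by
      field_simp; linear_combination hk hu
    refine not_symSpannedBy_of_vertical (V := genField ![0, 0, 0, 1, 0, 0, 0, 0] 1
      fun _ => -2 / a)
      (IsSym.of_genField hΩ hIc.nonempty hf' (hconst _) rfl fun q hq u hu => ?_)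
      (z := (p₀, v)) ⟨hp₀, hv⟩ (by simpa [genField, affineField, confFactor] using ha)
    rw [kohnLaplace_const, deriv_eq_of_eqOn hI hfe hu ((hlin u).exp.const_mul _), hfe u hu]
    simp [confFactor]
    field_simp
    ring

end

end Heis

theorem mainTheorem1
    (Ω : Set H1) (hΩ : IsOpen Ω) (hΩc : IsConnected Ω)
    (I : Set ℝ) (hI : IsOpen I) (hIc : IsConnected I) :
    -- the basic generators: translation in `t`, rotation, and right-invariant fields
    (IsFlow (fun s p => ![p 0, p 1, p 2 + s]) fieldT ∧
      IsFlow (fun s p => ![p 0 * Real.cos s + p 1 * Real.sin s,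
        -p 0 * Real.sin s + p 1 * Real.cos s, p 2]) fieldR ∧
      IsFlow (fun s p => Heis.mul ![s, 0, 0] p) fieldX ∧
      IsFlow (fun s p => Heis.mul ![0, s, 0] p) fieldY) ∧
    -- arbitrary `f`: they are symmetries for every `f`, and no others are
    (∀ f : ℝ → ℝ, ContDiffOn ℝ ∞ f I → ∀ V ∈ basic, IsSym Ω I f V) ∧
    (∀ V : VField, (∀ f : ℝ → ℝ, ContDiffOn ℝ ∞ f I → IsSym Ω I f V) ↔
      SpannedOn (Ω ×ˢ I) basic V) ∧
    -- the algebra is enlarged exactly for the listed `f`, up to `v = a u + b`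
    (∀ f : ℝ → ℝ, ContDiffOn ℝ ∞ f I →
      (¬ SymSpannedBy Ω I f basic ↔ IsEquivListed I f)) ∧
    -- `f = 0`
    SymSpannedBy Ω I (fun _ => 0) (gensZero Ω) ∧
    -- `f = c`
    (∀ c : ℝ,
      (∀ w : H1 → ℝ, IsSolution Ω (fun _ => c) w ↔
        IsSolution Ω (fun _ => 0) (fun p => w p + c * (p 0) ^ 2 / 2)) ∧
      SymSpannedBy Ω I (fun _ => c) (VectorField.pullback ℝ (shift c) '' gensZero Ω)) ∧
    -- `f = k u`
    (∀ k : ℝ, k ≠ 0 →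
      SymSpannedBy Ω I (fun u => k * u) (basic ∪ {fieldZ2} ∪ fieldsW Ω k)) ∧
    -- `f = k u ^ p`
    (∀ k p : ℝ, k ≠ 0 → p ≠ 0 → p ≠ 1 → p ≠ 3 → PowerDomain p I →
      SymSpannedBy Ω I (fun u => k * u ^ p) (basic ∪ {fieldZ p})) ∧
    (∀ k : ℝ, k ≠ 0 →
      SymSpannedBy Ω I (fun u => k * u ^ (3 : ℝ))
        (basic ∪ {fieldZ 3, fieldV1, fieldV2, fieldV3})) ∧
    -- `f = k e ^ u`
    (∀ k : ℝ, k ≠ 0 →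
      SymSpannedBy Ω I (fun u => k * Real.exp u) (basic ∪ {fieldZ3})) := by
  refine ⟨⟨isFlow_fieldT, isFlow_fieldR, isFlow_fieldX, isFlow_fieldY⟩, fun f hf V hV =>
    isSym_basic hΩ hIc.nonempty (differentiableAt_of_contDiffOn hI hf) hV,
    isSym_forall_iff hΩ hΩc hI hIc, fun f hf =>
      ⟨isEquivListed_of_not_symSpannedBy hΩ hΩc hI hIc hf,
        not_symSpannedBy_of_isEquivListed hΩ hΩc hI hIc hf⟩,
    symSpannedBy_zero hΩ hΩc hI hIc, fun c =>
      ⟨isSolution_const_iff hΩ c, symSpannedBy_const hΩ hΩc hI hIc c⟩,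
    fun k hk => symSpannedBy_linear hΩ hΩc hI hIc hk,
    fun k p hk hp0 hp1 hp3 hp => symSpannedBy_power hΩ hΩc hI hIc hk hp0 hp1 hp3 hp,
    fun k hk => symSpannedBy_cube hΩ hΩc hI hIc hk,
    fun k hk => symSpannedBy_exp hΩ hΩc hI hIc hk⟩
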